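/- Let $n\ge 1$, $V_n=M(n,\mathbb C)$ with $\langle x,y\rangle=\operatorname{Re}\operatorname{tr}(xy^*)$, let $K_n=U(n)\times U(n)$ act on $V_n$ by $(u_1,u_2)\cdot x=u_1xu_2^*$, and let $G_n=K_n\ltimes V_n$ with the law $(u,x)(v,y)=((u_1v_1,u_2v_2),\,x+u_1yu_2^*)$. A spherical function of positive type of the Gelfand pair $(G_n,K_n)$ is a continuous $K_n$-biinvariant function $\varphi$ of positive type on $G_n$ with $\varphi(e)=1$ and $$\int_{K_n}\varphi(gkh)\,dk=\varphi(g)\varphi(h)\qquad(g,h\in G_n),$$ where $dk$ is the normalized Haar measure of $K_n$; by right $K_n$-invariance it is a function on $V_n$. For $x=(x_1,\dots,x_n)\in\mathbb R^n$, identified with $\mathrm{diag}(x_1,\dots,x_n)$, let $\mu_x$ be the orbital measure on $V_n$, that is, the image of the measure $\alpha\otimes\alpha$ under $(u,v)\mapsto uxv^*$, with $\alpha$ the normalized Haar measure of $U(n)$, and let $\varphi_x(\xi)=\widehat{\mu_x}(\xi)=\int_{V_n}e^{i\langle\xi,y\rangle}\,\mu_x(dy)$ be its Fourier transform. The spherical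 functions of positive type of $(G_n,K_n)$ are exactly the functions $\varphi_x$, $x\in\mathbb R^n$. Moreover, for $x=\mathrm{diag}(x_1,\dots,x_n)$ and $\xi=\mathrm{diag}(\xi_1,\dots,\xi_n)$ with real entries, $$\varphi_x(\xi)=(\delta!)^2\,\frac{(-4)^{n(n-1)/2}}{D(x)D(\xi)}\,\det\big(J_0(x_j\xi_k)\big)_{1\le j,k\le n},$$ where $D(x)=\prod_{i<j}(x_i^2-x_j^2)$, $\delta=(n-1,n-2,\dots,0)$, $\delta!=\delta_1!\cdots\delta_n!$ and $J_0(t)=\sum_{k\ge0}\frac{(-1)^k}{4^k(k!)^2}t^{2k}$ is the Bessel function. If $D(x)D(\xi)=0$, the right-hand side is understood as its limit along points $(x',\xi')\to(x,\xi)$ in $\mathbb R^n\times\mathbb R^n$ with $D(x')D(\xi')\neq0$. -/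

import Mathlib

open MeasureTheory Filter Topology
open scoped ComplexOrder

noncomputable section

namespace SphericalMatrix

/-- The space `V_n = M(n, ℂ)` of complex `n × n` matrices. -/
abbrev V (n : ℕ) : Type := Matrix (Fin n) (Fin n) ℂ

/-- The unitary group `U(n)`. -/
abbrev U (n : ℕ) : Type := Matrix.unitaryGroup (Fin n) ℂ

/-- The group `K_n = U(n) × U(n)`. -/
abbrev K (n : ℕ) : Type := U n × U n

instance (n : ℕ) : MeasurableSpace (V n) := borel _

instance (n : ℕ) : BorelSpace (V n) := ⟨rfl⟩

instance (n : ℕ) : MeasurableSpace (U n) := borel _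

instance (n : ℕ) : BorelSpace (U n) := ⟨rfl⟩

instance (n : ℕ) : CompactSpace (U n) := by
  have hsub : ((Matrix.unitaryGroup (Fin n) ℂ : Submonoid (V n)) : Set (V n)) ⊆
      Set.univ.pi fun _ => Set.univ.pi fun _ => Metric.closedBall (0 : ℂ) 1 := by
    intro A hA i _ j _
    simpa using entry_norm_bound_of_unitary hA i j
  have hbox : IsCompact (Set.univ.pi fun _ : Fin n => Set.univ.pi fun _ : Fin n =>
      Metric.closedBall (0 : ℂ) 1) :=
    isCompact_univ_pi fun _ => isCompact_univ_pi fun _ => isCompact_closedBall 0 1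
  have hcl : IsClosed ((Matrix.unitaryGroup (Fin n) ℂ : Submonoid (V n)) : Set (V n)) :=
    isClosed_unitary
  exact isCompact_iff_compactSpace.mp (hbox.of_isClosed_subset hcl hsub)

/-- The normalized Haar measure of `U(n)`. -/
def haarU (n : ℕ) : Measure (U n) := Measure.haarMeasure ⊤

/-- The normalized Haar measure of `K_n`. -/
def haarK (n : ℕ) : Measure (K n) := (haarU n).prod (haarU n)

/-- The action of `K_n` on the additive group of `V_n`: `(u, v) . x = u x v*`. -/
def action (n : ℕ) : K n →* MulAut (Multiplicative (V n)) where
  toFun k :=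
    { toFun := fun x => Multiplicative.ofAdd
        ((k.1 : V n) * Multiplicative.toAdd x * star (k.2 : V n))
      invFun := fun x => Multiplicative.ofAdd
        (star (k.1 : V n) * Multiplicative.toAdd x * (k.2 : V n))
      left_inv := fun x => by
        have h1 : star (k.1 : V n) * (k.1 : V n) = 1 := Unitary.coe_star_mul_self k.1
        have h2 : star (k.2 : V n) * (k.2 : V n) = 1 := Unitary.coe_star_mul_self k.2
        apply Multiplicative.toAdd.injective
        simp only [toAdd_ofAdd]
        calc _ = (star (k.1 : V n) * (k.1 : V n)) * Multiplicative.toAdd x *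
              (star (k.2 : V n) * (k.2 : V n)) := by simp only [mul_assoc]
          _ = _ := by rw [h1, h2, one_mul, mul_one]
      right_inv := fun x => by
        have h1 : (k.1 : V n) * star (k.1 : V n) = 1 := Unitary.coe_mul_star_self k.1
        have h2 : (k.2 : V n) * star (k.2 : V n) = 1 := Unitary.coe_mul_star_self k.2
        apply Multiplicative.toAdd.injective
        simp only [toAdd_ofAdd]
        calc _ = ((k.1 : V n) * star (k.1 : V n)) * Multiplicative.toAdd x *
              ((k.2 : V n) * star (k.2 : V n)) := by simp only [mul_assoc]
          _ = _ := by rw [h1, h2, one_mul, mul_one]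
      map_mul' := fun x y => by
        apply Multiplicative.toAdd.injective
        simp only [toAdd_ofAdd, toAdd_mul, mul_add, add_mul] }
  map_one' := by
    ext x : 1
    apply Multiplicative.toAdd.injective
    simp
  map_mul' k l := by
    ext x : 1
    apply Multiplicative.toAdd.injective
    simp [mul_assoc]

/-- The group `G_n = K_n ⋉ V_n`, with `(u, x)(v, y) = (u v, x + u₁ y u₂*)`; the translation part
of `g` is `g.left` and its unitary part is `g.right`. -/
abbrev G (n : ℕ) : Type := Multiplicative (V n) ⋊[action n] K n

/-- `G_n` carries the product topology of `V_n × K_n`. -/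
instance (n : ℕ) : TopologicalSpace (G n) :=
  TopologicalSpace.induced (fun g => (Multiplicative.toAdd g.left, g.right))
    (inferInstance : TopologicalSpace (V n × K n))

/-- The embedding of `K_n` into `G_n` as a subgroup, `k ↦ (k, 0)`. -/
def ofK {n : ℕ} : K n →* G n := SemidirectProduct.inr

/-- The spherical functions of positive type of the pair `(G_n, K_n)`: the continuous
`K_n`-biinvariant functions `φ` on `G_n` of positive type with `φ(1) = 1` that satisfy the
functional equation `∫_{K_n} φ(g k h) dk = φ(g) φ(h)`. -/
structure IsSphericalOfPositiveType {n : ℕ} (φ : G n → ℂ) : Prop where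
  continuous : Continuous φ
  map_one : φ 1 = 1
  biinvariant : ∀ (k l : K n) (g : G n), φ (ofK k * g * ofK l) = φ g
  positiveType : ∀ (m : ℕ) (g : Fin m → G n),
    (Matrix.of fun i j => φ ((g i)⁻¹ * g j)).PosSemidef
  functionalEquation : ∀ g h : G n, ∫ k, φ (g * ofK k * h) ∂(haarK n) = φ g * φ h

/-- The orbital measure `μ_x`, the image of the Haar measure under `(u, v) ↦ u x v*`. -/
def orbitalMeasure {n : ℕ} (x : V n) : Measure (V n) :=
  (haarK n).map fun k => (k.1 : V n) * x * star (k.2 : V n)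

/-- The Fourier transform `ξ ↦ ∫ exp(i ⟨ξ, y⟩) μ(dy)` of a measure on `V_n`, where
`⟨ξ, y⟩ = Re tr(ξ y*)`. -/
def fourier {n : ℕ} (μ : Measure (V n)) (ξ : V n) : ℂ :=
  ∫ y, Complex.exp (Complex.I * (((ξ * star y).trace.re : ℝ) : ℂ)) ∂μ

/-- The diagonal matrix with real diagonal entries `x_1, …, x_n`. -/
def diag {n : ℕ} (x : Fin n → ℝ) : V n := Matrix.diagonal fun i => (x i : ℂ)

/-- The Bessel function `J_0`, by its everywhere convergent power series. -/
def besselJ0 (t : ℝ) : ℝ :=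
  ∑' k : ℕ, (-1 : ℝ) ^ k / (2 ^ (2 * k) * (k.factorial : ℝ) ^ 2) * t ^ (2 * k)

/-- `D(x) = ∏_{i < j} (x_i² - x_j²)`. -/
def D {n : ℕ} (x : Fin n → ℝ) : ℝ := ∏ i, ∏ j ∈ Finset.Ioi i, (x i ^ 2 - x j ^ 2)

/-- `δ! = δ_1! ⋯ δ_n!` for `δ = (n - 1, n - 2, …, 0)`. -/
def deltaFactorial (n : ℕ) : ℕ := ∏ j : Fin n, (n - 1 - (j : ℕ)).factorial

/-- The expression `(δ!)² (-4)^{n(n-1)/2} det(J_0(x_j ξ_k)) / (D(x) D(ξ))`; it is meaningful where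
`D(x) D(ξ) ≠ 0`. -/
def besselQuotient {n : ℕ} (x ξ : Fin n → ℝ) : ℝ :=
  (deltaFactorial n : ℝ) ^ 2 * ((-4) ^ (n * (n - 1) / 2) / (D x * D ξ)) *
    (Matrix.of fun j k => besselJ0 (x j * ξ k)).det

end SphericalMatrix

end

open scoped Matrix ContDiff

namespace SphericalMatrix

noncomputable section

/-! ### Haar measure on the compact group `K_n` -/

section Haar

variable {n : ℕ}

/-! Let `spherical x ξ` be the average of exp(i⟨ξ, k·x⟩) over `K n`, that is, the Fourier transform
of the orbital measure. It is a spherical function of positive type by Fubini and by its symmetry in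
x and ξ. Conversely, a spherical φ of positive type restricts to a function f on V_n, and Bochner's
theorem (`IsPositiveType.exists_charFun_eq`) makes f the Fourier transform of a probability measure
μ. The functional equation forces y ↦ `spherical y η` to equal the constant f(η) μ-almost everywhere
(`ae_spherical_eq`). Hence f is `spherical y` for a single y, and the singular value decomposition
moves y to a real diagonal matrix.

The determinant formula rests on radial parts. Restrict an invariant function to the diagonal
matrices and multiply by ∏(|z_i|² - |z_j|²). Because this product is harmonic (`laplacian_discr`),
the operation carries the Laplacian of V_n to the flat Laplacian of ℂ^n (`radial_laplacian`). It
also carries multiplication by tr((ξξ*)^k) to multiplication by ∑|z_i|^(2k). Taking 2k commutators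
with the Laplacian turns both multiplications into constant-coefficient operators, so the higher
invariant operators have radial parts ∑(4Δ_i)^k with no further computation. Their symbols are
constant on orbits, so spherical functions are eigenfunctions, and the radial part F satisfies
∑Δ_i^k F = ∑(-x_i²)^k F for all k.

When the x_i² are distinct, Newton's identities and Lagrange interpolation split F into joint
eigenfunctions with Δ_i-eigenvalue -x_{P(i)}² (`exists_sum_eigenvectors`). These inherit rotation
invariance from F, so each is a product of functions J_0 (`apply_ofReal_eq_prod`). Antisymmetry in ξ
gathers the products into one determinant times a constant (`exists_D_mul_spherical_eq`). The
constant comes from letting ξ tend to 0, where the spherical function is 1. The degenerate points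
follow from joint continuity. -/

instance : SecondCountableTopology (V n) :=
  inferInstanceAs (SecondCountableTopology (Fin n → Fin n → ℂ))

instance : SecondCountableTopology (U n) :=
  inferInstanceAs (SecondCountableTopology
    ((Matrix.unitaryGroup (Fin n) ℂ : Submonoid (V n)) : Set (V n)))

instance : IsTopologicalGroup (U n) :=
  inferInstanceAs (IsTopologicalGroup (unitary (Matrix (Fin n) (Fin n) ℂ)))

instance : (haarU n).IsHaarMeasure := by unfold haarU; infer_instance

instance : IsProbabilityMeasure (haarU n) := ⟨by
  have := Measure.haarMeasure_self (K₀ := (⊤ : TopologicalSpace.PositiveCompacts (U n)))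
  simpa [haarU] using this⟩

/-- A right translate of Haar measure is again a left Haar probability measure, and there is only
one. Inversion invariance then follows the same way, since right invariance makes the inverted
measure left invariant. -/
instance : (haarU n).IsMulRightInvariant := ⟨fun g => by
  have : IsProbabilityMeasure ((haarU n).map (· * g)) :=
    Measure.isProbabilityMeasure_map (measurable_mul_const g).aemeasurable
  have : ((haarU n).map (· * g)).IsHaarMeasure := inferInstance
  exact Measure.isHaarMeasure_eq_of_isProbabilityMeasure _ _⟩

instance : (haarU n).IsInvInvariant := ⟨by
  have : IsProbabilityMeasure (haarU n).inv :=
    Measure.isProbabilityMeasure_map measurable_inv.aemeasurable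
  have : (haarU n).inv.IsHaarMeasure :=
    Measure.isHaarMeasure_of_isCompact_nonempty_interior _ Set.univ isCompact_univ
      (by simp) (by simp) (by simp)
  exact Measure.isHaarMeasure_eq_of_isProbabilityMeasure _ _⟩

instance : IsProbabilityMeasure (haarK n) := by unfold haarK; infer_instance

instance : (haarK n).IsMulLeftInvariant := by unfold haarK; infer_instance

instance : (haarK n).IsInvInvariant := ⟨by
  have h := Measure.map_prod_map (haarU n) (haarU n) (f := Inv.inv) (g := Inv.inv)
    measurable_inv measurable_inv
  rw [Measure.map_inv_eq_self] at h
  exact h.symm⟩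

lemma integrable_haarK {E : Type*} [NormedAddCommGroup E] [SecondCountableTopology E]
    {f : K n → E} (hf : Continuous f) : Integrable f (haarK n) :=
  hf.integrable_of_hasCompactSupport (HasCompactSupport.of_compactSpace f)

end Haar

/-! ### The action of `K_n` on `V_n` and the pairing `Re tr(x y*)` -/

section Action

variable {n : ℕ}

/-- The action `(u, v) · x = u x v*` of `K_n` on `V_n`. -/
def act (k : K n) (x : V n) : V n := (k.1 : V n) * x * star (k.2 : V n)

/-- The real inner product `Re tr(x y*)`. -/
def pairing (x y : V n) : ℝ := (x * star y).trace.re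

lemma pairing_eq_sum (x y : V n) :
    pairing x y = ∑ i, ∑ j, (x i j * star (y i j)).re := by
  simp [pairing, Matrix.trace, Matrix.mul_apply, Matrix.star_apply]

lemma pairing_comm (x y : V n) : pairing x y = pairing y x := by
  simp only [pairing_eq_sum]
  refine Finset.sum_congr rfl fun i _ => Finset.sum_congr rfl fun j _ => ?_
  simp [mul_comm]

lemma pairing_add_left (x y z : V n) : pairing (x + y) z = pairing x z + pairing y z := by
  simp [pairing, add_mul]

lemma pairing_sub_left (x y z : V n) : pairing (x - y) z = pairing x z - pairing y z := by
  simp [pairing, sub_mul]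

@[simp] lemma pairing_zero_left (x : V n) : pairing 0 x = 0 := by simp [pairing]

lemma act_mul (k l : K n) (x : V n) : act (k * l) x = act k (act l x) := by
  simp [act, mul_assoc]

@[simp] lemma act_one (x : V n) : act 1 x = x := by simp [act]

lemma act_add (k : K n) (x y : V n) : act k (x + y) = act k x + act k y := by
  simp [act, mul_add, add_mul]

lemma act_neg (k : K n) (x : V n) : act k (-x) = - act k x := by
  simp [act]

lemma act_act_inv (k : K n) (x : V n) : act k (act k⁻¹ x) = x := by
  rw [← act_mul]; simp

lemma pairing_act_act (k : K n) (x y : V n) : pairing (act k x) (act k y) = pairing x y := by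
  have h2 : star (k.2 : V n) * (k.2 : V n) = 1 := Unitary.coe_star_mul_self k.2
  have h1 : star (k.1 : V n) * (k.1 : V n) = 1 := Unitary.coe_star_mul_self k.1
  unfold pairing act
  congr 1
  calc ((k.1 : V n) * x * star (k.2 : V n) * star ((k.1 : V n) * y * star (k.2 : V n))).trace
      = ((k.1 : V n) * (x * (star (k.2 : V n) * (k.2 : V n)) * star y * star (k.1 : V n))).trace := by
        simp only [star_mul, star_star, mul_assoc]
    _ = (x * (star (k.2 : V n) * (k.2 : V n)) * star y * (star (k.1 : V n) * (k.1 : V n))).trace := by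
        rw [Matrix.trace_mul_comm]; simp only [mul_assoc]
    _ = _ := by rw [h1, h2, mul_one, mul_one]

lemma pairing_act_left (k : K n) (x y : V n) : pairing (act k x) y = pairing x (act k⁻¹ y) := by
  conv_lhs => rw [← act_act_inv k y, pairing_act_act]

lemma Continuous.act {X : Type*} [TopologicalSpace X] {f : X → K n} {g : X → V n}
    (hf : Continuous f) (hg : Continuous g) : Continuous fun x => act (f x) (g x) := by
  have h1 : Continuous fun x => ((f x).1 : V n) :=
    continuous_subtype_val.comp (continuous_fst.comp hf)
  have h2 : Continuous fun x => star ((f x).2 : V n) :=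
    continuous_star.comp (continuous_subtype_val.comp (continuous_snd.comp hf))
  exact (h1.mul hg).mul h2

lemma continuous_pairing : Continuous fun p : V n × V n => pairing p.1 p.2 := by
  unfold pairing
  fun_prop

lemma Continuous.pairing {X : Type*} [TopologicalSpace X] {f g : X → V n}
    (hf : Continuous f) (hg : Continuous g) : Continuous fun x => pairing (f x) (g x) :=
  continuous_pairing.comp (hf.prodMk hg)

lemma Continuous.cexp_I_mul_ofReal {X : Type*} [TopologicalSpace X] {f : X → ℝ}
    (hf : Continuous f) : Continuous fun x => Complex.exp (Complex.I * (f x : ℂ)) :=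
  Complex.continuous_exp.comp (continuous_const.mul (Complex.continuous_ofReal.comp hf))

/-- The spherical function attached to the orbit of `x`. -/
def spherical (x ξ : V n) : ℂ :=
  ∫ k, Complex.exp (Complex.I * (pairing ξ (act k x) : ℝ)) ∂(haarK n)

lemma norm_cexp_I_mul_ofReal (r : ℝ) : ‖Complex.exp (Complex.I * (r : ℂ))‖ = 1 := by
  rw [mul_comm]; exact Complex.norm_exp_ofReal_mul_I r

lemma continuous_spherical : Continuous fun p : V n × V n => spherical p.1 p.2 := by
  unfold spherical
  refine continuous_of_dominated (bound := fun _ => 1) ?_ ?_ (integrable_const _) ?_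
  · intro p
    have h : Continuous fun k : K n =>
        Complex.exp (Complex.I * (pairing p.2 (act k p.1) : ℝ)) :=
      Continuous.cexp_I_mul_ofReal (Continuous.pairing continuous_const
        (Continuous.act continuous_id continuous_const))
    exact h.aestronglyMeasurable
  · intro p
    exact Eventually.of_forall fun k => (norm_cexp_I_mul_ofReal _).le
  · exact Eventually.of_forall fun k => Continuous.cexp_I_mul_ofReal
      (Continuous.pairing continuous_snd (Continuous.act continuous_const continuous_fst))

lemma fourier_orbitalMeasure (x ξ : V n) : fourier (orbitalMeasure x) ξ = spherical x ξ := by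
  unfold fourier orbitalMeasure spherical
  rw [integral_map]
  · rfl
  · have h : Continuous fun k : K n => act k x := Continuous.act continuous_id continuous_const
    exact h.measurable.aemeasurable
  · exact (Continuous.cexp_I_mul_ofReal
      (Continuous.pairing continuous_const continuous_id)).aestronglyMeasurable

lemma spherical_act_right (k : K n) (x ξ : V n) : spherical x (act k ξ) = spherical x ξ := by
  unfold spherical
  rw [← integral_mul_left_eq_self _ k]
  refine integral_congr_ae (Eventually.of_forall fun l => ?_)
  simp only [act_mul, pairing_act_act]

/-- Moving k across the pairing replaces it by its inverse, and the Haar measure is invariant under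
inversion. -/
lemma spherical_comm (x ξ : V n) : spherical x ξ = spherical ξ x := by
  unfold spherical
  rw [← integral_inv_eq_self]
  refine integral_congr_ae (Eventually.of_forall fun l => ?_)
  simp only
  rw [← pairing_act_left, pairing_comm]

lemma spherical_act_left (k : K n) (x ξ : V n) : spherical (act k x) ξ = spherical x ξ := by
  rw [spherical_comm, spherical_act_right, spherical_comm]

@[simp] lemma spherical_zero_right (x : V n) : spherical x 0 = 1 := by
  simp [spherical]

/-- After Fubini the average over k is the spherical function of η at l·x. By symmetry and
invariance it is `spherical x η` for every l, so it factors out of the average over l. -/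
lemma integral_spherical_add_act (x ξ η : V n) :
    ∫ k, spherical x (ξ + act k η) ∂(haarK n) = spherical x ξ * spherical x η := by
  have hc : Continuous fun p : K n × K n =>
      Complex.exp (Complex.I * (pairing (ξ + act p.1 η) (act p.2 x) : ℝ)) := by
    exact Continuous.cexp_I_mul_ofReal (Continuous.pairing
      (continuous_const.add (Continuous.act continuous_fst continuous_const))
      (Continuous.act continuous_snd continuous_const))
  have hint : Integrable (fun p : K n × K n =>
      Complex.exp (Complex.I * (pairing (ξ + act p.1 η) (act p.2 x) : ℝ)))
      ((haarK n).prod (haarK n)) :=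
    hc.integrable_of_hasCompactSupport (HasCompactSupport.of_compactSpace _)
  calc ∫ k, spherical x (ξ + act k η) ∂(haarK n)
      = ∫ k, ∫ l, Complex.exp (Complex.I * (pairing (ξ + act k η) (act l x) : ℝ))
          ∂(haarK n) ∂(haarK n) := rfl
    _ = ∫ l, ∫ k, Complex.exp (Complex.I * (pairing (ξ + act k η) (act l x) : ℝ))
          ∂(haarK n) ∂(haarK n) := integral_integral_swap hint
    _ = ∫ l, Complex.exp (Complex.I * (pairing ξ (act l x) : ℝ)) * spherical x η
          ∂(haarK n) := by
        refine integral_congr_ae (Eventually.of_forall fun l => ?_)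
        have : spherical x η = spherical η (act l x) := by
          rw [spherical_comm, spherical_act_right]
        simp only [this]
        unfold spherical
        rw [← integral_const_mul]
        refine integral_congr_ae (Eventually.of_forall fun k => ?_)
        simp only
        rw [pairing_add_left, pairing_comm (act k η), ← Complex.exp_add]
        push_cast
        rw [mul_add]
    _ = _ := by rw [integral_mul_const]; rfl

end Action

/-! ### Bochner's theorem in finite dimension -/

section Bochner

variable {E : Type*} [NormedAddCommGroup E]

/-- Functions of positive type on an additive group. -/
def IsPositiveType (φ : E → ℂ) : Prop :=
  ∀ (m : ℕ) (g : Fin m → E), (Matrix.of fun i j => φ (g j - g i)).PosSemidef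

lemma IsPositiveType.map_neg {φ : E → ℂ} (h : IsPositiveType φ) (ξ : E) :
    φ (-ξ) = star (φ ξ) := by
  have := (h 2 ![0, ξ]).1.apply 1 0
  simpa using this.symm

/-- The 2 × 2 positive matrix of the points 0 and ξ has determinant 1 - |φ(ξ)|². -/
lemma IsPositiveType.norm_le_one {φ : E → ℂ} (h : IsPositiveType φ) (h0 : φ 0 = 1) (ξ : E) :
    ‖φ ξ‖ ≤ 1 := by
  have h1 := (h 2 ![0, ξ]).det_nonneg
  rw [Matrix.det_fin_two] at h1
  simp only [Matrix.of_apply, Matrix.cons_val_zero, Matrix.cons_val_one, sub_self, h0, sub_zero,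
    zero_sub, h.map_neg, mul_one] at h1
  have h2 : φ ξ * star (φ ξ) = ((‖φ ξ‖ ^ 2 : ℝ) : ℂ) := by
    rw [Complex.star_def, Complex.mul_conj, Complex.normSq_eq_norm_sq]
  rw [h2] at h1
  have h3 : (0 : ℝ) ≤ 1 - ‖φ ξ‖ ^ 2 := by exact_mod_cast h1
  nlinarith [norm_nonneg (φ ξ)]

/-- The matrices of a function of positive type, twisted by a character, have nonnegative sums. -/
lemma IsPositiveType.sum_nonneg {φ : E → ℂ} (h : IsPositiveType φ) (χ : E → ℝ)
    (hχ : ∀ ξ η, χ (ξ - η) = χ ξ - χ η) (m : ℕ) (g : Fin m → E) :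
    0 ≤ ∑ i, ∑ j, (φ (g j - g i) * Complex.exp (-(Complex.I * (χ (g j - g i) : ℝ)))).re := by
  have h1 := (h m g).dotProduct_mulVec_nonneg
    (fun j => Complex.exp (-(Complex.I * (χ (g j) : ℝ))))
  have h2 := (Complex.le_def.mp h1).1
  simp only [Complex.zero_re, dotProduct, Matrix.mulVec, Pi.star_apply, Finset.mul_sum,
    Matrix.of_apply, Complex.re_sum] at h2
  refine h2.trans_eq (Finset.sum_congr rfl fun i _ => Finset.sum_congr rfl fun j _ => ?_)
  have : star (Complex.exp (-(Complex.I * (χ (g i) : ℝ)))) =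
      Complex.exp (Complex.I * (χ (g i) : ℝ)) := by
    rw [Complex.star_def, ← Complex.exp_conj]
    simp
  rw [this, hχ, mul_left_comm, ← Complex.exp_add]
  congr 3
  push_cast
  ring

variable [MeasurableSpace E] [BorelSpace E] [SecondCountableTopology E]

/-- Positivity of sums over finite samples implies positivity of the mean. -/
lemma integral_sub_nonneg_of_sum_nonneg {F : E → ℝ} (hF : Continuous F) (hb : ∀ ξ, |F ξ| ≤ 1)
    (hs : ∀ (m : ℕ) (g : Fin m → E), 0 ≤ ∑ i, ∑ j, F (g j - g i))
    (P : Measure E) [IsProbabilityMeasure P] :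
    0 ≤ ∫ p : E × E, F (p.2 - p.1) ∂(P.prod P) := by
  set J := ∫ p : E × E, F (p.2 - p.1) ∂(P.prod P) with hJ
  have hcont : Continuous fun p : E × E => F (p.2 - p.1) := by fun_prop
  -- Take m independent samples with law P: the m diagonal terms contribute at most m, and each of
  -- the m(m - 1) others has expectation J.
  have key : ∀ m : ℕ, 0 ≤ (m : ℝ) + (m : ℝ) * (m - 1) * J := by
    intro m
    let Q : Measure (Fin m → E) := Measure.pi fun _ => P
    have hint : ∀ i j : Fin m, Integrable (fun g : Fin m → E => F (g j - g i)) Q := by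
      intro i j
      refine Integrable.of_bound (C := 1) ?_ (Eventually.of_forall fun g => by simpa using hb _)
      exact (hF.measurable.comp ((measurable_pi_apply j).sub
        (measurable_pi_apply i))).aestronglyMeasurable
    have h0 : 0 ≤ ∫ g, ∑ i, ∑ j, F (g j - g i) ∂Q := integral_nonneg fun g => hs m g
    rw [integral_finsetSum _ fun i _ => integrable_finsetSum _ fun j _ => hint i j] at h0
    simp_rw [integral_finsetSum _ fun j _ => hint _ j] at h0
    have hoff : ∀ i j : Fin m, i ≠ j → ∫ g, F (g j - g i) ∂Q = J := by
      intro i j hij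
      have hind : ProbabilityTheory.iIndepFun (fun (i : Fin m) (g : Fin m → E) => g i) Q :=
        ProbabilityTheory.iIndepFun_pi (X := fun _ => id) fun _ => aemeasurable_id
      have h2 := hind.indepFun hij
      rw [ProbabilityTheory.indepFun_iff_map_prod_eq_prod_map_map
        (measurable_pi_apply i).aemeasurable (measurable_pi_apply j).aemeasurable,
        (measurePreserving_eval (fun _ => P) i).map_eq,
        (measurePreserving_eval (fun _ => P) j).map_eq] at h2
      rw [hJ, ← h2, integral_map]
      · exact ((measurable_pi_apply i).prodMk (measurable_pi_apply j)).aemeasurable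
      · exact hcont.measurable.aestronglyMeasurable
    have hdiag : ∀ i : Fin m, ∫ g, F (g i - g i) ∂Q ≤ 1 := by
      intro i
      simp only [sub_self, integral_const, probReal_univ, one_smul]
      exact (le_abs_self _).trans (hb 0)
    have hsum : ∑ i, ∑ j, ∫ g, F (g j - g i) ∂Q ≤ ∑ i : Fin m, (1 + ((m : ℝ) - 1) * J) := by
      refine Finset.sum_le_sum fun i _ => ?_
      rw [← Finset.add_sum_erase _ _ (Finset.mem_univ i)]
      have : ∑ j ∈ Finset.univ.erase i, ∫ g, F (g j - g i) ∂Q = ((m : ℝ) - 1) * J := by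
        rw [Finset.sum_congr rfl fun j hj => hoff i j (Finset.ne_of_mem_erase hj).symm]
        have hm : 1 ≤ m := Nat.one_le_iff_ne_zero.mpr fun h => by subst h; exact i.elim0
        simp [Finset.card_erase_of_mem, Nat.cast_sub hm]
      rw [this]
      linarith [hdiag i]
    have := h0.trans hsum
    simp only [Finset.sum_const, Finset.card_univ, Fintype.card_fin, nsmul_eq_mul] at this
    linarith
  by_contra hneg
  push Not at hneg
  -- For this m, (m - 1)(-J) exceeds 1, so m + m(m - 1)J is negative.
  obtain ⟨m, hm⟩ := exists_nat_gt (1 + 1 / (-J))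
  have hJ' : 0 < -J := by linarith
  have h1 : 0 < 1 / (-J) := by positivity
  have hm1 : (1 : ℝ) < (m : ℝ) := by linarith
  have h2 : 1 < ((m : ℝ) - 1) * (-J) := by
    have : 1 / (-J) < (m : ℝ) - 1 := by linarith
    rwa [div_lt_iff₀ hJ'] at this
  nlinarith [key m]

end Bochner

/-! ### Gaussian regularization and construction of the representing measure -/

section Bochner

variable {E : Type*} [NormedAddCommGroup E] [InnerProductSpace ℝ E] [FiniteDimensional ℝ E]
  [MeasurableSpace E] [BorelSpace E]

lemma integrable_rexp_neg_mul_sq_norm {b : ℝ} (hb : 0 < b) :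
    Integrable fun v : E => Real.exp (-b * ‖v‖ ^ 2) := by
  have h := (GaussianFourier.integrable_cexp_neg_mul_sq_norm_add (V := E) (b := (b : ℂ))
    (by simpa using hb) 0 0).norm
  refine h.congr (Eventually.of_forall fun v => ?_)
  simp only [zero_mul, add_zero]
  rw [show -(b : ℂ) * (‖v‖ : ℂ) ^ 2 = ((-b * ‖v‖ ^ 2 : ℝ) : ℂ) by push_cast; ring,
    ← Complex.ofReal_exp, Complex.norm_real, Real.norm_eq_abs, abs_of_pos (Real.exp_pos _)]

lemma integral_rexp_neg_mul_sq_norm_pos {b : ℝ} (hb : 0 < b) :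
    0 < ∫ v : E, Real.exp (-b * ‖v‖ ^ 2) := by
  rw [GaussianFourier.integral_rexp_neg_mul_sq_norm hb]
  positivity

lemma integrable_mul_gaussian {b : ℝ} (hb : 0 < b) {G : Type*} [NormedAddCommGroup G]
    [NormedSpace ℝ G] [SecondCountableTopology G] {F : E → G} (hF : Continuous F)
    {C : ℝ} (hC : ∀ v, ‖F v‖ ≤ C) :
    Integrable fun v : E => Real.exp (-b * ‖v‖ ^ 2) • F v := by
  refine ((integrable_rexp_neg_mul_sq_norm hb).mul_const C).mono' ?_ ?_
  · exact Continuous.aestronglyMeasurable (by fun_prop)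
  · refine Eventually.of_forall fun v => ?_
    rw [norm_smul, Real.norm_eq_abs, abs_of_pos (Real.exp_pos _)]
    exact mul_le_mul_of_nonneg_left (hC v) (Real.exp_pos _).le

/-- Positivity on finite samples, tested against Gaussian weights. -/
lemma integral_gaussian_mul_nonneg_of_sum_nonneg {F : E → ℝ} (hF : Continuous F)
    (hb : ∀ ξ, |F ξ| ≤ 1)
    (hs : ∀ (m : ℕ) (g : Fin m → E), 0 ≤ ∑ i, ∑ j, F (g j - g i)) {a : ℝ} (ha : 0 < a) :
    0 ≤ ∫ ζ : E, Real.exp (-a * ‖ζ‖ ^ 2) * F ζ := by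
  -- With this weight the difference of two independent samples has density proportional to
  -- exp(-a‖ζ‖²).
  set w : E → ℝ := fun ξ => Real.exp (-(2 * a) * ‖ξ‖ ^ 2) with hw
  have hwc : Continuous w := by fun_prop
  have hw0 : ∀ ξ, 0 < w ξ := fun ξ => Real.exp_pos _
  have hwi : Integrable w := integrable_rexp_neg_mul_sq_norm (by positivity)
  set Z := ∫ ξ, w ξ with hZ
  have hZ0 : 0 < Z := integral_rexp_neg_mul_sq_norm_pos (by positivity)
  set P : Measure E := volume.withDensity fun ξ => ENNReal.ofReal (w ξ / Z) with hP
  have hPp : IsProbabilityMeasure P := ⟨by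
    rw [hP, withDensity_apply _ MeasurableSet.univ, Measure.restrict_univ,
      ← ofReal_integral_eq_lintegral_ofReal (hwi.div_const Z)
        (Eventually.of_forall fun ξ => (div_pos (hw0 ξ) hZ0).le), integral_div,
        div_self hZ0.ne', ENNReal.ofReal_one]⟩
  have hPint : ∀ f : E → ℝ, ∫ ξ, f ξ ∂P = ∫ ξ, w ξ / Z * f ξ := by
    intro f
    rw [hP, integral_withDensity_eq_integral_toReal_smul₀]
    · refine integral_congr_ae (Eventually.of_forall fun ξ => ?_)
      simp only [smul_eq_mul]
      rw [ENNReal.toReal_ofReal (div_pos (hw0 ξ) hZ0).le]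
    · exact (ENNReal.continuous_ofReal.comp (hwc.div_const Z)).measurable.aemeasurable
    · exact Eventually.of_forall fun ξ => ENNReal.ofReal_lt_top
  have h1 := integral_sub_nonneg_of_sum_nonneg hF hb hs P
  have hI : Integrable (fun p : E × E => F (p.2 - p.1)) (P.prod P) := by
    refine Integrable.of_bound (C := 1) ?_ (Eventually.of_forall fun g => by simpa using hb _)
    exact (by fun_prop : Continuous fun p : E × E => F (p.2 - p.1)).aestronglyMeasurable
  rw [integral_prod _ hI] at h1
  simp_rw [hPint] at h1
  have h2 : ∀ ξ : E, ∫ η, w η / Z * F (η - ξ) = ∫ ζ, w (ζ + ξ) / Z * F ζ := by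
    intro ξ
    rw [← integral_add_right_eq_self (fun η => w η / Z * F (η - ξ)) ξ]
    simp
  simp_rw [h2, ← integral_const_mul] at h1
  -- Completing the square separates a factor in ζ alone from a Gaussian in ξ centred at -ζ/2, whose
  -- integral does not depend on ζ.
  have hsq : ∀ ξ ζ : E, w ξ * w (ζ + ξ) =
      Real.exp (-a * ‖ζ‖ ^ 2) * Real.exp (-(4 * a) * ‖ξ + (1 / 2 : ℝ) • ζ‖ ^ 2) := by
    intro ξ ζ
    simp only [hw]
    rw [← Real.exp_add, ← Real.exp_add]
    congr 1
    rw [norm_add_sq_real, norm_add_sq_real, norm_smul, real_inner_smul_right, real_inner_comm ξ ζ]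
    norm_num
    ring
  have hI2 : Integrable (Function.uncurry fun ξ ζ : E => w ξ / Z * (w (ζ + ξ) / Z * F ζ))
      ((volume : Measure E).prod volume) := by
    have hbase : Integrable (fun p : E × E => w p.1 * w p.2) ((volume : Measure E).prod volume) :=
      hwi.mul_prod hwi
    have hmp : MeasurePreserving (fun p : E × E => (p.1, p.2 + p.1))
        ((volume : Measure E).prod volume) (volume.prod volume) :=
      measurePreserving_prod_add_right volume volume
    have h3 := hmp.integrable_comp_of_integrable hbase
    refine (h3.const_mul (1 / (Z * Z))).mono' ?_ (Eventually.of_forall fun p => ?_)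
    · exact (by unfold Function.uncurry; fun_prop : Continuous (Function.uncurry fun ξ ζ : E =>
        w ξ / Z * (w (ζ + ξ) / Z * F ζ))).aestronglyMeasurable
    · simp only [Function.uncurry, Function.comp, norm_mul, Real.norm_eq_abs,
        abs_of_pos (div_pos (hw0 _) hZ0)]
      have := mul_le_mul_of_nonneg_left (hb p.2)
        (mul_pos (div_pos (hw0 p.1) hZ0) (div_pos (hw0 (p.2 + p.1)) hZ0)).le
      calc _ = w p.1 / Z * (w (p.2 + p.1) / Z) * |F p.2| := by ring
        _ ≤ _ := this
        _ = _ := by field_simp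
  rw [integral_integral_swap hI2] at h1
  have h4 : ∀ ζ : E, ∫ ξ, w ξ / Z * (w (ζ + ξ) / Z * F ζ) =
      (∫ ξ : E, Real.exp (-(4 * a) * ‖ξ‖ ^ 2)) / (Z * Z) * (Real.exp (-a * ‖ζ‖ ^ 2) * F ζ) := by
    intro ζ
    rw [← integral_add_right_eq_self (fun ξ : E => Real.exp (-(4 * a) * ‖ξ‖ ^ 2))
      ((1 / 2 : ℝ) • ζ), ← integral_div, ← integral_mul_const]
    refine integral_congr_ae (Eventually.of_forall fun ξ => ?_)
    simp only
    calc _ = (w ξ * w (ζ + ξ)) / (Z * Z) * F ζ := by ring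
      _ = _ := by rw [hsq]; ring
  simp_rw [h4] at h1
  rw [integral_const_mul] at h1
  have hpos : 0 < (∫ ξ : E, Real.exp (-(4 * a) * ‖ξ‖ ^ 2)) / (Z * Z) :=
    div_pos (integral_rexp_neg_mul_sq_norm_pos (by positivity)) (by positivity)
  exact nonneg_of_mul_nonneg_right h1 hpos

/-- The Gaussian regularization of the inverse Fourier transform of `φ`. -/
def gaussDensity (φ : E → ℂ) (b : ℝ) (y : E) : ℝ :=
  ∫ ζ : E, Real.exp (-b * ‖ζ‖ ^ 2) *
    (φ ζ * Complex.exp (-(Complex.I * (inner ℝ y ζ : ℝ)))).re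

variable {φ : E → ℂ}

lemma norm_exp_neg_I_mul (r : ℝ) : ‖Complex.exp (-(Complex.I * (r : ℂ)))‖ = 1 := by
  rw [show -(Complex.I * (r : ℂ)) = ((-r : ℝ) : ℂ) * Complex.I by push_cast; ring]
  exact Complex.norm_exp_ofReal_mul_I _

lemma gaussDensity_nonneg (h : IsPositiveType φ) (h0 : φ 0 = 1) (hc : Continuous φ) {b : ℝ}
    (hb : 0 < b) (y : E) : 0 ≤ gaussDensity φ b y := by
  refine integral_gaussian_mul_nonneg_of_sum_nonneg (by fun_prop) (fun ξ => ?_)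
    (fun m g => h.sum_nonneg (fun ζ => inner ℝ y ζ) (fun ξ η => inner_sub_right _ _ _) m g) hb
  refine (Complex.abs_re_le_norm _).trans ?_
  rw [norm_mul, norm_exp_neg_I_mul, mul_one]
  exact h.norm_le_one h0 ξ

lemma ofReal_gaussDensity (h : IsPositiveType φ) (h0 : φ 0 = 1) (hc : Continuous φ) {b : ℝ}
    (hb : 0 < b) (y : E) : (gaussDensity φ b y : ℂ) =
      ∫ ζ : E, (Real.exp (-b * ‖ζ‖ ^ 2) : ℂ) *
        (φ ζ * Complex.exp (-(Complex.I * (inner ℝ y ζ : ℝ)))) := by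
  set f : E → ℂ := fun ζ => (Real.exp (-b * ‖ζ‖ ^ 2) : ℂ) *
        (φ ζ * Complex.exp (-(Complex.I * (inner ℝ y ζ : ℝ)))) with hf
  have hfi : Integrable f := by
    have := integrable_mul_gaussian (E := E) hb
      (F := fun ζ => φ ζ * Complex.exp (-(Complex.I * (inner ℝ y ζ : ℝ)))) (by fun_prop)
      (C := 1) (fun v => by
        rw [norm_mul, norm_exp_neg_I_mul, mul_one]; exact h.norm_le_one h0 v)
    simpa [hf, Complex.real_smul] using this
  -- The substitution ζ ↦ -ζ undoes the conjugation, because φ(-ζ) is the conjugate of φ(ζ).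
  have hconj : (starRingEnd ℂ) (∫ ζ, f ζ) = ∫ ζ, f ζ := by
    rw [← integral_conj, ← integral_neg_eq_self]
    refine integral_congr_ae (Eventually.of_forall fun ζ => ?_)
    simp only [hf, map_mul, norm_neg, inner_neg_right, h.map_neg, ← Complex.exp_conj,
      Complex.conj_ofReal, Complex.star_def, Complex.conj_conj, map_neg, Complex.conj_I]
    push_cast
    ring_nf
  have hre := Complex.conj_eq_iff_re.mp hconj
  rw [← hre]
  congr 1
  have : (∫ ζ, f ζ).re = ∫ ζ, (f ζ).re := by
    simpa using (integral_re hfi).symm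
  rw [this]
  unfold gaussDensity
  refine integral_congr_ae (Eventually.of_forall fun ζ => ?_)
  simp only [hf, Complex.re_ofReal_mul]

lemma continuous_gaussDensity (h : IsPositiveType φ) (h0 : φ 0 = 1) (hc : Continuous φ) {b : ℝ}
    (hb : 0 < b) : Continuous (gaussDensity φ b) := by
  refine continuous_of_dominated (bound := fun ζ => Real.exp (-b * ‖ζ‖ ^ 2)) ?_ ?_
    (integrable_rexp_neg_mul_sq_norm hb) ?_
  · exact fun y => Continuous.aestronglyMeasurable (by fun_prop)
  · refine fun y => Eventually.of_forall fun ζ => ?_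
    rw [norm_mul, Real.norm_eq_abs, Real.norm_eq_abs, abs_of_pos (Real.exp_pos _)]
    refine mul_le_of_le_one_right (Real.exp_pos _).le ((Complex.abs_re_le_norm _).trans ?_)
    rw [norm_mul, norm_exp_neg_I_mul, mul_one]
    exact h.norm_le_one h0 ζ
  · exact Eventually.of_forall fun ζ => by fun_prop

lemma norm_gaussDensity_le (h : IsPositiveType φ) (h0 : φ 0 = 1) {b : ℝ}
    (hb : 0 < b) (y : E) : ‖gaussDensity φ b y‖ ≤ ∫ ζ : E, Real.exp (-b * ‖ζ‖ ^ 2) := by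
  refine norm_integral_le_of_norm_le (integrable_rexp_neg_mul_sq_norm hb)
    (Eventually.of_forall fun ζ => ?_)
  rw [norm_mul, Real.norm_eq_abs, Real.norm_eq_abs, abs_of_pos (Real.exp_pos _)]
  refine mul_le_of_le_one_right (Real.exp_pos _).le ((Complex.abs_re_le_norm _).trans ?_)
  rw [norm_mul, norm_exp_neg_I_mul, mul_one]
  exact h.norm_le_one h0 ζ

/-- The Gaussian regularization of `φ`, up to normalization. -/
def gaussSmooth (φ : E → ℂ) (b : ℝ) (ξ : E) : ℂ :=
  ∫ η : E, (Real.exp (-‖η‖ ^ 2) : ℂ) * ((Real.exp (-b * ‖ξ - (2 * √b) • η‖ ^ 2) : ℂ) *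
    φ (ξ - (2 * √b) • η))

/-- Fubini leaves a Gaussian integral in y, which produces the kernel exp(-‖ξ - ζ‖²/(4b)). The
damping exp(-b‖y‖²) makes the merely bounded `gaussDensity` integrable with no decay estimate. The
value of κ is irrelevant, since only quotients are used later. -/
lemma exists_fourier_gaussDensity (h : IsPositiveType φ) (h0 : φ 0 = 1) (hc : Continuous φ)
    {b : ℝ} (hb : 0 < b) : ∃ κ : ℂ, κ ≠ 0 ∧ ∀ ξ : E,
      ∫ y : E, Complex.exp ((inner ℝ y ξ : ℝ) * Complex.I) *
        ((Real.exp (-b * ‖y‖ ^ 2) * gaussDensity φ b y : ℝ) : ℂ) = κ * gaussSmooth φ b ξ := by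
  have hb' : 0 < (b : ℂ).re := by simpa using hb
  refine ⟨(Real.pi / b : ℂ) ^ (Module.finrank ℝ E / 2 : ℂ) *
    (((2 * √b) ^ Module.finrank ℝ E : ℝ) : ℂ), ?_, fun ξ => ?_⟩
  · have h1 : (Real.pi / b : ℂ) ≠ 0 :=
      div_ne_zero (by exact_mod_cast Real.pi_ne_zero) (by exact_mod_cast hb.ne')
    have h2 : (0 : ℝ) < (2 * √b) ^ Module.finrank ℝ E := by positivity
    exact mul_ne_zero (by simp [Complex.cpow_eq_zero_iff, h1]) (by exact_mod_cast h2.ne')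
  have hint : Integrable (Function.uncurry fun y ζ : E => Complex.exp ((inner ℝ y ξ : ℝ) * Complex.I) *
      ((Real.exp (-b * ‖y‖ ^ 2) : ℂ) * ((Real.exp (-b * ‖ζ‖ ^ 2) : ℂ) *
        (φ ζ * Complex.exp (-(Complex.I * (inner ℝ y ζ : ℝ)))))))
      ((volume : Measure E).prod volume) := by
    refine ((integrable_rexp_neg_mul_sq_norm hb).mul_prod
      (integrable_rexp_neg_mul_sq_norm hb)).mono' ?_ (Eventually.of_forall fun p => ?_)
    · exact Continuous.aestronglyMeasurable (by unfold Function.uncurry; fun_prop)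
    · simp only [Function.uncurry, norm_mul, norm_exp_neg_I_mul, Complex.norm_exp_ofReal_mul_I,
        Complex.norm_real, Real.norm_eq_abs, abs_of_pos (Real.exp_pos _), one_mul, mul_one]
      refine mul_le_mul_of_nonneg_left ?_ (Real.exp_pos _).le
      exact mul_le_of_le_one_right (Real.exp_pos _).le (h.norm_le_one h0 _)
  calc ∫ y : E, Complex.exp ((inner ℝ y ξ : ℝ) * Complex.I) *
        ((Real.exp (-b * ‖y‖ ^ 2) * gaussDensity φ b y : ℝ) : ℂ)
      = ∫ y : E, ∫ ζ : E, Complex.exp ((inner ℝ y ξ : ℝ) * Complex.I) *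
      ((Real.exp (-b * ‖y‖ ^ 2) : ℂ) * ((Real.exp (-b * ‖ζ‖ ^ 2) : ℂ) *
        (φ ζ * Complex.exp (-(Complex.I * (inner ℝ y ζ : ℝ)))))) := by
        refine integral_congr_ae (Eventually.of_forall fun y => ?_)
        simp only
        rw [integral_const_mul, integral_const_mul, ← ofReal_gaussDensity h h0 hc hb]
        push_cast
        rfl
    _ = ∫ ζ : E, ∫ y : E, Complex.exp ((inner ℝ y ξ : ℝ) * Complex.I) *
      ((Real.exp (-b * ‖y‖ ^ 2) : ℂ) * ((Real.exp (-b * ‖ζ‖ ^ 2) : ℂ) *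
        (φ ζ * Complex.exp (-(Complex.I * (inner ℝ y ζ : ℝ)))))) := integral_integral_swap hint
    _ = ∫ ζ : E, (Real.pi / b : ℂ) ^ (Module.finrank ℝ E / 2 : ℂ) *
          ((Real.exp (-‖ξ - ζ‖ ^ 2 / (4 * b)) : ℂ) * ((Real.exp (-b * ‖ζ‖ ^ 2) : ℂ) * φ ζ)) := by
        refine integral_congr_ae (Eventually.of_forall fun ζ => ?_)
        simp only
        have h1 := GaussianFourier.integral_cexp_neg_mul_sq_norm_add (V := E) hb' Complex.I (ξ - ζ)
        have h2 : Complex.I ^ 2 * (‖ξ - ζ‖ : ℂ) ^ 2 / (4 * b) =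
            ((-‖ξ - ζ‖ ^ 2 / (4 * b) : ℝ) : ℂ) := by
          push_cast; rw [Complex.I_sq]; ring
        rw [h2, ← Complex.ofReal_exp] at h1
        rw [← mul_assoc, ← h1, ← integral_mul_const]
        refine integral_congr_ae (Eventually.of_forall fun y => ?_)
        simp only
        rw [show -(b : ℂ) * (‖y‖ : ℂ) ^ 2 + Complex.I * ((inner ℝ (ξ - ζ) y : ℝ) : ℂ) =
          (inner ℝ y ξ : ℝ) * Complex.I + (((-b * ‖y‖ ^ 2 : ℝ) : ℂ) +
            -(Complex.I * (inner ℝ y ζ : ℝ))) by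
            rw [inner_sub_left, real_inner_comm y ξ, real_inner_comm y ζ]; push_cast; ring,
          Complex.exp_add, Complex.exp_add, Complex.ofReal_exp (-b * ‖y‖ ^ 2)]
        ring
    _ = (Real.pi / b : ℂ) ^ (Module.finrank ℝ E / 2 : ℂ) *
        ∫ ζ : E, (Real.exp (-‖ξ - ζ‖ ^ 2 / (4 * b)) : ℂ) *
          ((Real.exp (-b * ‖ζ‖ ^ 2) : ℂ) * φ ζ) := integral_const_mul _ _
    _ = _ := by
        rw [mul_assoc]
        congr 1
        -- The substitution ζ = ξ - 2√b η turns the kernel into exp(-‖η‖²); its Jacobian is the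
        -- power of 2√b included in κ.
        rw [← integral_sub_left_eq_self _ volume ξ]
        have h3 := Measure.integral_comp_smul (volume : Measure E)
          (fun ζ : E => (Real.exp (-‖ξ - (ξ - ζ)‖ ^ 2 / (4 * b)) : ℂ) *
          ((Real.exp (-b * ‖ξ - ζ‖ ^ 2) : ℂ) * φ (ξ - ζ))) (2 * √b)
        have hpos : 0 < (2 * √b) ^ Module.finrank ℝ E := by positivity
        rw [abs_of_pos (inv_pos.mpr hpos)] at h3
        have h4 : gaussSmooth φ b ξ = ∫ x : E,
            (Real.exp (-‖ξ - (ξ - (2 * √b) • x)‖ ^ 2 / (4 * b)) : ℂ) *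
          ((Real.exp (-b * ‖ξ - (2 * √b) • x‖ ^ 2) : ℂ) * φ (ξ - (2 * √b) • x)) := by
          unfold gaussSmooth
          refine integral_congr_ae (Eventually.of_forall fun x => ?_)
          simp only
          congr 3
          rw [sub_sub_cancel, norm_smul, mul_pow, Real.norm_eq_abs, sq_abs, mul_pow,
            Real.sq_sqrt hb.le]
          field_simp
          ring
        rw [h4, h3, Complex.real_smul, ← mul_assoc, ← Complex.ofReal_mul,
          mul_inv_cancel₀ hpos.ne', Complex.ofReal_one, one_mul]

/-- The integrands are dominated by exp(-‖η‖²) and depend continuously on b down to b = 0, where √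
is still continuous. -/
lemma tendsto_gaussSmooth (h : IsPositiveType φ) (h0 : φ 0 = 1) (hc : Continuous φ)
    {b : ℕ → ℝ} (hb : ∀ m, 0 < b m) (hb0 : Tendsto b atTop (𝓝 0)) (ξ : E) :
    Tendsto (fun m => gaussSmooth φ (b m) ξ) atTop
      (𝓝 ((∫ η : E, Real.exp (-‖η‖ ^ 2) : ℝ) * φ ξ)) := by
  have hlim : ((∫ η : E, Real.exp (-‖η‖ ^ 2) : ℝ) * φ ξ : ℂ) =
      ∫ η : E, (Real.exp (-‖η‖ ^ 2) : ℂ) * ((Real.exp (-(0 : ℝ) * ‖ξ - (2 * √0) • η‖ ^ 2) : ℂ) *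
        φ (ξ - (2 * √0) • η)) := by
    simp only [neg_zero, zero_mul, Real.exp_zero, Complex.ofReal_one, one_mul, Real.sqrt_zero,
      mul_zero, zero_smul, sub_zero]
    rw [integral_mul_const, integral_complex_ofReal]
  rw [hlim]
  refine tendsto_integral_of_dominated_convergence (fun η => Real.exp (-1 * ‖η‖ ^ 2)) ?_
    (integrable_rexp_neg_mul_sq_norm one_pos) ?_ ?_
  · exact fun m => Continuous.aestronglyMeasurable (by fun_prop)
  · refine fun m => Eventually.of_forall fun η => ?_
    rw [norm_mul, norm_mul, Complex.norm_real, Complex.norm_real, Real.norm_eq_abs,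
      Real.norm_eq_abs, abs_of_pos (Real.exp_pos _), abs_of_pos (Real.exp_pos _), neg_one_mul]
    refine mul_le_of_le_one_right (Real.exp_pos _).le (mul_le_one₀ ?_ (norm_nonneg _)
      (h.norm_le_one h0 _))
    rw [Real.exp_le_one_iff]
    have := hb m
    nlinarith [sq_nonneg ‖ξ - (2 * √(b m)) • η‖]
  · refine Eventually.of_forall fun η => ?_
    have hcont : Continuous fun t : ℝ => (Real.exp (-‖η‖ ^ 2) : ℂ) *
        ((Real.exp (-t * ‖ξ - (2 * √t) • η‖ ^ 2) : ℂ) * φ (ξ - (2 * √t) • η)) := by fun_prop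
    exact (hcont.tendsto 0).comp hb0

/-- **Bochner's theorem**: a continuous function of positive type on a finite dimensional real
inner product space is the characteristic function of a probability measure. -/
theorem IsPositiveType.exists_charFun_eq (h : IsPositiveType φ) (h0 : φ 0 = 1)
    (hc : Continuous φ) : ∃ μ : Measure E, IsProbabilityMeasure μ ∧ charFun μ = φ := by
  have hpi : (0 : ℝ) < ∫ η : E, Real.exp (-‖η‖ ^ 2) := by
    simpa using integral_rexp_neg_mul_sq_norm_pos (E := E) one_pos
  obtain ⟨b, hb, hb0⟩ : ∃ b : ℕ → ℝ, (∀ m, 0 < b m) ∧ Tendsto b atTop (𝓝 0) :=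
    ⟨fun m => 1 / ((m : ℝ) + 1), fun m => by positivity, tendsto_one_div_add_atTop_nhds_zero_nat⟩
  have hlim := tendsto_gaussSmooth h h0 hc hb hb0
  -- Dividing by the value at 0 cancels the limiting Gaussian mass, and in the Fourier transforms
  -- also κ.
  have hquot : ∀ ξ, Tendsto (fun m => gaussSmooth φ (b m) ξ / gaussSmooth φ (b m) 0) atTop
      (𝓝 (φ ξ)) := by
    intro ξ
    have hne : ((∫ η : E, Real.exp (-‖η‖ ^ 2) : ℝ) * φ 0 : ℂ) ≠ 0 := by
      rw [h0, mul_one]; exact_mod_cast hpi.ne'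
    have := (hlim ξ).div (hlim 0) hne
    rwa [h0, mul_one, mul_div_cancel_left₀ _ (by exact_mod_cast hpi.ne')] at this
  set d : ℕ → E → ℝ := fun m y => Real.exp (-(b m) * ‖y‖ ^ 2) * gaussDensity φ (b m) y with hd
  have hdn : ∀ m y, 0 ≤ d m y := fun m y =>
    mul_nonneg (Real.exp_pos _).le (gaussDensity_nonneg h h0 hc (hb m) y)
  have hdc : ∀ m, Continuous (d m) := fun m => by
    have := continuous_gaussDensity h h0 hc (hb m)
    fun_prop
  have hdi : ∀ m, Integrable (d m) := fun m =>
    integrable_mul_gaussian (hb m) (continuous_gaussDensity h h0 hc (hb m))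
      (norm_gaussDensity_le h h0 (hb m))
  choose κ hκ0 hκ using fun m => exists_fourier_gaussDensity h h0 hc (hb m)
  have hmass : ∀ m, ((∫ y, d m y : ℝ) : ℂ) = κ m * gaussSmooth φ (b m) 0 := by
    intro m
    rw [← hκ, ← integral_complex_ofReal]
    simp [hd]
  have hne : ∀ᶠ m in atTop, gaussSmooth φ (b m) 0 ≠ 0 := by
    refine (hlim 0).eventually_ne ?_
    rw [h0, mul_one]; exact_mod_cast hpi.ne'
  -- From m₀ on the total masses are nonzero, so the densities can be normalized once the index is
  -- shifted by m₀.
  obtain ⟨m₀, hm₀⟩ := eventually_atTop.mp hne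
  have hMpos : ∀ m, 0 < ∫ y, d (m + m₀) y := by
    intro m
    refine lt_of_le_of_ne (integral_nonneg (hdn _)) fun h => ?_
    have := hmass (m + m₀)
    rw [← h, Complex.ofReal_zero] at this
    exact mul_ne_zero (hκ0 _) (hm₀ _ (Nat.le_add_left _ _)) this.symm
  set P : ℕ → Measure E := fun m => volume.withDensity fun y =>
    ENNReal.ofReal (d (m + m₀) y / ∫ y, d (m + m₀) y) with hP
  have hPp : ∀ m, IsProbabilityMeasure (P m) := fun m => ⟨by
    rw [hP]
    simp only
    rw [withDensity_apply _ MeasurableSet.univ, Measure.restrict_univ,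
      ← ofReal_integral_eq_lintegral_ofReal ((hdi _).div_const _)
        (Eventually.of_forall fun ξ => (div_nonneg (hdn _ ξ) (hMpos m).le)), integral_div,
        div_self (hMpos m).ne', ENNReal.ofReal_one]⟩
  have hPchar : ∀ m ξ, charFun (P m) ξ =
      gaussSmooth φ (b (m + m₀)) ξ / gaussSmooth φ (b (m + m₀)) 0 := by
    intro m ξ
    rw [charFun_apply, hP]
    simp only
    rw [integral_withDensity_eq_integral_toReal_smul₀]
    · rw [← mul_div_mul_left _ _ (hκ0 (m + m₀)), ← hκ, ← hmass, ← integral_div]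
      refine integral_congr_ae (Eventually.of_forall fun y => ?_)
      simp only
      rw [ENNReal.toReal_ofReal (div_nonneg (hdn _ y) (hMpos m).le), Complex.real_smul]
      push_cast [hd]
      ring
    · exact (ENNReal.continuous_ofReal.comp ((hdc _).div_const _)).measurable.aemeasurable
    · exact Eventually.of_forall fun ξ => ENNReal.ofReal_lt_top
  have hconv : ∀ ξ, Tendsto (fun m => charFun (P m) ξ) atTop (𝓝 (φ ξ)) := by
    intro ξ
    simp_rw [hPchar]
    exact (hquot ξ).comp (tendsto_add_atTop_nat m₀)
  -- Pointwise convergence of characteristic functions to a limit continuous at 0 gives tightness.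
  -- Prokhorov's theorem then yields a weak cluster point, which suffices: its characteristic
  -- function is a cluster value of a convergent sequence.
  have htight : IsTightMeasureSet (Set.range P) :=
    isTightMeasureSet_of_tendsto_charFun hc.continuousAt hconv
  set Q : ℕ → ProbabilityMeasure E := fun m => ⟨P m, hPp m⟩
  have hcomp : IsCompact (closure (Set.range Q)) := by
    refine isCompact_closure_of_isTightMeasureSet (htight.subset ?_)
    rintro _ ⟨_, ⟨m, rfl⟩, rfl⟩
    exact Set.mem_range_self m
  obtain ⟨μ, -, hμ⟩ := hcomp.exists_mapClusterPt (f := atTop) (u := Q)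
    (tendsto_principal.mpr (Eventually.of_forall fun m => subset_closure (Set.mem_range_self m)))
  refine ⟨μ, μ.2, funext fun ξ => ?_⟩
  have hcf : Continuous fun ν : ProbabilityMeasure E => charFun (ν : Measure E) ξ := by
    simp_rw [charFun_eq_integral_innerProbChar]
    exact continuous_iff_continuousAt.mpr fun ν =>
      (ProbabilityMeasure.tendsto_iff_forall_integral_rclike_tendsto ℂ).mp tendsto_id _
  have h1 : MapClusterPt (charFun (μ : Measure E) ξ) atTop fun m => charFun (P m) ξ :=
    hμ.continuousAt_comp hcf.continuousAt
  have h2 : (𝓝 (charFun (μ : Measure E) ξ) ⊓ 𝓝 (φ ξ)).NeBot :=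
    Filter.NeBot.mono h1 (inf_le_inf_left _ (hconv ξ))
  exact eq_of_nhds_neBot h2

end Bochner

/-! ### Positive-type spherical functions come from orbits -/

section Orbit

variable {n : ℕ}

/-- The matrix with the entries of a vector of the Euclidean space `ℂ^(n × n)`. -/
def matrixOfEuclidean (v : PiLp 2 fun _ : Fin n × Fin n => ℂ) : V n :=
  Matrix.of fun i j => v (i, j)

/-- The vector of the entries of a matrix in the Euclidean space `ℂ^(n × n)`. -/
def euclideanOfMatrix (x : V n) : PiLp 2 fun _ : Fin n × Fin n => ℂ :=
  WithLp.toLp 2 fun p => x p.1 p.2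

lemma matrixOfEuclidean_euclideanOfMatrix (x : V n) :
    matrixOfEuclidean (euclideanOfMatrix x) = x := rfl

lemma continuous_matrixOfEuclidean : Continuous (matrixOfEuclidean (n := n)) := by
  refine continuous_matrix fun i j => ?_
  unfold matrixOfEuclidean
  simp only [Matrix.of_apply]
  fun_prop

lemma inner_euclideanOfMatrix (v : PiLp 2 fun _ : Fin n × Fin n => ℂ) (x : V n) :
    inner ℝ v (euclideanOfMatrix x) = pairing x (matrixOfEuclidean v) := by
  rw [PiLp.inner_apply, pairing_eq_sum, Fintype.sum_prod_type]
  refine Finset.sum_congr rfl fun i _ => Finset.sum_congr rfl fun j _ => ?_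
  simp only [euclideanOfMatrix, matrixOfEuclidean, Matrix.of_apply]
  rw [Complex.inner]
  simp

lemma norm_spherical_le_one (x η : V n) : ‖spherical x η‖ ≤ 1 := by
  refine (norm_integral_le_of_norm_le_const (C := 1)
    (Eventually.of_forall fun k => (norm_cexp_I_mul_ofReal _).le)).trans ?_
  simp

lemma Continuous.spherical {X : Type*} [TopologicalSpace X] {f g : X → V n}
    (hf : Continuous f) (hg : Continuous g) : Continuous fun x => spherical (f x) (g x) :=
  continuous_spherical.comp (f := fun x => (f x, g x)) (hf.prodMk hg)

/-! ### From the functional equation to almost everywhere constancy -/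

section FunctionalEquation

variable {X : Type*} [TopologicalSpace X] [MeasurableSpace X] [BorelSpace X]
  [SecondCountableTopology X] {μ : Measure X} [IsProbabilityMeasure μ] {T : X → V n} {f : V n → ℂ}

/-- The functional equation says that `(spherical y η - f η) μ(dy)` has zero Fourier transform. -/
lemma integral_spherical_sub_mul_cexp (hS : Continuous T)
    (hchar : ∀ ξ : V n, ∫ v, Complex.exp (Complex.I * (pairing ξ (T v) : ℝ)) ∂μ = f ξ)
    (hf : ∀ ξ η, ∫ k, f (ξ + act k η) ∂(haarK n) = f ξ * f η) (ξ η : V n) :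
    ∫ v, (spherical (T v) η - f η) * Complex.exp (Complex.I * (pairing ξ (T v) : ℝ)) ∂μ = 0 := by
  have hexp : ∀ ξ : V n, Continuous fun v =>
      Complex.exp (Complex.I * (pairing ξ (T v) : ℝ)) := fun ξ =>
    Continuous.cexp_I_mul_ofReal (Continuous.pairing continuous_const hS)
  have hg : Continuous fun v => spherical (T v) η := Continuous.spherical hS continuous_const
  simp_rw [sub_mul]
  rw [integral_sub, integral_const_mul, hchar, sub_eq_zero, mul_comm (f η), ← hf]
  · have hint : Integrable (Function.uncurry fun (k : K n)
        (v : X) => Complex.exp (Complex.I *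
          (pairing (ξ + act k η) (T v) : ℝ))) ((haarK n).prod μ) := by
      refine Integrable.of_bound (C := 1) ?_ (Eventually.of_forall fun p =>
        (norm_cexp_I_mul_ofReal _).le)
      have : Continuous (Function.uncurry fun (k : K n)
        (v : X) => Complex.exp (Complex.I *
          (pairing (ξ + act k η) (T v) : ℝ))) :=
        Continuous.cexp_I_mul_ofReal (Continuous.pairing (continuous_const.add
          (Continuous.act continuous_fst continuous_const)) (hS.comp continuous_snd))
      exact this.aestronglyMeasurable
    simp_rw [← hchar]
    rw [integral_integral_swap hint]
    refine integral_congr_ae (Eventually.of_forall fun v => ?_)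
    simp only
    rw [spherical_comm]
    unfold spherical
    rw [← integral_mul_const]
    refine integral_congr_ae (Eventually.of_forall fun k => ?_)
    simp only
    rw [pairing_add_left, pairing_comm _ (act k η), ← Complex.exp_add]
    push_cast
    ring_nf
  · refine Integrable.of_bound (C := 1) (hg.mul (hexp ξ)).aestronglyMeasurable
      (Eventually.of_forall fun v => ?_)
    rw [norm_mul, norm_cexp_I_mul_ofReal, mul_one]
    exact norm_spherical_le_one _ _
  · refine Integrable.of_bound (C := ‖f η‖) (continuous_const.mul (hexp ξ)).aestronglyMeasurable
      (Eventually.of_forall fun v => ?_)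
    rw [norm_mul, norm_cexp_I_mul_ofReal, mul_one]

/-- Let g(v) be the spherical function of T v at η. The vanishing Fourier transform is tested twice:
averaging ξ over the orbit of -η makes g - f(η) orthogonal to g, and ξ = 0 makes it orthogonal to
the constant f(η). Subtracting gives ∫|g - f(η)|² = 0, so injectivity of the Fourier transform is
not needed. -/
lemma ae_spherical_eq (hS : Continuous T)
    (hchar : ∀ ξ : V n, ∫ v, Complex.exp (Complex.I * (pairing ξ (T v) : ℝ)) ∂μ = f ξ)
    (hf : ∀ ξ η, ∫ k, f (ξ + act k η) ∂(haarK n) = f ξ * f η) (η : V n) :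
    ∀ᵐ v ∂μ, spherical (T v) η = f η := by
  have hA := integral_spherical_sub_mul_cexp hS hchar hf
  have hg : Continuous fun v => spherical (T v) η := Continuous.spherical hS continuous_const
  have hd : Continuous fun v => spherical (T v) η - f η :=
    hg.sub continuous_const
  have hbd : ∀ v, ‖spherical (T v) η - f η‖ ≤ 1 + ‖f η‖ := fun v =>
    (norm_sub_le _ _).trans (add_le_add (norm_spherical_le_one _ _) le_rfl)
  have h1 : ∫ v, (spherical (T v) η - f η) *
      (starRingEnd ℂ) (spherical (T v) η) ∂μ = 0 := by
    have hcj : ∀ v, (starRingEnd ℂ) (spherical (T v) η) =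
        ∫ k, Complex.exp (Complex.I * (pairing (act k (-η)) (T v) : ℝ))
          ∂(haarK n) := by
      intro v
      rw [spherical_comm]
      unfold spherical
      rw [← integral_conj]
      refine integral_congr_ae (Eventually.of_forall fun k => ?_)
      simp only
      rw [← Complex.exp_conj, act_neg, pairing_comm _ (act k η)]
      simp [pairing]
    simp_rw [hcj, ← integral_const_mul]
    rw [integral_integral_swap]
    · simp_rw [hA]; simp
    · refine Integrable.of_bound (C := 1 + ‖f η‖) ?_ (Eventually.of_forall fun p => ?_)
      · have h3 : Continuous fun p : X × K n =>
            (spherical (T p.1) η - f η) *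
            Complex.exp (Complex.I * (pairing (act p.2 (-η)) (T p.1) : ℝ)) :=
          (hd.comp continuous_fst).mul (Continuous.cexp_I_mul_ofReal (Continuous.pairing
            (Continuous.act continuous_snd continuous_const) (hS.comp continuous_fst)))
        exact h3.aestronglyMeasurable
      · simp only [Function.uncurry]
        rw [norm_mul, norm_cexp_I_mul_ofReal, mul_one]
        exact hbd _
  have h2 : ∫ v, (spherical (T v) η - f η) * (starRingEnd ℂ) (f η) ∂μ = 0 := by
    have := hA 0 η
    simp only [pairing_zero_left, Complex.ofReal_zero, mul_zero, Complex.exp_zero, mul_one] at this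
    rw [integral_mul_const, this, zero_mul]
  have h3 : ∫ v, ‖spherical (T v) η - f η‖ ^ 2 ∂μ = 0 := by
    have h4 : ((∫ v, ‖spherical (T v) η - f η‖ ^ 2 ∂μ : ℝ) : ℂ) = 0 := by
      rw [← integral_complex_ofReal]
      rw [← sub_eq_zero.mpr (h1.trans h2.symm), ← integral_sub]
      · refine integral_congr_ae (Eventually.of_forall fun v => ?_)
        simp only
        rw [← mul_sub, ← map_sub, Complex.mul_conj, Complex.normSq_eq_norm_sq]
      · refine Integrable.of_bound (C := (1 + ‖f η‖) * 1)
          (hd.mul (Complex.continuous_conj.comp hg)).aestronglyMeasurable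
          (Eventually.of_forall fun v => ?_)
        rw [norm_mul, RCLike.norm_conj]
        exact mul_le_mul (hbd v) (norm_spherical_le_one _ _) (norm_nonneg _) (by positivity)
      · refine Integrable.of_bound (C := (1 + ‖f η‖) * ‖f η‖)
          (hd.mul continuous_const).aestronglyMeasurable
          (Eventually.of_forall fun v => ?_)
        rw [norm_mul, RCLike.norm_conj]
        exact mul_le_mul_of_nonneg_right (hbd v) (norm_nonneg _)
    exact_mod_cast h4
  rw [integral_eq_zero_iff_of_nonneg (fun v => by positivity)] at h3
  · filter_upwards [h3] with v hv
    simpa [sub_eq_zero] using hv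
  · refine Integrable.of_bound (C := (1 + ‖f η‖) ^ 2) (hd.norm.pow 2).aestronglyMeasurable
      (Eventually.of_forall fun v => ?_)
    rw [norm_pow, norm_norm]
    exact pow_le_pow_left₀ (norm_nonneg _) (hbd v) 2

end FunctionalEquation

/-- The exceptional null sets depend on η, so a countable dense set of η is used to find one point
that serves all of them; continuity in η does the rest. -/
lemma exists_eq_spherical {f : V n → ℂ} (hc : Continuous f) (h0 : f 0 = 1)
    (hp : ∀ (m : ℕ) (g : Fin m → V n), (Matrix.of fun i j => f (g j - g i)).PosSemidef)
    (hf : ∀ ξ η, ∫ k, f (ξ + act k η) ∂(haarK n) = f ξ * f η) :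
    ∃ y : V n, ∀ ξ, f ξ = spherical y ξ := by
  have hp' : IsPositiveType fun v => f (matrixOfEuclidean v) := fun m g =>
    hp m fun i => matrixOfEuclidean (g i)
  obtain ⟨μ, hμ, hμf⟩ := hp'.exists_charFun_eq h0 (hc.comp continuous_matrixOfEuclidean)
  have hchar : ∀ ξ : V n, ∫ v, Complex.exp (Complex.I * (pairing ξ (matrixOfEuclidean v) : ℝ)) ∂μ =
      f ξ := by
    intro ξ
    have := congrFun hμf (euclideanOfMatrix ξ)
    rw [charFun_apply] at this
    simp only [inner_euclideanOfMatrix, matrixOfEuclidean_euclideanOfMatrix] at this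
    simpa [mul_comm] using this
  have hS := continuous_matrixOfEuclidean (n := n)
  have hae := ae_spherical_eq hS hchar hf
  obtain ⟨s, hs, hsd⟩ := TopologicalSpace.exists_countable_dense (V n)
  have hall : ∀ᵐ v ∂μ, ∀ η ∈ s, spherical (matrixOfEuclidean v) η = f η :=
    (ae_ball_iff hs).mpr fun η _ => hae η
  obtain ⟨v, hv⟩ := hall.exists
  refine ⟨matrixOfEuclidean v, fun ξ => ?_⟩
  have hcs : Continuous fun η => spherical (matrixOfEuclidean v) η :=
    Continuous.spherical continuous_const continuous_id
  exact (congrFun (hcs.ext_on hsd hc hv) ξ).symm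

/-- **Singular value decomposition** of a square complex matrix. -/
lemma exists_eq_act_diag (y : V n) : ∃ (k : K n) (x : Fin n → ℝ), y = act k (diag x) := by
  have hpsd : (yᴴ * y).PosSemidef := Matrix.posSemidef_conjTranspose_mul_self y
  have hH := hpsd.1
  set W : V n := (hH.eigenvectorUnitary : V n) with hW
  set ev := hH.eigenvalues with hev
  have hWW : W * Wᴴ = 1 := Unitary.coe_mul_star_self hH.eigenvectorUnitary
  have hWW' : Wᴴ * W = 1 := Unitary.coe_star_mul_self hH.eigenvectorUnitary
  have hdiag : (y * W)ᴴ * (y * W) = Matrix.diagonal fun i => (ev i : ℂ) := by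
    have h1 : yᴴ * y = W * Matrix.diagonal (fun i => (ev i : ℂ)) * Wᴴ := by
      conv_lhs => rw [hH.spectral_theorem]
      rfl
    rw [Matrix.conjTranspose_mul]
    calc Wᴴ * yᴴ * (y * W) = Wᴴ * (yᴴ * y) * W := by simp only [Matrix.mul_assoc]
      _ = (Wᴴ * W) * Matrix.diagonal (fun i => (ev i : ℂ)) * (Wᴴ * W) := by
          rw [h1]; simp only [Matrix.mul_assoc]
      _ = _ := by rw [hWW', Matrix.one_mul, Matrix.mul_one]
  have hev0 : ∀ i, 0 ≤ ev i := hpsd.eigenvalues_nonneg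
  let c : Fin n → EuclideanSpace ℂ (Fin n) := fun i => WithLp.toLp 2 fun a => (y * W) a i
  -- The columns of y W are orthogonal and their squared norms are the eigenvalues of y* y; in
  -- particular a column with eigenvalue 0 vanishes.
  have hcc : ∀ i j, inner ℂ (c i) (c j) = if i = j then (ev i : ℂ) else 0 := by
    intro i j
    have h2 := congrFun (congrFun hdiag i) j
    rw [Matrix.diagonal_apply, Matrix.mul_apply] at h2
    rw [← h2, PiLp.inner_apply]
    refine Finset.sum_congr rfl fun a _ => ?_
    simp [c, Matrix.conjTranspose_apply, mul_comm]
  let s : Set (Fin n) := {i | ev i ≠ 0}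
  let v : Fin n → EuclideanSpace ℂ (Fin n) := fun i => ((√(ev i) : ℝ) : ℂ)⁻¹ • c i
  have hv : Orthonormal ℂ (s.domRestrict v) := by
    rw [orthonormal_iff_ite]
    rintro ⟨i, hi⟩ ⟨j, hj⟩
    have hi' : ((√(ev i) : ℝ) : ℂ) ≠ 0 := by
      have : 0 < √(ev i) := Real.sqrt_pos.mpr (lt_of_le_of_ne (hev0 i) (Ne.symm hi))
      exact_mod_cast this.ne'
    simp only [Set.domRestrict_apply, v, inner_smul_left, inner_smul_right, hcc, Subtype.mk.injEq,
      map_inv₀, Complex.conj_ofReal]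
    split_ifs with hij
    · subst hij
      have h3 : (ev i : ℂ) = ((√(ev i) : ℝ) : ℂ) * ((√(ev i) : ℝ) : ℂ) := by
        rw [← Complex.ofReal_mul, Real.mul_self_sqrt (hev0 i)]
      rw [h3]
      field_simp
    · simp
  -- The vectors added to complete the basis are later multiplied by √0, so their choice does not
  -- matter.
  obtain ⟨b, hb⟩ := hv.exists_orthonormalBasis_extension_of_card_eq (by simp)
  let u : V n := Matrix.of fun a i => b i a
  have hu : uᴴ * u = 1 := by
    ext i j
    have h4 := orthonormal_iff_ite.mp b.orthonormal i j
    rw [Matrix.mul_apply, Matrix.one_apply, ← h4, PiLp.inner_apply]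
    refine Finset.sum_congr rfl fun a _ => ?_
    simp [u, Matrix.conjTranspose_apply, mul_comm]
  have hyW : y * W = u * diag fun i => √(ev i) := by
    ext a i
    rw [diag, Matrix.mul_diagonal]
    have h5 : c i = ((√(ev i) : ℝ) : ℂ) • b i := by
      by_cases hi : ev i = 0
      · have : inner ℂ (c i) (c i) = 0 := by rw [hcc, if_pos rfl, hi, Complex.ofReal_zero]
        rw [inner_self_eq_zero.mp this, hi]
        simp
      · have hi' : ((√(ev i) : ℝ) : ℂ) ≠ 0 := by
          have : 0 < √(ev i) := Real.sqrt_pos.mpr (lt_of_le_of_ne (hev0 i) (Ne.symm hi))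
          exact_mod_cast this.ne'
        rw [hb i hi, smul_smul, mul_inv_cancel₀ hi', one_smul]
    have h6 : c i a = ((√(ev i) : ℝ) : ℂ) * b i a := by rw [h5]; rfl
    rw [mul_comm]
    exact h6
  refine ⟨(⟨u, Matrix.mem_unitaryGroup_iff'.mpr hu⟩, hH.eigenvectorUnitary),
    fun i => √(ev i), ?_⟩
  unfold act
  change y = u * diag (fun i => √(ev i)) * Wᴴ
  rw [← hyW, Matrix.mul_assoc, hWW, Matrix.mul_one]

end Orbit

/-! ### Spherical functions on `G_n` -/

section SphericalOnGroup

variable {n : ℕ}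

/-- The translation part of an element of `G_n`. -/
def translation (g : G n) : V n := Multiplicative.toAdd g.left

lemma toAdd_action (k : K n) (x : Multiplicative (V n)) :
    Multiplicative.toAdd (action n k x) = act k (Multiplicative.toAdd x) := rfl

lemma translation_mul (g h : G n) :
    translation (g * h) = translation g + act g.right (translation h) := by
  unfold translation
  rw [SemidirectProduct.mul_left, toAdd_mul, toAdd_action]

lemma translation_ofK (k : K n) : translation (ofK k) = 0 := rfl

lemma right_ofK (k : K n) : (ofK k : G n).right = k := rfl

lemma translation_inv (g : G n) : translation g⁻¹ = act g.right⁻¹ (-translation g) := rfl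

lemma act_zero (k : K n) : act k (0 : V n) = 0 := by simp [act]

lemma act_sub (k : K n) (x y : V n) : act k (x - y) = act k x - act k y := by
  simp [sub_eq_add_neg, act_add, act_neg]

lemma translation_biinvariant (k l : K n) (g : G n) :
    translation (ofK k * g * ofK l) = act k (translation g) := by
  simp [translation_mul, translation_ofK, right_ofK, act_zero]

lemma translation_mul_ofK_mul (g h : G n) (k : K n) :
    translation (g * ofK k * h) = translation g + act (g.right * k) (translation h) := by
  simp [translation_mul, translation_ofK, right_ofK, act_zero]

lemma translation_inv_mul (g h : G n) :
    translation (g⁻¹ * h) = act g.right⁻¹ (translation h - translation g) := by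
  rw [translation_mul, translation_inv, SemidirectProduct.inv_right, act_sub, act_neg]
  abel

lemma continuous_translation : Continuous (translation (n := n)) :=
  continuous_fst.comp (continuous_induced_dom (f := fun g : G n =>
    (Multiplicative.toAdd g.left, g.right)))

/-- The translation by a matrix, as an element of `G_n`. -/
def ofTranslation (x : V n) : G n := ⟨Multiplicative.ofAdd x, 1⟩

lemma translation_ofTranslation (x : V n) : translation (ofTranslation x) = x := rfl

lemma right_ofTranslation (x : V n) : (ofTranslation x).right = 1 := rfl

lemma continuous_ofTranslation : Continuous (ofTranslation (n := n)) := by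
  refine continuous_induced_rng.mpr ?_
  exact continuous_id.prodMk continuous_const

lemma eq_ofTranslation_mul (g : G n) : g = ofTranslation (translation g) * ofK g.right := by
  refine SemidirectProduct.ext ?_ ?_
  · apply Multiplicative.toAdd.injective
    change translation g = translation (ofTranslation (translation g) * ofK g.right)
    rw [translation_mul, translation_ofK, translation_ofTranslation, act_zero, add_zero]
  · simp [right_ofTranslation, right_ofK]

lemma isSphericalOfPositiveType_spherical (x : V n) :
    IsSphericalOfPositiveType fun g : G n => spherical x (translation g) where
  continuous := Continuous.spherical continuous_const continuous_translation
  map_one := spherical_zero_right x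
  biinvariant k l g := by rw [translation_biinvariant, spherical_act_right]
  functionalEquation g h := by
    simp_rw [translation_mul_ofK_mul]
    rw [integral_mul_left_eq_self
      (fun k => spherical x (translation g + act k (translation h))) g.right]
    exact integral_spherical_add_act _ _ _
  positiveType m g := by
    simp_rw [translation_inv_mul, spherical_act_right]
    refine Matrix.PosSemidef.of_dotProduct_mulVec_nonneg ?_ fun c => ?_
    · ext i j
      simp only [Matrix.conjTranspose_apply, Matrix.of_apply]
      unfold spherical
      rw [Complex.star_def, ← integral_conj]
      refine integral_congr_ae (Eventually.of_forall fun k => ?_)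
      simp only
      rw [← Complex.exp_conj]
      simp only [map_mul, Complex.conj_I, Complex.conj_ofReal, pairing_sub_left]
      push_cast
      ring_nf
    · let F : K n → Fin m → ℂ := fun k j =>
        Complex.exp (Complex.I * (pairing (translation (g j)) (act k x) : ℝ)) * c j
      have hterm : ∀ k i j, star (F k i) * F k j = star (c i) *
          (Complex.exp (Complex.I *
            (pairing (translation (g j) - translation (g i)) (act k x) : ℝ)) * c j) := by
        intro k i j
        have : star (F k i) = star (c i) * Complex.exp (-(Complex.I *
            (pairing (translation (g i)) (act k x) : ℝ))) := by
          simp only [F, star_mul]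
          congr 1
          rw [Complex.star_def, ← Complex.exp_conj]
          simp
        rw [this, pairing_sub_left]
        simp only [F]
        rw [mul_assoc, ← mul_assoc (Complex.exp _) (Complex.exp _), ← Complex.exp_add]
        push_cast
        ring_nf
      have hFc : ∀ i, Continuous fun k => Complex.exp (Complex.I *
          (pairing i (act k x) : ℝ)) := fun i =>
        Continuous.cexp_I_mul_ofReal (Continuous.pairing continuous_const
          (Continuous.act continuous_id continuous_const))
      have hFi : ∀ i j, Integrable (fun k => star (c i) * (Complex.exp (Complex.I *
          (pairing (translation (g j) - translation (g i)) (act k x) : ℝ)) * c j)) (haarK n) :=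
        fun i j => integrable_haarK (continuous_const.mul ((hFc _).mul continuous_const))
      -- The quadratic form is the mean over k of the squared modulus of a sum of characters.
      have hsum : star c ⬝ᵥ (Matrix.of fun i j =>
            spherical x (translation (g j) - translation (g i))) *ᵥ c =
          ∫ k, star (∑ i, F k i) * ∑ j, F k j ∂(haarK n) := by
        simp only [star_sum, Finset.sum_mul_sum, hterm]
        rw [integral_finsetSum _ fun i _ => integrable_finsetSum _ fun j _ => hFi i j]
        simp only [dotProduct, Matrix.mulVec, Pi.star_apply, Matrix.of_apply, Finset.mul_sum]
        refine Finset.sum_congr rfl fun i _ => ?_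
        rw [integral_finsetSum _ fun j _ => hFi i j]
        refine Finset.sum_congr rfl fun j _ => ?_
        rw [integral_const_mul, integral_mul_const]
        rfl
      rw [hsum]
      have hsq : ∀ k, star (∑ i, F k i) * ∑ j, F k j = ((‖∑ j, F k j‖ ^ 2 : ℝ) : ℂ) := by
        intro k
        rw [mul_comm, Complex.star_def, Complex.mul_conj, Complex.normSq_eq_norm_sq]
      simp_rw [hsq]
      rw [integral_complex_ofReal]
      have : 0 ≤ ∫ k, ‖∑ j, F k j‖ ^ 2 ∂(haarK n) := integral_nonneg fun k => by positivity
      exact_mod_cast this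

/-- By right invariance φ depends only on the translation part, and on pure translations the
positivity and the functional equation become those required on V_n. -/
lemma IsSphericalOfPositiveType.exists_eq_spherical {φ : G n → ℂ}
    (h : IsSphericalOfPositiveType φ) :
    ∃ x : Fin n → ℝ, ∀ g, φ g = spherical (diag x) (translation g) := by
  have hφ : ∀ g, φ g = φ (ofTranslation (translation g)) := by
    intro g
    conv_lhs => rw [eq_ofTranslation_mul g]
    have := h.biinvariant 1 g.right (ofTranslation (translation g))
    simpa using this
  obtain ⟨y, hy⟩ := SphericalMatrix.exists_eq_spherical
    (f := fun ξ => φ (ofTranslation ξ)) (h.continuous.comp continuous_ofTranslation)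
    (by exact h.map_one)
    (fun m g => by
      have := h.positiveType m fun i => ofTranslation (g i)
      have he : (fun i j => φ ((ofTranslation (g i))⁻¹ * ofTranslation (g j))) =
          fun i j => φ (ofTranslation (g j - g i)) := by
        funext i j
        rw [hφ, translation_inv_mul]
        simp [translation_ofTranslation, right_ofTranslation]
      rwa [he] at this)
    (fun ξ η => by
      rw [← h.functionalEquation]
      refine integral_congr_ae (Eventually.of_forall fun k => ?_)
      simp only
      rw [hφ (_ * _), translation_mul_ofK_mul]
      simp [translation_ofTranslation, right_ofTranslation])
  obtain ⟨k, x, rfl⟩ := exists_eq_act_diag y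
  exact ⟨x, fun g => by rw [hφ g, hy, spherical_act_left]⟩

theorem isSphericalOfPositiveType_iff (φ : G n → ℂ) :
    IsSphericalOfPositiveType φ ↔ ∃ x : Fin n → ℝ, ∀ g : G n,
      φ g = fourier (orbitalMeasure (diag x)) (Multiplicative.toAdd g.left) := by
  simp_rw [fourier_orbitalMeasure]
  constructor
  · exact fun h => h.exists_eq_spherical
  · rintro ⟨x, hx⟩
    have : φ = fun g => spherical (diag x) (translation g) := funext hx
    rw [this]
    exact isSphericalOfPositiveType_spherical _

end SphericalOnGroup

/-! ### Differential operators on smooth functions -/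

section Derivation

variable {R : Type*} [Ring R]

/-- The commutator with a fixed element. -/
def commutator (T : R) : R →+ R where
  toFun X := T * X - X * T
  map_zero' := by simp
  map_add' X Y := by noncomm_ring

lemma commutator_apply (T X : R) : commutator T X = T * X - X * T := rfl

lemma commutator_mul (T X Y : R) :
    commutator T (X * Y) = commutator T X * Y + X * commutator T Y := by
  simp only [commutator_apply]; noncomm_ring

/-- Leibniz's formula has only three terms because the third derivative of a vanishes; δ²a = 2b
doubles the binomial coefficient of the last one. -/
lemma iterate_derivation_mul (δ : R →+ R) (hδ : ∀ x y, δ (x * y) = δ x * y + x * δ y)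
    {a b : R} (hab : δ (δ a) = 2 • b) (hb : δ b = 0) (x : R) (m : ℕ) :
    δ^[m + 2] (x * a) = δ^[m + 2] x * a + (m + 2) • (δ^[m + 1] x * δ a) +
      ((m + 2) * (m + 1)) • (δ^[m] x * b) := by
  induction m with
  | zero =>
    simp only [Function.iterate_succ, Function.iterate_zero, Function.comp, id, hδ, map_add, hab]
    simp only [nsmul_eq_mul]
    push_cast
    noncomm_ring
  | succ m ih =>
    rw [Function.iterate_succ_apply', ih]
    simp only [map_add, map_nsmul, hδ, hab, hb, ← Function.iterate_succ_apply' δ, mul_zero, add_zero]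
    simp only [nsmul_eq_mul]
    push_cast
    noncomm_ring

/-- The top iterated derivative of a power of a quadratic element. -/
lemma iterate_derivation_pow (δ : R →+ R) (hδ : ∀ x y, δ (x * y) = δ x * y + x * δ y)
    {a b : R} (hab : δ (δ a) = 2 • b) (hb : δ b = 0) (k : ℕ) :
    δ^[2 * k] (a ^ k) = (2 * k).factorial • b ^ k ∧ δ^[2 * k + 1] (a ^ k) = 0 := by
  have hδ1 : δ 1 = 0 := by
    have := hδ 1 1
    simpa using this
  have hδpow : ∀ k : ℕ, δ (b ^ k) = 0 := by
    intro k
    induction k with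
    | zero => simpa using hδ1
    | succ k ih => rw [pow_succ, hδ, ih, hb]; simp
  have hδ2 : δ^[2 * k] (a ^ k) = (2 * k).factorial • b ^ k := by
    induction k with
    | zero => simp
    | succ k ih =>
      -- Since a ^ k is annihilated after 2k + 1 derivations, only the last Leibniz term survives
      -- for a ^ (k + 1).
      have h0 : δ^[2 * k + 1] (a ^ k) = 0 := by
        rw [Function.iterate_succ_apply', ih, map_nsmul, hδpow, smul_zero]
      have h1 : δ^[2 * k + 2] (a ^ k) = 0 := by
        rw [Function.iterate_succ_apply', h0, map_zero]
      rw [pow_succ, show 2 * (k + 1) = 2 * k + 2 by ring, iterate_derivation_mul δ hδ hab hb, h0, h1,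
        ih, Nat.factorial_succ, Nat.factorial_succ, pow_succ]
      simp only [zero_mul, smul_zero, zero_add, smul_mul_assoc, smul_smul]
      congr 1
      ring
  exact ⟨hδ2, by rw [Function.iterate_succ_apply', hδ2, map_nsmul, hδpow, smul_zero]⟩

end Derivation

/-! ### Smooth functions on ℂ^ι, Wirtinger operators and the Laplacian -/

section Smooth

variable {ι : Type*} [Fintype ι]

/-- The algebra of smooth complex functions on `ℂ^ι`, as a subalgebra of the functions. -/
def smoothSubalgebra (ι : Type*) [Fintype ι] : Subalgebra ℂ ((ι → ℂ) → ℂ) where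
  carrier := {f | ContDiff ℝ ∞ f}
  mul_mem' {f g} hf hg := by
    have h1 : ContDiff ℝ ∞ f := hf
    have h2 : ContDiff ℝ ∞ g := hg
    exact h1.mul h2
  add_mem' {f g} hf hg := by
    have h1 : ContDiff ℝ ∞ f := hf
    have h2 : ContDiff ℝ ∞ g := hg
    exact h1.add h2
  algebraMap_mem' c := (contDiff_const : ContDiff ℝ ∞ fun _ : ι → ℂ => c)

/-- The algebra of smooth complex functions on `ℂ^ι`. -/
def Smooth (ι : Type*) [Fintype ι] : Type _ := smoothSubalgebra ι

instance : CommRing (Smooth ι) := inferInstanceAs (CommRing (smoothSubalgebra ι))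

instance : Algebra ℂ (Smooth ι) := inferInstanceAs (Algebra ℂ (smoothSubalgebra ι))

instance : FunLike (Smooth ι) (ι → ℂ) ℂ where
  coe f := f.1
  coe_injective _ _ h := Subtype.ext h

instance : Ring (Smooth ι) := CommRing.toRing

instance : Semiring (Smooth ι) := Ring.toSemiring

instance : AddCommGroup (Smooth ι) := Ring.toAddCommGroup

instance : AddCommMonoid (Smooth ι) := AddCommGroup.toAddCommMonoid

instance : Module ℂ (Smooth ι) := Algebra.toModule

/-- The algebra of linear operators on smooth functions. -/
abbrev SmoothOp (ι : Type*) [Fintype ι] : Type _ := Module.End ℂ (Smooth ι)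

instance : Ring (SmoothOp ι) := Module.End.instRing

instance : Algebra ℂ (SmoothOp ι) := Module.End.instAlgebra ℂ ℂ (Smooth ι)

instance : Module ℂ (SmoothOp ι) := Algebra.toModule

instance : Semiring (SmoothOp ι) := inferInstance

instance : NonAssocSemiring (SmoothOp ι) := inferInstance

instance : NonUnitalSemiring (SmoothOp ι) := inferInstance

instance : NonUnitalNonAssocRing (SmoothOp ι) := inferInstance

instance : NonUnitalNonAssocSemiring (SmoothOp ι) := inferInstance

instance : Distrib (SmoothOp ι) := inferInstance

instance : Monoid (SmoothOp ι) := inferInstance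

instance : Semigroup (SmoothOp ι) := inferInstance

instance : MulOneClass (SmoothOp ι) := inferInstance

instance : Mul (SmoothOp ι) := inferInstance

instance : AddCommGroup (SmoothOp ι) := inferInstance

instance : AddCommMonoid (SmoothOp ι) := inferInstance

instance : AddGroup (SmoothOp ι) := inferInstance

instance : SubtractionMonoid (SmoothOp ι) := inferInstance

instance : AddMonoid (SmoothOp ι) := inferInstance

instance : AddZeroClass (SmoothOp ι) := inferInstance

namespace Smooth

lemma contDiff (f : Smooth ι) : ContDiff ℝ ∞ (f : (ι → ℂ) → ℂ) := f.2

lemma differentiable (f : Smooth ι) : Differentiable ℝ f :=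
  f.contDiff.differentiable (by simp)

/-- A smooth function, as an element of the algebra of smooth functions. -/
def of (f : (ι → ℂ) → ℂ) (hf : ContDiff ℝ ∞ f) : Smooth ι := ⟨f, hf⟩

@[simp] lemma of_apply (f : (ι → ℂ) → ℂ) (hf : ContDiff ℝ ∞ f) (x : ι → ℂ) :
    Smooth.of f hf x = f x := rfl

@[ext] lemma ext {f g : Smooth ι} (h : ∀ x, f x = g x) : f = g := DFunLike.ext f g h

@[simp] lemma add_apply (f g : Smooth ι) (x : ι → ℂ) : (f + g) x = f x + g x := rfl

@[simp] lemma sub_apply (f g : Smooth ι) (x : ι → ℂ) : (f - g) x = f x - g x := rfl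

@[simp] lemma mul_apply (f g : Smooth ι) (x : ι → ℂ) : (f * g) x = f x * g x := rfl

@[simp] lemma neg_apply (f : Smooth ι) (x : ι → ℂ) : (-f) x = - f x := rfl

@[simp] lemma zero_apply (x : ι → ℂ) : (0 : Smooth ι) x = 0 := rfl

@[simp] lemma one_apply (x : ι → ℂ) : (1 : Smooth ι) x = 1 := rfl

@[simp] lemma smul_apply (c : ℂ) (f : Smooth ι) (x : ι → ℂ) : (c • f) x = c * f x := rfl

@[simp] lemma algebraMap_apply (c : ℂ) (x : ι → ℂ) : algebraMap ℂ (Smooth ι) c x = c := rfl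

/-- Evaluation at a point. -/
def eval (x : ι → ℂ) : Smooth ι →+* ℂ where
  toFun f := f x
  map_one' := rfl
  map_mul' _ _ := rfl
  map_zero' := rfl
  map_add' _ _ := rfl

lemma eval_apply (x : ι → ℂ) (f : Smooth ι) : eval x f = f x := rfl

end Smooth

/-- The derivative of smooth functions in the direction `v`. -/
def dirDeriv (v : ι → ℂ) : SmoothOp ι where
  toFun f := Smooth.of (fun x => fderiv ℝ f x v)
    ((f.contDiff.fderiv_right (m := ∞) (by simp)).clm_apply contDiff_const)
  map_add' f g := by
    ext x
    change fderiv ℝ (fun y => f y + g y) x v = fderiv ℝ f x v + fderiv ℝ g x v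
    rw [fderiv_fun_add f.differentiable.differentiableAt g.differentiable.differentiableAt]
    rfl
  map_smul' c f := by
    ext x
    change fderiv ℝ (fun y => c • f y) x v = c • fderiv ℝ f x v
    rw [fderiv_fun_const_smul f.differentiable.differentiableAt]
    rfl

lemma dirDeriv_apply (v : ι → ℂ) (f : Smooth ι) (x : ι → ℂ) :
    dirDeriv v f x = fderiv ℝ f x v := rfl

lemma dirDeriv_mul_apply (v : ι → ℂ) (f g : Smooth ι) :
    dirDeriv v (f * g) = dirDeriv v f * g + f * dirDeriv v g := by
  ext x
  change fderiv ℝ (fun y => f y * g y) x v = fderiv ℝ f x v * g x + f x * fderiv ℝ g x v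
  rw [fderiv_fun_mul f.differentiable.differentiableAt g.differentiable.differentiableAt]
  simp only [_root_.add_apply, _root_.smul_apply, smul_eq_mul]
  ring

lemma dirDeriv_add (v w : ι → ℂ) : dirDeriv (v + w) = dirDeriv v + dirDeriv w := by
  ext f x
  simp [dirDeriv_apply]

lemma dirDeriv_smul (r : ℝ) (v : ι → ℂ) : dirDeriv (r • v) = (r : ℂ) • dirDeriv v := by
  ext f x
  rw [LinearMap.smul_apply, Smooth.smul_apply, dirDeriv_apply, dirDeriv_apply, map_smul,
    Complex.real_smul]

lemma fderiv_dirDeriv (v w : ι → ℂ) (f : Smooth ι) (x : ι → ℂ) :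
    dirDeriv w (dirDeriv v f) x =
      fderiv ℝ (fderiv ℝ f) x w v := by
  have hd : DifferentiableAt ℝ (fderiv ℝ f) x :=
    ((f.contDiff.fderiv_right (m := ∞) (by simp)).differentiable (by simp)).differentiableAt
  change fderiv ℝ (fun y => fderiv ℝ f y v) x w = _
  rw [fderiv_clm_apply hd (differentiableAt_const v)]
  simp

lemma dirDeriv_comm (v w : ι → ℂ) : dirDeriv v * dirDeriv w = dirDeriv w * dirDeriv v := by
  ext f x
  simp only [Module.End.mul_apply, fderiv_dirDeriv]
  have : IsSymmSndFDerivAt ℝ f x :=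
    f.contDiff.contDiffAt.isSymmSndFDerivAt
      (by rw [minSmoothness_of_isRCLikeNormedField]; exact WithTop.coe_le_coe.mpr le_top)
  exact this v w

lemma dirDeriv_commute (v w : ι → ℂ) : Commute (dirDeriv v) (dirDeriv w) := dirDeriv_comm v w

/-- Multiplication by a smooth function. -/
def mulOp : Smooth ι →ₐ[ℂ] SmoothOp ι := Algebra.lmul ℂ (Smooth ι)

lemma mulOp_apply (f g : Smooth ι) : mulOp f g = f * g := rfl

lemma dirDeriv_mul_mulOp (v : ι → ℂ) (f : Smooth ι) :
    dirDeriv v * mulOp f = mulOp f * dirDeriv v + mulOp (dirDeriv v f) := by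
  refine LinearMap.ext fun g => ?_
  simp only [Module.End.mul_apply, LinearMap.add_apply, mulOp_apply, dirDeriv_mul_apply]
  ring

lemma mulOp_algebraMap (c : ℂ) : mulOp (algebraMap ℂ (Smooth ι) c) = c • 1 := by
  rw [AlgHom.commutes, Algebra.algebraMap_eq_smul_one]

/-- The coordinate function `z_i`. -/
def coord (i : ι) : Smooth ι :=
  .of (fun z => z i) (by fun_prop)

/-- The conjugate coordinate function `z̄_i`. -/
def conjCoord (i : ι) : Smooth ι :=
  .of (fun z => star (z i)) (Complex.conjCLE.contDiff.comp
    (by fun_prop : ContDiff ℝ ∞ fun z : ι → ℂ => z i))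

lemma coord_apply (i : ι) (z : ι → ℂ) : coord i z = z i := rfl

lemma conjCoord_apply (i : ι) (z : ι → ℂ) : conjCoord i z = star (z i) := rfl

lemma dirDeriv_coord (v : ι → ℂ) (i : ι) : dirDeriv v (coord i) = algebraMap ℂ _ (v i) := by
  ext x
  have : HasFDerivAt (fun z : ι → ℂ => z i) (ContinuousLinearMap.proj (R := ℝ) i) x :=
    hasFDerivAt_apply i x
  change fderiv ℝ (fun z : ι → ℂ => z i) x v = v i
  rw [this.fderiv]
  rfl

lemma dirDeriv_conjCoord (v : ι → ℂ) (i : ι) :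
    dirDeriv v (conjCoord i) = algebraMap ℂ _ (star (v i)) := by
  ext x
  have h1 : HasFDerivAt (fun z : ι → ℂ => z i) (ContinuousLinearMap.proj (R := ℝ) i) x :=
    hasFDerivAt_apply i x
  have : HasFDerivAt (fun z : ι → ℂ => star (z i))
      ((Complex.conjCLE : ℂ →L[ℝ] ℂ).comp (ContinuousLinearMap.proj (R := ℝ) i)) x :=
    (Complex.conjCLE : ℂ →L[ℝ] ℂ).hasFDerivAt.comp x h1
  change fderiv ℝ (fun z : ι → ℂ => star (z i)) x v = star (v i)
  rw [this.fderiv]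
  rfl

/-- The commutator of the first derivative with the coordinate is the scalar v_j, and each of the
two derivatives contributes it once. -/
lemma commutator_dirDeriv_sq_coord (v : ι → ℂ) (j : ι) :
    commutator (dirDeriv v * dirDeriv v) (mulOp (coord j)) = (2 * v j) • dirDeriv v := by
  have h := dirDeriv_mul_mulOp v (coord j)
  rw [dirDeriv_coord, mulOp_algebraMap] at h
  rw [commutator_apply, mul_assoc, h, mul_add, ← mul_assoc, h]
  simp only [add_mul, smul_mul_assoc, mul_smul_comm, one_mul, mul_one, two_mul, add_smul]
  noncomm_ring

lemma commutator_dirDeriv_sq_conjCoord (v : ι → ℂ) (j : ι) :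
    commutator (dirDeriv v * dirDeriv v) (mulOp (conjCoord j)) =
      (2 * star (v j)) • dirDeriv v := by
  have h := dirDeriv_mul_mulOp v (conjCoord j)
  rw [dirDeriv_conjCoord, mulOp_algebraMap] at h
  rw [commutator_apply, mul_assoc, h, mul_add, ← mul_assoc, h]
  simp only [add_mul, smul_mul_assoc, mul_smul_comm, one_mul, mul_one, two_mul, add_smul]
  noncomm_ring

variable [DecidableEq ι]

/-- The Wirtinger operator `2 ∂/∂z_i`. -/
def wirtinger (i : ι) : SmoothOp ι :=
  dirDeriv (Pi.single i 1) - Complex.I • dirDeriv (Pi.single i Complex.I)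

/-- The Wirtinger operator `2 ∂/∂z̄_i`. -/
def conjWirtinger (i : ι) : SmoothOp ι :=
  dirDeriv (Pi.single i 1) + Complex.I • dirDeriv (Pi.single i Complex.I)

/-- The Laplacian in the variable `z_i`. -/
def coordLaplacian (i : ι) : SmoothOp ι :=
  dirDeriv (Pi.single i 1) * dirDeriv (Pi.single i 1) +
    dirDeriv (Pi.single i Complex.I) * dirDeriv (Pi.single i Complex.I)

/-- The Laplacian of `ℂ^ι`. -/
def laplacian (ι : Type*) [Fintype ι] [DecidableEq ι] : SmoothOp ι :=
  ∑ i, coordLaplacian i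

lemma commute_dirDeriv_conjWirtinger (v : ι → ℂ) (i : ι) :
    Commute (dirDeriv v) (conjWirtinger i) :=
  (dirDeriv_commute _ _).add_right ((dirDeriv_commute _ _).smul_right _)

lemma commute_dirDeriv_coordLaplacian (v : ι → ℂ) (i : ι) :
    Commute (dirDeriv v) (coordLaplacian i) := by
  unfold coordLaplacian
  exact ((dirDeriv_commute _ _).mul_right (dirDeriv_commute _ _)).add_right
    ((dirDeriv_commute _ _).mul_right (dirDeriv_commute _ _))

lemma commute_coordLaplacian (i j : ι) : Commute (coordLaplacian i) (coordLaplacian j) := by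
  conv in coordLaplacian i => unfold coordLaplacian
  exact Commute.add_left
    ((commute_dirDeriv_coordLaplacian _ _).mul_left (commute_dirDeriv_coordLaplacian _ _))
    ((commute_dirDeriv_coordLaplacian _ _).mul_left (commute_dirDeriv_coordLaplacian _ _))

lemma commute_wirtinger_coordLaplacian (i j : ι) : Commute (wirtinger i) (coordLaplacian j) :=
  (commute_dirDeriv_coordLaplacian _ _).sub_left
    ((commute_dirDeriv_coordLaplacian _ _).smul_left _)

lemma commute_conjWirtinger_coordLaplacian (i j : ι) :
    Commute (conjWirtinger i) (coordLaplacian j) :=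
  (commute_dirDeriv_coordLaplacian _ _).add_left
    ((commute_dirDeriv_coordLaplacian _ _).smul_left _)

lemma commute_wirtinger_laplacian (i : ι) : Commute (wirtinger i) (laplacian ι) :=
  Commute.sum_right _ _ _ fun j _ => commute_wirtinger_coordLaplacian i j

lemma commute_conjWirtinger_laplacian (i : ι) : Commute (conjWirtinger i) (laplacian ι) :=
  Commute.sum_right _ _ _ fun j _ => commute_conjWirtinger_coordLaplacian i j

/-- The mixed terms cancel because directional derivatives commute. -/
lemma conjWirtinger_mul_wirtinger (i : ι) :
    conjWirtinger i * wirtinger i = coordLaplacian i := by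
  unfold wirtinger conjWirtinger coordLaplacian
  have h := dirDeriv_comm (Pi.single i 1 : ι → ℂ) (Pi.single i Complex.I)
  set A := dirDeriv (Pi.single i 1 : ι → ℂ)
  set B := dirDeriv (Pi.single i Complex.I : ι → ℂ)
  rw [add_mul, mul_sub, mul_sub, mul_smul_comm, smul_mul_assoc, smul_mul_assoc, mul_smul_comm, h,
    smul_smul, Complex.I_mul_I, neg_one_smul]
  abel

lemma commutator_add_left {R : Type*} [Ring R] (S T X : R) :
    commutator (S + T) X = commutator S X + commutator T X := by
  simp only [commutator_apply]; noncomm_ring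

lemma commutator_sum_left {R : Type*} [Ring R] {κ : Type*} (s : Finset κ) (T : κ → R) (X : R) :
    commutator (∑ i ∈ s, T i) X = ∑ i ∈ s, commutator (T i) X := by
  simp only [commutator_apply, Finset.sum_mul, Finset.mul_sum, Finset.sum_sub_distrib]

lemma commutator_laplacian_coord (j : ι) :
    commutator (laplacian ι) (mulOp (coord j)) = (2 : ℂ) • conjWirtinger j := by
  unfold laplacian coordLaplacian
  simp only [commutator_sum_left, commutator_add_left, commutator_dirDeriv_sq_coord]
  rw [Finset.sum_eq_single j]
  · simp only [Pi.single_eq_same, conjWirtinger, smul_add, smul_smul, mul_one]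
  · intro i _ hij
    simp [Pi.single_eq_of_ne hij.symm]
  · simp

lemma commutator_laplacian_conjCoord (j : ι) :
    commutator (laplacian ι) (mulOp (conjCoord j)) = (2 : ℂ) • wirtinger j := by
  unfold laplacian coordLaplacian
  simp only [commutator_sum_left, commutator_add_left, commutator_dirDeriv_sq_conjCoord]
  rw [Finset.sum_eq_single j]
  · simp only [Pi.single_eq_same, wirtinger, smul_sub, smul_smul, mul_one, star_one]
    simp [sub_eq_add_neg]
  · intro i _ hij
    simp [Pi.single_eq_of_ne hij.symm]
  · simp

lemma commutator_laplacian_wirtinger (j : ι) :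
    commutator (laplacian ι) (wirtinger j) = 0 :=
  sub_eq_zero.mpr (commute_wirtinger_laplacian j).symm

lemma commutator_laplacian_conjWirtinger (j : ι) :
    commutator (laplacian ι) (conjWirtinger j) = 0 :=
  sub_eq_zero.mpr (commute_conjWirtinger_laplacian j).symm

end Smooth

/-! ### Intertwined operators -/

section Intertwines

variable {M N : Type*} [AddCommGroup M] [Module ℂ M] [AddCommGroup N] [Module ℂ N]

/-- The operator `T` preserves the subspace `I`, and the map `R` intertwines `T` on `I` with
`T'`. -/
structure Intertwines (R : M →ₗ[ℂ] N) (I : Submodule ℂ M) (T : Module.End ℂ M)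
    (T' : Module.End ℂ N) : Prop where
  mem : ∀ f ∈ I, T f ∈ I
  map : ∀ f ∈ I, R (T f) = T' (R f)

namespace Intertwines

variable {R : M →ₗ[ℂ] N} {I : Submodule ℂ M} {T S : Module.End ℂ M} {T' S' : Module.End ℂ N}

lemma one : Intertwines R I 1 1 := ⟨fun _ hf => hf, fun _ _ => rfl⟩

lemma zero : Intertwines R I 0 0 := ⟨fun _ _ => I.zero_mem, fun _ _ => by simp⟩

lemma mul (h : Intertwines R I T T') (h' : Intertwines R I S S') :
    Intertwines R I (T * S) (T' * S') :=
  ⟨fun f hf => h.mem _ (h'.mem f hf), fun f hf => by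
    simp only [Module.End.mul_apply]
    rw [h.map _ (h'.mem f hf), h'.map f hf]⟩

lemma add (h : Intertwines R I T T') (h' : Intertwines R I S S') :
    Intertwines R I (T + S) (T' + S') :=
  ⟨fun f hf => I.add_mem (h.mem f hf) (h'.mem f hf), fun f hf => by
    simp only [LinearMap.add_apply, map_add, h.map f hf, h'.map f hf]⟩

lemma sub (h : Intertwines R I T T') (h' : Intertwines R I S S') :
    Intertwines R I (T - S) (T' - S') :=
  ⟨fun f hf => I.sub_mem (h.mem f hf) (h'.mem f hf), fun f hf => by
    simp only [LinearMap.sub_apply, map_sub, h.map f hf, h'.map f hf]⟩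

lemma sum {κ : Type*} (s : Finset κ) {T : κ → Module.End ℂ M} {T' : κ → Module.End ℂ N}
    (h : ∀ i ∈ s, Intertwines R I (T i) (T' i)) :
    Intertwines R I (∑ i ∈ s, T i) (∑ i ∈ s, T' i) := by
  classical
  induction s using Finset.induction_on with
  | empty => simpa using zero
  | insert a s ha ih =>
    rw [Finset.sum_insert ha, Finset.sum_insert ha]
    exact (h a (Finset.mem_insert_self a s)).add
      (ih fun i hi => h i (Finset.mem_insert_of_mem hi))

/-- This is how two easy intertwining relations, for the Laplacian and for invariant polynomials,
produce the radial parts of all the higher invariant operators. -/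
lemma iterate_commutator (h : Intertwines R I T T') (h' : Intertwines R I S S') (m : ℕ) :
    Intertwines R I ((commutator T)^[m] S) ((commutator T')^[m] S') := by
  induction m with
  | zero => exact h'
  | succ m ih =>
    rw [Function.iterate_succ_apply', Function.iterate_succ_apply']
    exact (h.mul ih).sub (ih.mul h)

lemma matrix_mul {n : ℕ} {A B : Matrix (Fin n) (Fin n) (Module.End ℂ M)}
    {A' B' : Matrix (Fin n) (Fin n) (Module.End ℂ N)}
    (h : ∀ i j, Intertwines R I (A i j) (A' i j)) (h' : ∀ i j, Intertwines R I (B i j) (B' i j))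
    (i j : Fin n) : Intertwines R I ((A * B) i j) ((A' * B') i j) := by
  rw [Matrix.mul_apply, Matrix.mul_apply]
  exact sum _ fun k _ => (h i k).mul (h' k j)

lemma matrix_pow {n : ℕ} {A : Matrix (Fin n) (Fin n) (Module.End ℂ M)}
    {A' : Matrix (Fin n) (Fin n) (Module.End ℂ N)}
    (h : ∀ i j, Intertwines R I (A i j) (A' i j)) (k : ℕ) (i j : Fin n) :
    Intertwines R I ((A ^ k) i j) ((A' ^ k) i j) := by
  induction k generalizing i j with
  | zero =>
    rw [pow_zero, pow_zero, Matrix.one_apply, Matrix.one_apply]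
    split_ifs
    exacts [one, zero]
  | succ k ih =>
    rw [pow_succ, pow_succ]
    exact matrix_mul ih h i j

lemma matrix_trace {n : ℕ} {A : Matrix (Fin n) (Fin n) (Module.End ℂ M)}
    {A' : Matrix (Fin n) (Fin n) (Module.End ℂ N)}
    (h : ∀ i j, Intertwines R I (A i j) (A' i j)) :
    Intertwines R I A.trace A'.trace :=
  sum _ fun i _ => h i i

end Intertwines

end Intertwines

/-! ### Iterated commutators of the Laplacian with invariant polynomials -/

section PowerTrace

variable {n : ℕ}

/-- The matrix of coordinate functions on `V_n`. -/
def coordMatrix (n : ℕ) : Matrix (Fin n) (Fin n) (Smooth (Fin n × Fin n)) :=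
  Matrix.of fun i j => coord (i, j)

/-- The adjoint of the matrix of coordinate functions on `V_n`. -/
def adjCoordMatrix (n : ℕ) : Matrix (Fin n) (Fin n) (Smooth (Fin n × Fin n)) :=
  Matrix.of fun i j => conjCoord (j, i)

/-- The invariant polynomial `tr((ξ ξ*)^k)`. -/
def powerTrace (n k : ℕ) : Smooth (Fin n × Fin n) :=
  ((coordMatrix n * adjCoordMatrix n) ^ k).trace

/-- The matrix of operators `4 ∂/∂ξ̄ (∂/∂ξ̄)*`. -/
def derivMatrix (n : ℕ) : Matrix (Fin n) (Fin n) (SmoothOp (Fin n × Fin n)) :=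
  (Matrix.of fun i j => (2 : ℂ) • conjWirtinger (i, j)) *
    Matrix.of fun i j => (2 : ℂ) • wirtinger (j, i)

lemma commutator_smul {R : Type*} [Ring R] [Algebra ℂ R] (T X : R) (c : ℂ) :
    commutator T (c • X) = c • commutator T X := by
  simp only [commutator_apply, mul_smul_comm, smul_mul_assoc, smul_sub]

/-- A derivation of a ring, applied to the entries of matrices. -/
lemma mapMatrix_derivation_mul {R : Type*} [Ring R] (δ : R →+ R)
    (hδ : ∀ x y, δ (x * y) = δ x * y + x * δ y) (A B : Matrix (Fin n) (Fin n) R) :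
    δ.mapMatrix (A * B) = δ.mapMatrix A * B + A * δ.mapMatrix B := by
  ext i j
  simp only [AddMonoidHom.mapMatrix_apply, Matrix.map_apply, Matrix.add_apply, Matrix.mul_apply,
    map_sum, hδ, Finset.sum_add_distrib]

/-- The commutator with the Laplacian is a derivation that sends coordinates to constant-coefficient
first-order operators and kills the latter. Applied entrywise, two steps take Ξ Ξs to twice
`derivMatrix n`, and one more gives 0. So `iterate_derivation_pow` applies in the noncommutative
ring of matrices of operators. -/
lemma iterate_commutator_powerTrace (k : ℕ) :
    (commutator (laplacian (Fin n × Fin n)))^[2 * k] (mulOp (powerTrace n k)) =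
      (2 * k).factorial • (derivMatrix n ^ k).trace := by
  set δ := commutator (laplacian (Fin n × Fin n)) with hδ
  set Ξ : Matrix (Fin n) (Fin n) (SmoothOp (Fin n × Fin n)) := Matrix.of fun i j =>
    mulOp (coord (i, j)) with hΞ
  set Ξs : Matrix (Fin n) (Fin n) (SmoothOp (Fin n × Fin n)) := Matrix.of fun i j =>
    mulOp (conjCoord (j, i)) with hΞs
  have h1 : δ.mapMatrix Ξ = Matrix.of fun i j => (2 : ℂ) • conjWirtinger (i, j) := by
    ext1 i j
    exact commutator_laplacian_coord (i, j)
  have h2 : δ.mapMatrix Ξs = Matrix.of fun i j => (2 : ℂ) • wirtinger (j, i) := by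
    ext1 i j
    exact commutator_laplacian_conjCoord (j, i)
  have h3 : δ.mapMatrix (δ.mapMatrix Ξ) = 0 := by
    rw [h1]
    ext1 i j
    change δ ((2 : ℂ) • conjWirtinger (i, j)) = 0
    rw [hδ, commutator_smul, commutator_laplacian_conjWirtinger, smul_zero]
  have h4 : δ.mapMatrix (δ.mapMatrix Ξs) = 0 := by
    rw [h2]
    ext1 i j
    change δ ((2 : ℂ) • wirtinger (j, i)) = 0
    rw [hδ, commutator_smul, commutator_laplacian_wirtinger, smul_zero]
  have hδm := mapMatrix_derivation_mul (n := n) δ (commutator_mul _)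
  have hb : derivMatrix n = δ.mapMatrix Ξ * δ.mapMatrix Ξs := by rw [h1, h2]; rfl
  have h5 : δ.mapMatrix (δ.mapMatrix (Ξ * Ξs)) = 2 • derivMatrix n := by
    rw [hδm, map_add, hδm, hδm, h3, h4, hb, two_nsmul]
    simp
  have h6 : δ.mapMatrix (derivMatrix n) = 0 := by
    rw [hb, hδm, h3, h4]; simp
  set d : Matrix (Fin n) (Fin n) (SmoothOp (Fin n × Fin n)) →+
    Matrix (Fin n) (Fin n) (SmoothOp (Fin n × Fin n)) := δ.mapMatrix with hd
  have h7 := (iterate_derivation_pow d hδm h5 h6 k).1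
  have h8 : ∀ (m : ℕ) (A : Matrix (Fin n) (Fin n) (SmoothOp (Fin n × Fin n))),
      δ^[m] A.trace = (d^[m] A).trace := by
    intro m A
    induction m with
    | zero => rfl
    | succ m ih =>
      rw [Function.iterate_succ_apply', Function.iterate_succ_apply', ih]
      exact AddMonoidHom.map_trace δ _
  have h9 : mulOp (powerTrace n k) = ((Ξ * Ξs) ^ k).trace := by
    have hm : (mulOp : Smooth (Fin n × Fin n) →ₐ[ℂ] _).toRingHom.mapMatrix
        (coordMatrix n * adjCoordMatrix n) = Ξ * Ξs := by
      rw [map_mul]; rfl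
    rw [← hm, ← map_pow]
    exact AddMonoidHom.map_trace
      (mulOp : Smooth (Fin n × Fin n) →ₐ[ℂ] _).toRingHom.toAddMonoidHom _
  rw [h9, h8, h7, Matrix.trace_smul]

/-- The squared modulus of a coordinate. -/
def coordSq {ι : Type*} [Fintype ι] (i : ι) : Smooth ι := coord i * conjCoord i

/-- The power sum `∑ |z_i|^{2k}`. -/
def powerSum (n k : ℕ) : Smooth (Fin n) := ∑ i, coordSq i ^ k

/-- The same computation in scalar form, for each variable separately; here the quadratic element
becomes 4Δ_i. -/
lemma iterate_commutator_powerSum (k : ℕ) :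
    (commutator (laplacian (Fin n)))^[2 * k] (mulOp (powerSum n k)) =
      (2 * k).factorial • ∑ i, ((4 : ℂ) • coordLaplacian i) ^ k := by
  set δ := commutator (laplacian (Fin n)) with hδ
  have hit : ∀ i : Fin n, δ^[2 * k] (mulOp (coordSq i) ^ k) =
      (2 * k).factorial • ((4 : ℂ) • coordLaplacian i) ^ k := by
    intro i
    have h1 : δ (mulOp (coord i)) = (2 : ℂ) • conjWirtinger i := commutator_laplacian_coord i
    have h2 : δ (mulOp (conjCoord i)) = (2 : ℂ) • wirtinger i := commutator_laplacian_conjCoord i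
    have h3 : δ ((2 : ℂ) • conjWirtinger i) = 0 := by
      rw [hδ, commutator_smul, commutator_laplacian_conjWirtinger, smul_zero]
    have h4 : δ ((2 : ℂ) • wirtinger i) = 0 := by
      rw [hδ, commutator_smul, commutator_laplacian_wirtinger, smul_zero]
    have hm : ∀ x y, δ (x * y) = δ x * y + x * δ y := commutator_mul _
    have hb : ((2 : ℂ) • conjWirtinger i) * ((2 : ℂ) • wirtinger i) =
        (4 : ℂ) • coordLaplacian i := by
      rw [smul_mul_assoc, mul_smul_comm, smul_smul, conjWirtinger_mul_wirtinger]
      norm_num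
    refine (iterate_derivation_pow δ hm ?_ ?_ k).1
    · rw [coordSq, map_mul, hm, map_add, hm, hm, h1, h2, h3, h4, hb, two_nsmul]
      simp
    · rw [← hb, hm, h3, h4]; simp
  have hsum : ∀ (m : ℕ) (f : Fin n → SmoothOp (Fin n)), δ^[m] (∑ i, f i) = ∑ i, δ^[m] (f i) := by
    intro m f
    induction m with
    | zero => rfl
    | succ m ih => simp only [Function.iterate_succ_apply', ih, map_sum]
  rw [powerSum, map_sum, hsum, Finset.smul_sum]
  exact Finset.sum_congr rfl fun i _ => by rw [map_pow, hit]

end PowerTrace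

/-! ### Smooth functions given by Fourier integrals -/

section FourierIntegral

variable {ι : Type*} [Fintype ι]

/-- The real inner product `Re ∑ x_i ȳ_i`. -/
def realInner (x y : ι → ℂ) : ℝ := ∑ i, (x i * star (y i)).re

lemma realInner_add_left (x x' y : ι → ℂ) :
    realInner (x + x') y = realInner x y + realInner x' y := by
  simp only [realInner, Pi.add_apply, add_mul, Complex.add_re, Finset.sum_add_distrib]

lemma realInner_add_right (x y y' : ι → ℂ) :
    realInner x (y + y') = realInner x y + realInner x y' := by
  simp only [realInner, Pi.add_apply, star_add, mul_add, Complex.add_re, Finset.sum_add_distrib]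

lemma realInner_smul_left (r : ℝ) (x y : ι → ℂ) : realInner (r • x) y = r * realInner x y := by
  simp only [realInner, Pi.smul_apply, Finset.mul_sum]
  refine Finset.sum_congr rfl fun i _ => ?_
  rw [Complex.real_smul, mul_assoc, Complex.re_ofReal_mul]

lemma realInner_smul_right (r : ℝ) (x y : ι → ℂ) : realInner x (r • y) = r * realInner x y := by
  simp only [realInner, Pi.smul_apply, Finset.mul_sum]
  refine Finset.sum_congr rfl fun i _ => ?_
  rw [star_smul, star_trivial, mul_smul_comm, Complex.real_smul, Complex.re_ofReal_mul]

/-- The real inner product as a bilinear form, normalized for Fourier integrals. -/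
def fourierForm (ι : Type*) [Fintype ι] : (ι → ℂ) →L[ℝ] (ι → ℂ) →L[ℝ] ℝ :=
  LinearMap.toContinuousLinearMap
    { toFun := fun y => LinearMap.toContinuousLinearMap
        { toFun := fun x => -(realInner x y / (2 * Real.pi))
          map_add' := fun a b => by rw [realInner_add_left]; ring
          map_smul' := fun r a => by
            rw [realInner_smul_left, RingHom.id_apply, smul_eq_mul]; ring }
      map_add' := fun a b => by
        ext x
        simp only [realInner_add_right, LinearMap.coe_toContinuousLinearMap', LinearMap.coe_mk,
          AddHom.coe_mk, _root_.add_apply]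
        ring
      map_smul' := fun r a => by
        ext x
        simp only [realInner_smul_right, RingHom.id_apply, smul_eq_mul,
          LinearMap.coe_toContinuousLinearMap', LinearMap.coe_mk, AddHom.coe_mk,
          _root_.smul_apply]
        ring }

lemma fourierForm_apply (y x : ι → ℂ) :
    fourierForm ι y x = -(realInner x y / (2 * Real.pi)) := rfl

/-- The factor -1/(2π) in the form cancels the 2π and the sign in the convention for the additive
character. -/
lemma fourierChar_neg_fourierForm (y x : ι → ℂ) (c : ℂ) :
    Real.fourierChar (-(fourierForm ι y x)) • c =
      Complex.exp (Complex.I * (realInner x y : ℝ)) * c := by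
  rw [fourierForm_apply, neg_neg, Circle.smul_def, Real.fourierChar_apply, smul_eq_mul]
  congr 2
  push_cast
  have : (Real.pi : ℂ) ≠ 0 := by exact_mod_cast Real.pi_ne_zero
  field_simp

lemma fourierIntegral_fourierForm (μ : Measure (ι → ℂ)) (g : (ι → ℂ) → ℂ) (x : ι → ℂ) :
    VectorFourier.fourierIntegral Real.fourierChar μ
      (ContinuousLinearMap.toLinearMap₁₂ (fourierForm ι)) g x =
      ∫ y, Complex.exp (Complex.I * (realInner x y : ℝ)) * g y ∂μ := by
  unfold VectorFourier.fourierIntegral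
  refine integral_congr_ae (Eventually.of_forall fun y => ?_)
  exact fourierChar_neg_fourierForm y x (g y)

/-- Integrability of every continuous function supplies all the moments needed to differentiate
under the integral. Orbital measures satisfy it because the group is compact. -/
lemma contDiff_integral_cexp_mul {μ : Measure (ι → ℂ)}
    (hμ : ∀ g : C(ι → ℂ, ℂ), Integrable g μ) (g : C(ι → ℂ, ℂ)) :
    ContDiff ℝ ∞ fun x => ∫ y, Complex.exp (Complex.I * (realInner x y : ℝ)) * g y ∂μ := by
  have := VectorFourier.contDiff_fourierIntegral (E := ℂ) (fourierForm ι) (f := g) (μ := μ)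
    (N := ⊤) fun m _ => by
      have h := (hμ ⟨fun y => ((‖y‖ ^ m * ‖g y‖ : ℝ) : ℂ), by fun_prop⟩).norm
      refine h.congr (Eventually.of_forall fun y => ?_)
      simp only [ContinuousMap.coe_mk, Complex.norm_real, Real.norm_eq_abs]
      exact abs_of_nonneg (by positivity)
  have h : (fun x => ∫ y, Complex.exp (Complex.I * (realInner x y : ℝ)) * g y ∂μ) =
      VectorFourier.fourierIntegral Real.fourierChar μ
        (ContinuousLinearMap.toLinearMap₁₂ (fourierForm ι)) g :=
    funext fun x => (fourierIntegral_fourierForm μ g x).symm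
  rw [h]
  exact this

/-- The real inner product with a vector, as a continuous function. -/
def realInnerMap (v : ι → ℂ) : C(ι → ℂ, ℂ) where
  toFun y := (realInner v y : ℝ)
  continuous_toFun := by unfold realInner; fun_prop

/-- The character `y ↦ exp(i ⟨x, y⟩)`. -/
def expMap (x : ι → ℂ) : C(ι → ℂ, ℂ) where
  toFun y := Complex.exp (Complex.I * (realInner x y : ℝ))
  continuous_toFun := by unfold realInner; fun_prop

/-- The smooth function `x ↦ ∫ exp(i ⟨x, y⟩) g(y) μ(dy)`, as a linear function of `g`. -/
def fourierSmooth {μ : Measure (ι → ℂ)} (hμ : ∀ g : C(ι → ℂ, ℂ), Integrable g μ) :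
    C(ι → ℂ, ℂ) →ₗ[ℂ] Smooth ι where
  toFun g := .of _ (contDiff_integral_cexp_mul hμ g)
  map_add' g h := by
    ext x
    simp only [Smooth.of_apply, Smooth.add_apply, ContinuousMap.add_apply, mul_add]
    exact integral_add (hμ (expMap x * g)) (hμ (expMap x * h))
  map_smul' c g := by
    ext x
    simp only [Smooth.of_apply, Smooth.smul_apply, ContinuousMap.smul_apply, smul_eq_mul,
      RingHom.id_apply, ← integral_const_mul]
    exact integral_congr_ae (Eventually.of_forall fun y => by simp only []; ring)

lemma fourierSmooth_apply {μ : Measure (ι → ℂ)} (hμ : ∀ g : C(ι → ℂ, ℂ), Integrable g μ)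
    (g : C(ι → ℂ, ℂ)) (x : ι → ℂ) : fourierSmooth hμ g x =
      ∫ y, Complex.exp (Complex.I * (realInner x y : ℝ)) * g y ∂μ := rfl

lemma dirDeriv_fourierSmooth {μ : Measure (ι → ℂ)} (hμ : ∀ g : C(ι → ℂ, ℂ), Integrable g μ)
    (g : C(ι → ℂ, ℂ)) (v : ι → ℂ) :
    dirDeriv v (fourierSmooth hμ g) = fourierSmooth hμ (Complex.I • (realInnerMap v * g)) := by
  ext x
  have hg : Integrable g μ := hμ g
  have hg' : Integrable (fun y => ‖y‖ * ‖g y‖) μ := by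
    refine (hμ ⟨fun y => ((‖y‖ * ‖g y‖ : ℝ) : ℂ), by fun_prop⟩).norm.congr
      (Eventually.of_forall fun y => ?_)
    simp only [ContinuousMap.coe_mk, Complex.norm_real, Real.norm_eq_abs]
    exact abs_of_nonneg (by positivity)
  have h := VectorFourier.hasFDerivAt_fourierIntegral (fourierForm ι) hg hg' x
  have h0 : (fourierSmooth hμ g : (ι → ℂ) → ℂ) =
      VectorFourier.fourierIntegral Real.fourierChar μ
        (ContinuousLinearMap.toLinearMap₁₂ (fourierForm ι)) g :=
    funext fun x => (fourierIntegral_fourierForm μ g x).symm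
  rw [dirDeriv_apply, h0, h.fderiv]
  have hint : Integrable (VectorFourier.fourierSMulRight (fourierForm ι) g) μ := by
    refine (hg'.const_mul (2 * Real.pi * ‖fourierForm ι‖)).mono'
      g.continuous.aestronglyMeasurable.fourierSMulRight (Eventually.of_forall fun y => ?_)
    rw [← mul_assoc]
    exact VectorFourier.norm_fourierSMulRight_le _ _ _
  rw [Real.fourierIntegral_continuousLinearMap_apply' hint]
  unfold VectorFourier.fourierIntegral
  rw [fourierSmooth_apply]
  refine integral_congr_ae (Eventually.of_forall fun y => ?_)
  refine (fourierChar_neg_fourierForm y x _).trans ?_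
  simp only [VectorFourier.fourierSMulRight_apply, fourierForm_apply]
  simp only [ContinuousMap.smul_apply, ContinuousMap.mul_apply, realInnerMap,
    ContinuousMap.coe_mk, smul_eq_mul, Complex.real_smul]
  push_cast
  have : (Real.pi : ℂ) ≠ 0 := by exact_mod_cast Real.pi_ne_zero
  field_simp

variable [DecidableEq ι]

/-- The coordinate `y_i`, as a continuous function. -/
def coordMap (i : ι) : C(ι → ℂ, ℂ) := ⟨fun y => y i, by fun_prop⟩

/-- The conjugate coordinate `ȳ_i`, as a continuous function. -/
def conjCoordMap (i : ι) : C(ι → ℂ, ℂ) := ⟨fun y => star (y i), by fun_prop⟩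

lemma wirtinger_fourierSmooth {μ : Measure (ι → ℂ)} (hμ : ∀ g : C(ι → ℂ, ℂ), Integrable g μ)
    (g : C(ι → ℂ, ℂ)) (i : ι) :
    wirtinger i (fourierSmooth hμ g) = fourierSmooth hμ (Complex.I • (conjCoordMap i * g)) := by
  rw [wirtinger, LinearMap.sub_apply, LinearMap.smul_apply, dirDeriv_fourierSmooth,
    dirDeriv_fourierSmooth, ← map_smul, ← map_sub]
  congr 1
  ext y
  have h : ∀ z : ℂ, realInner (Pi.single i z) y = (z * star (y i)).re := by
    intro z
    rw [realInner, Finset.sum_eq_single i (fun j _ hj => by simp [Pi.single_eq_of_ne hj]) (by simp),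
      Pi.single_eq_same]
  simp only [ContinuousMap.sub_apply, ContinuousMap.smul_apply, ContinuousMap.mul_apply,
    realInnerMap, conjCoordMap, ContinuousMap.coe_mk, smul_eq_mul, h]
  have h1 : star (y i) = (((1 * star (y i)).re : ℝ) : ℂ) -
      Complex.I * (((Complex.I * star (y i)).re : ℝ) : ℂ) := by
    apply Complex.ext <;> simp
  conv_rhs => rw [h1]
  ring

lemma conjWirtinger_fourierSmooth {μ : Measure (ι → ℂ)}
    (hμ : ∀ g : C(ι → ℂ, ℂ), Integrable g μ) (g : C(ι → ℂ, ℂ)) (i : ι) :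
    conjWirtinger i (fourierSmooth hμ g) = fourierSmooth hμ (Complex.I • (coordMap i * g)) := by
  rw [conjWirtinger, LinearMap.add_apply, LinearMap.smul_apply, dirDeriv_fourierSmooth,
    dirDeriv_fourierSmooth, ← map_smul, ← map_add]
  congr 1
  ext y
  have h : ∀ z : ℂ, realInner (Pi.single i z) y = (z * star (y i)).re := by
    intro z
    rw [realInner, Finset.sum_eq_single i (fun j _ hj => by simp [Pi.single_eq_of_ne hj]) (by simp),
      Pi.single_eq_same]
  simp only [ContinuousMap.add_apply, ContinuousMap.smul_apply, ContinuousMap.mul_apply,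
    realInnerMap, coordMap, ContinuousMap.coe_mk, smul_eq_mul, h]
  have h1 : y i = (((1 * star (y i)).re : ℝ) : ℂ) +
      Complex.I * (((Complex.I * star (y i)).re : ℝ) : ℂ) := by
    apply Complex.ext <;> simp
  conv_rhs => rw [h1]
  ring

end FourierIntegral

/-! ### The spherical functions as smooth functions -/

section SmoothSpherical

variable {n : ℕ}

/-- The identification of `ℂ^(n × n)` with the space of matrices. -/
def toMat (n : ℕ) : (Fin n × Fin n → ℂ) ≃ₗ[ℂ] V n where
  toFun y := Matrix.of fun i j => y (i, j)
  invFun A p := A p.1 p.2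
  map_add' _ _ := rfl
  map_smul' _ _ := rfl
  left_inv _ := rfl
  right_inv _ := rfl

lemma toMat_apply (y : Fin n × Fin n → ℂ) (i j : Fin n) : toMat n y i j = y (i, j) := rfl

lemma toMat_symm_apply (A : V n) (p : Fin n × Fin n) : (toMat n).symm A p = A p.1 p.2 := rfl

lemma continuous_toMat_symm : Continuous (toMat n).symm :=
  continuous_pi fun p => (continuous_id.matrix_elem p.1 p.2)

lemma realInner_eq_pairing (x y : Fin n × Fin n → ℂ) :
    realInner x y = pairing (toMat n x) (toMat n y) := by
  rw [pairing_eq_sum, realInner, Fintype.sum_prod_type]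
  rfl

/-- The orbital measure, as a measure on `ℂ^(n × n)`. -/
def orbitMeasure (A : V n) : Measure (Fin n × Fin n → ℂ) :=
  (haarK n).map fun k => (toMat n).symm (act k A)

lemma continuous_toMat_symm_act (A : V n) :
    Continuous fun k : K n => (toMat n).symm (act k A) :=
  continuous_toMat_symm.comp (Continuous.act continuous_id continuous_const)

lemma integrable_orbitMeasure (A : V n) (g : C(Fin n × Fin n → ℂ, ℂ)) :
    Integrable g (orbitMeasure A) := by
  rw [orbitMeasure, integrable_map_measure g.continuous.aestronglyMeasurable
    (continuous_toMat_symm_act A).aemeasurable]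
  exact integrable_haarK (g.continuous.comp (continuous_toMat_symm_act A))

/-- The spherical function of the orbit of `A`, as a smooth function. -/
def smoothSpherical (A : V n) : Smooth (Fin n × Fin n) :=
  fourierSmooth (integrable_orbitMeasure A) 1

lemma smoothSpherical_apply (A : V n) (y : Fin n × Fin n → ℂ) :
    smoothSpherical A y = spherical A (toMat n y) := by
  rw [smoothSpherical, fourierSmooth_apply, orbitMeasure,
    integral_map (continuous_toMat_symm_act A).aemeasurable]
  · simp [spherical, realInner_eq_pairing]
  · exact (expMap y * 1).continuous.aestronglyMeasurable

/-- The matrix `-4 y y*` of functions on `V_n`, the symbol of `derivMatrix`. -/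
def symbolMatrix (n : ℕ) : Matrix (Fin n) (Fin n) C(Fin n × Fin n → ℂ, ℂ) :=
  (Matrix.of fun i j => (2 * Complex.I) • coordMap (i, j)) *
    Matrix.of fun i j => (2 * Complex.I) • conjCoordMap (j, i)

/-- Differentiating under the Fourier integral multiplies by 2i times a coordinate or its conjugate.
This is checked for the entries of the two factors and passes to products, powers and the trace. -/
lemma intertwines_derivMatrix_pow_trace (A : V n) (k : ℕ) :
    Intertwines (fourierSmooth (integrable_orbitMeasure A)) ⊤
      (Algebra.lmul ℂ C(Fin n × Fin n → ℂ, ℂ) (symbolMatrix n ^ k).trace)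
      (derivMatrix n ^ k).trace := by
  set m : C(Fin n × Fin n → ℂ, ℂ) →ₐ[ℂ] Module.End ℂ C(Fin n × Fin n → ℂ, ℂ) :=
    Algebra.lmul ℂ C(Fin n × Fin n → ℂ, ℂ) with hm
  have h1 : m (symbolMatrix n ^ k).trace = (m.mapMatrix (symbolMatrix n) ^ k).trace := by
    rw [← map_pow]
    exact AddMonoidHom.map_trace m.toRingHom.toAddMonoidHom _
  rw [h1, symbolMatrix, map_mul]
  refine Intertwines.matrix_trace fun i j => Intertwines.matrix_pow (fun i j => ?_) k i j
  refine Intertwines.matrix_mul (fun i j => ⟨fun _ _ => Submodule.mem_top, fun g _ => ?_⟩)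
    (fun i j => ⟨fun _ _ => Submodule.mem_top, fun g _ => ?_⟩) i j
  · change fourierSmooth _ (((2 * Complex.I) • coordMap (i, j)) * g) =
      (2 : ℂ) • conjWirtinger (i, j) (fourierSmooth _ g)
    rw [conjWirtinger_fourierSmooth, ← map_smul, smul_smul, smul_mul_assoc]
  · change fourierSmooth _ (((2 * Complex.I) • conjCoordMap (j, i)) * g) =
      (2 : ℂ) • wirtinger (j, i) (fourierSmooth _ g)
    rw [wirtinger_fourierSmooth, ← map_smul, smul_smul, smul_mul_assoc]

lemma trace_pow_act (k : ℕ) (u : K n) (A : V n) :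
    ((act u A * star (act u A)) ^ k).trace = ((A * star A) ^ k).trace := by
  set B := A * star A
  have h1 : star (u.1 : V n) * (u.1 : V n) = 1 := Unitary.coe_star_mul_self u.1
  have h2 : star (u.2 : V n) * (u.2 : V n) = 1 := Unitary.coe_star_mul_self u.2
  have h3 : act u A * star (act u A) = (u.1 : V n) * B * star (u.1 : V n) := by
    simp only [act, star_mul, star_star, mul_assoc, B]
    rw [← mul_assoc (star (u.2 : V n)), h2, one_mul]
  have h4 : ((u.1 : V n) * B * star (u.1 : V n)) ^ k = (u.1 : V n) * B ^ k * star (u.1 : V n) := by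
    induction k with
    | zero => simp
    | succ k ih =>
      rw [pow_succ, ih, pow_succ]
      simp only [mul_assoc]
      rw [← mul_assoc (star (u.1 : V n)), h1, one_mul]
  rw [h3, h4, Matrix.trace_mul_comm, ← mul_assoc, h1, one_mul]

lemma trace_pow_symbolMatrix_apply (k : ℕ) (y : Fin n × Fin n → ℂ) :
    (symbolMatrix n ^ k).trace y =
      (-4) ^ k * ((toMat n y * star (toMat n y)) ^ k).trace := by
  set e : C(Fin n × Fin n → ℂ, ℂ) →ₐ[ℂ] ℂ := ContinuousMap.evalAlgHom ℂ ℂ y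
  have h1 : e.mapMatrix (symbolMatrix n) = (-4 : ℂ) • (toMat n y * star (toMat n y)) := by
    have h : e.mapMatrix (symbolMatrix n) =
        ((2 * Complex.I) • toMat n y) * ((2 * Complex.I) • star (toMat n y)) := by
      rw [symbolMatrix, map_mul]; rfl
    rw [h, smul_mul_assoc, mul_smul_comm, smul_smul]
    congr 1
    linear_combination (4 : ℂ) * Complex.I_mul_I
  have h2 : e (symbolMatrix n ^ k).trace = (e.mapMatrix (symbolMatrix n ^ k)).trace :=
    AddMonoidHom.map_trace e.toRingHom.toAddMonoidHom _
  rw [map_pow, h1, smul_pow, Matrix.trace_smul, smul_eq_mul] at h2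
  exact h2

lemma trace_pow_diag (k : ℕ) (x : Fin n → ℝ) :
    ((diag x * star (diag x)) ^ k).trace = ∑ i, (x i : ℂ) ^ (2 * k) := by
  rw [diag, Matrix.star_eq_conjTranspose, Matrix.diagonal_conjTranspose, Matrix.diagonal_mul_diagonal,
    Matrix.diagonal_pow, Matrix.trace_diagonal]
  refine Finset.sum_congr rfl fun i _ => ?_
  simp [pow_mul, sq]

/-- The spherical functions are eigenfunctions of the invariant differential operators. -/
lemma derivMatrix_pow_trace_smoothSpherical (x : Fin n → ℝ) (k : ℕ) :
    (derivMatrix n ^ k).trace (smoothSpherical (diag x)) =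
      ((-4) ^ k * ∑ i, (x i : ℂ) ^ (2 * k)) • smoothSpherical (diag x) := by
  unfold smoothSpherical
  rw [← (intertwines_derivMatrix_pow_trace (diag x) k).map 1 trivial]
  ext y
  rw [Smooth.smul_apply, fourierSmooth_apply, fourierSmooth_apply, ← integral_const_mul]
  unfold orbitMeasure
  rw [integral_map (continuous_toMat_symm_act _).aemeasurable,
    integral_map (continuous_toMat_symm_act _).aemeasurable]
  -- The symbol is constant along the orbit, so it comes out of the integral as the eigenvalue.
  · refine integral_congr_ae (Eventually.of_forall fun u => ?_)
    change _ * ((symbolMatrix n ^ k).trace * 1) _ = _ * (_ * (1 : C(Fin n × Fin n → ℂ, ℂ)) _)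
    rw [mul_one, ContinuousMap.one_apply, mul_one]
    rw [trace_pow_symbolMatrix_apply, LinearEquiv.apply_symm_apply, trace_pow_act, trace_pow_diag]
    ring
  · exact (((-4) ^ k * ∑ i, (x i : ℂ) ^ (2 * k)) •
      (expMap y * 1)).continuous.aestronglyMeasurable
  · exact (expMap y * _).continuous.aestronglyMeasurable

end SmoothSpherical

/-! ### Pullback along linear maps -/

section Comap

variable {ι κ : Type*} [Fintype ι] [Fintype κ]

/-- The pullback of smooth functions along a linear map. -/
def comap (T : (κ → ℂ) →ₗ[ℂ] (ι → ℂ)) : Smooth ι →ₐ[ℂ] Smooth κ where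
  toFun f := .of (fun z => f (T z))
    (f.contDiff.comp (T.toContinuousLinearMap.restrictScalars ℝ).contDiff)
  map_one' := rfl
  map_mul' _ _ := rfl
  map_zero' := rfl
  map_add' _ _ := rfl
  commutes' _ := rfl

@[simp] lemma comap_apply (T : (κ → ℂ) →ₗ[ℂ] (ι → ℂ)) (f : Smooth ι) (z : κ → ℂ) :
    comap T f z = f (T z) := rfl

lemma dirDeriv_comap (T : (κ → ℂ) →ₗ[ℂ] (ι → ℂ)) (f : Smooth ι) (v : κ → ℂ) :
    dirDeriv v (comap T f) = comap T (dirDeriv (T v) f) := by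
  ext z
  have h1 : HasFDerivAt (fun z => T z) (T.toContinuousLinearMap.restrictScalars ℝ) z :=
    (T.toContinuousLinearMap.restrictScalars ℝ).hasFDerivAt
  have h2 : HasFDerivAt f (fderiv ℝ f (T z)) (T z) :=
    f.differentiable.differentiableAt.hasFDerivAt
  change fderiv ℝ (fun z => f (T z)) z v = fderiv ℝ f (T z) (T v)
  have h3 : HasFDerivAt (fun z => f (T z))
      ((fderiv ℝ f (T z)).comp (T.toContinuousLinearMap.restrictScalars ℝ)) z := h2.comp z h1
  rw [h3.fderiv]
  rfl

variable [DecidableEq ι] [DecidableEq κ]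

lemma dirDeriv_eq_sum (v : ι → ℂ) :
    dirDeriv v = ∑ i, (((v i).re : ℂ) • dirDeriv (Pi.single i 1) +
      ((v i).im : ℂ) • dirDeriv (Pi.single i Complex.I)) := by
  have h : v = ∑ i, ((v i).re • (Pi.single i 1 : ι → ℂ) +
      (v i).im • (Pi.single i Complex.I : ι → ℂ)) := by
    ext j
    rw [Finset.sum_apply, Finset.sum_eq_single j]
    · simp [Complex.re_add_im]
    · intro i _ hij
      simp [Pi.single_eq_of_ne hij.symm]
    · simp
  have hsum : ∀ (s : Finset ι) (w : ι → ι → ℂ), dirDeriv (∑ i ∈ s, w i) =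
      ∑ i ∈ s, dirDeriv (w i) := by
    intro s w
    induction s using Finset.induction_on with
    | empty =>
      ext f x
      simp [dirDeriv_apply]
    | insert a s ha ih => rw [Finset.sum_insert ha, Finset.sum_insert ha, dirDeriv_add, ih]
  conv_lhs => rw [h]
  rw [hsum]
  exact Finset.sum_congr rfl fun i _ => by rw [dirDeriv_add, dirDeriv_smul, dirDeriv_smul]

/-- This combination is complex linear in v, and its companion with the opposite sign is conjugate
linear. Hence pulling back along a complex linear map transforms one kind of Wirtinger operator by
its matrix and the other by the conjugate matrix. -/
lemma dirDeriv_sub_smul_I (v : ι → ℂ) :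
    dirDeriv v - Complex.I • dirDeriv (Complex.I • v) = ∑ i, v i • wirtinger i := by
  rw [dirDeriv_eq_sum v, dirDeriv_eq_sum (Complex.I • v), Finset.smul_sum,
    ← Finset.sum_sub_distrib]
  refine Finset.sum_congr rfl fun i _ => ?_
  have h := Complex.re_add_im (v i)
  have h1 : ((Complex.I • v) i).re = - (v i).im := by simp
  have h2 : ((Complex.I • v) i).im = (v i).re := by simp
  rw [h1, h2, wirtinger]
  generalize (dirDeriv (Pi.single i 1 : ι → ℂ)) = X
  generalize (dirDeriv (Pi.single i Complex.I : ι → ℂ)) = Y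
  conv_rhs => rw [← h]
  push_cast
  match_scalars
  · ring
  · linear_combination ((v i).im : ℂ) * Complex.I_mul_I

lemma dirDeriv_add_smul_I (v : ι → ℂ) :
    dirDeriv v + Complex.I • dirDeriv (Complex.I • v) = ∑ i, star (v i) • conjWirtinger i := by
  rw [dirDeriv_eq_sum v, dirDeriv_eq_sum (Complex.I • v), Finset.smul_sum,
    ← Finset.sum_add_distrib]
  refine Finset.sum_congr rfl fun i _ => ?_
  have h : ((v i).re : ℂ) - (v i).im * Complex.I = star (v i) := by
    apply Complex.ext <;> simp
  have h1 : ((Complex.I • v) i).re = - (v i).im := by simp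
  have h2 : ((Complex.I • v) i).im = (v i).re := by simp
  rw [h1, h2, conjWirtinger]
  generalize (dirDeriv (Pi.single i 1 : ι → ℂ)) = X
  generalize (dirDeriv (Pi.single i Complex.I : ι → ℂ)) = Y
  rw [← h]
  push_cast
  match_scalars
  · ring
  · linear_combination ((v i).im : ℂ) * Complex.I_mul_I

lemma wirtinger_comap (T : (κ → ℂ) →ₗ[ℂ] (ι → ℂ)) (f : Smooth ι) (p : κ) :
    wirtinger p (comap T f) =
      comap T ((∑ i, T (Pi.single p 1) i • wirtinger i) f) := by
  have h : (Pi.single p Complex.I : κ → ℂ) = Complex.I • Pi.single p 1 := by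
    rw [← Pi.single_smul]; simp
  rw [← dirDeriv_sub_smul_I, wirtinger, LinearMap.sub_apply, LinearMap.smul_apply, dirDeriv_comap,
    dirDeriv_comap, h, map_smul T, ← map_smul, ← map_sub]
  rfl

lemma conjWirtinger_comap (T : (κ → ℂ) →ₗ[ℂ] (ι → ℂ)) (f : Smooth ι) (p : κ) :
    conjWirtinger p (comap T f) =
      comap T ((∑ i, star (T (Pi.single p 1) i) • conjWirtinger i) f) := by
  have h : (Pi.single p Complex.I : κ → ℂ) = Complex.I • Pi.single p 1 := by
    rw [← Pi.single_smul]; simp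
  rw [← dirDeriv_add_smul_I, conjWirtinger, LinearMap.add_apply, LinearMap.smul_apply,
    dirDeriv_comap, dirDeriv_comap, h, map_smul T, ← map_smul, ← map_add]
  rfl

lemma laplacian_eq_sum (ι : Type*) [Fintype ι] [DecidableEq ι] :
    laplacian ι = ∑ i, conjWirtinger i * wirtinger i :=
  Finset.sum_congr rfl fun i _ => (conjWirtinger_mul_wirtinger i).symm

/-- The Laplacian commutes with the pullback along a unitary map. -/
lemma laplacian_comap (T : (κ → ℂ) →ₗ[ℂ] (ι → ℂ))
    (hT : ∀ i j, ∑ p, star (T (Pi.single p 1) i) * T (Pi.single p 1) j = if i = j then 1 else 0)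
    (f : Smooth ι) : laplacian κ (comap T f) = comap T (laplacian ι f) := by
  have h1 : ∀ p, (conjWirtinger p * wirtinger p) (comap T f) =
      comap T (((∑ i, star (T (Pi.single p 1) i) • conjWirtinger i) *
        (∑ j, T (Pi.single p 1) j • wirtinger j)) f) := by
    intro p
    rw [Module.End.mul_apply, wirtinger_comap, conjWirtinger_comap]
    rfl
  rw [laplacian_eq_sum, laplacian_eq_sum, LinearMap.sum_apply]
  simp only [h1]
  rw [← map_sum, ← LinearMap.sum_apply]
  congr 2
  simp only [Finset.sum_mul_sum, smul_mul_smul_comm]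
  rw [Finset.sum_comm]
  refine Finset.sum_congr rfl fun i _ => ?_
  rw [Finset.sum_comm]
  simp only [← Finset.sum_smul, hT]
  simp

end Comap

/-! ### Invariant functions -/

section Invariant

variable {n : ℕ}

/-- The action of `K_n` on `ℂ^(n × n)`. -/
def actMap (u : K n) : (Fin n × Fin n → ℂ) →ₗ[ℂ] (Fin n × Fin n → ℂ) where
  toFun y := (toMat n).symm (act u (toMat n y))
  map_add' y z := by rw [map_add, act_add, map_add]
  map_smul' c y := by
    rw [map_smul, RingHom.id_apply, ← map_smul]
    simp [act]

lemma actMap_apply (u : K n) (y : Fin n × Fin n → ℂ) :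
    actMap u y = (toMat n).symm (act u (toMat n y)) := rfl

/-- The invariant smooth functions. -/
def invariants (n : ℕ) : Submodule ℂ (Smooth (Fin n × Fin n)) where
  carrier := {f | ∀ u : K n, comap (actMap u) f = f}
  add_mem' {f g} hf hg u := by rw [map_add, hf u, hg u]
  zero_mem' u := map_zero _
  smul_mem' c f hf u := by rw [map_smul, hf u]

lemma mul_mem_invariants {f g : Smooth (Fin n × Fin n)} (hf : f ∈ invariants n)
    (hg : g ∈ invariants n) : f * g ∈ invariants n := fun u => by rw [map_mul, hf u, hg u]

/-- In the basis of matrix units the action is the tensor product of u₁ and the conjugate of u₂.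
This matrix is unitary, so `laplacian_comap` applies. -/
lemma laplacian_mem_invariants {f : Smooth (Fin n × Fin n)} (hf : f ∈ invariants n) :
    laplacian (Fin n × Fin n) f ∈ invariants n := by
  intro u
  rw [← laplacian_comap, hf u]
  have h1 : (u.1 : V n) * star (u.1 : V n) = 1 := Unitary.coe_mul_star_self u.1
  have h2 : (u.2 : V n) * star (u.2 : V n) = 1 := Unitary.coe_mul_star_self u.2
  have h3 : ∀ p q : Fin n × Fin n, actMap u (Pi.single p 1) q =
      (u.1 : V n) q.1 p.1 * star ((u.2 : V n) q.2 p.2) := by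
    intro p q
    rw [actMap_apply, toMat_symm_apply, act, Matrix.mul_apply, Finset.sum_eq_single p.2]
    · rw [Matrix.mul_apply, Finset.sum_eq_single p.1]
      · simp [toMat_apply, Matrix.star_apply]
      · intro b _ hb
        rw [toMat_apply, Pi.single_eq_of_ne (fun h => hb (congrArg Prod.fst h)), mul_zero]
      · simp
    · intro b _ hb
      rw [Matrix.mul_apply, Finset.sum_eq_zero, zero_mul]
      intro c _
      rw [toMat_apply, Pi.single_eq_of_ne (fun h => hb (congrArg Prod.snd h)), mul_zero]
    · simp
  intro i j
  have e1 : ∑ a, (u.1 : V n) j.1 a * star ((u.1 : V n) i.1 a) = if i.1 = j.1 then 1 else 0 := by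
    have := congrFun (congrFun h1 j.1) i.1
    rw [Matrix.mul_apply, Matrix.one_apply] at this
    simpa [Matrix.star_apply, eq_comm] using this
  have e2 : ∑ a, (u.2 : V n) i.2 a * star ((u.2 : V n) j.2 a) = if i.2 = j.2 then 1 else 0 := by
    have := congrFun (congrFun h2 i.2) j.2
    rw [Matrix.mul_apply, Matrix.one_apply] at this
    simpa [Matrix.star_apply, eq_comm] using this
  have e3 : (if i = j then (1 : ℂ) else 0) =
      (if i.1 = j.1 then 1 else 0) * (if i.2 = j.2 then 1 else 0) := by
    by_cases ha : i.1 = j.1 <;> by_cases hb : i.2 = j.2 <;> simp [ha, hb, Prod.ext_iff]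
  rw [e3, ← e1, ← e2, Finset.sum_mul_sum, Fintype.sum_prod_type]
  refine Finset.sum_congr rfl fun a _ => Finset.sum_congr rfl fun b _ => ?_
  rw [h3, h3, star_mul, star_star]
  ring

lemma powerTrace_apply (k : ℕ) (y : Fin n × Fin n → ℂ) :
    powerTrace n k y = ((toMat n y * star (toMat n y)) ^ k).trace := by
  have h1 : (Smooth.eval y).mapMatrix (coordMatrix n * adjCoordMatrix n) =
      toMat n y * star (toMat n y) := by
    rw [map_mul]; rfl
  rw [← Smooth.eval_apply, powerTrace, ← h1, ← map_pow]
  exact AddMonoidHom.map_trace (Smooth.eval y).toAddMonoidHom _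

lemma powerTrace_mem_invariants (k : ℕ) : powerTrace n k ∈ invariants n := by
  intro u
  ext y
  rw [comap_apply, powerTrace_apply, powerTrace_apply, actMap_apply, LinearEquiv.apply_symm_apply,
    trace_pow_act]

lemma smoothSpherical_mem_invariants (A : V n) : smoothSpherical A ∈ invariants n := by
  intro u
  ext y
  rw [comap_apply, smoothSpherical_apply, smoothSpherical_apply, actMap_apply,
    LinearEquiv.apply_symm_apply, spherical_act_right]

end Invariant

/-! ### Infinitesimal invariance -/

section Infinitesimal

variable {n : ℕ}

section Exp

open scoped Matrix.Norms.Operator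

lemma hasDerivAt_exp_smul_zero (X : V n) :
    HasDerivAt (fun t : ℝ => NormedSpace.exp (t • X)) X 0 := by
  have := hasDerivAt_exp_smul_const (𝕂 := ℝ) X (0 : ℝ)
  rw [zero_smul, NormedSpace.exp_zero, one_mul] at this
  exact this

lemma hasDerivAt_exp_smul_apply (X : V n) (i j : Fin n) :
    HasDerivAt (fun t : ℝ => NormedSpace.exp (t • X) i j) (X i j) 0 := by
  have h1 := hasDerivAt_exp_smul_zero X
  have h2 : HasFDerivAt (fun A : V n => A i j)
      (LinearMap.toContinuousLinearMap (Matrix.entryLinearMap ℝ ℂ i j)) 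
      (NormedSpace.exp ((0 : ℝ) • X)) :=
    (LinearMap.toContinuousLinearMap (Matrix.entryLinearMap ℝ ℂ i j)).hasFDerivAt
  exact h2.comp_hasDerivAt (0 : ℝ) h1

end Exp

/-- The one-parameter group of unitary matrices of a skew-Hermitian matrix. -/
def expUnitary (X : V n) (hX : star X = -X) (t : ℝ) : U n :=
  ⟨NormedSpace.exp (t • X), by
    have h : star (NormedSpace.exp (t • X)) = NormedSpace.exp (-(t • X)) := by
      rw [Matrix.star_eq_conjTranspose, ← Matrix.exp_conjTranspose, ← Matrix.star_eq_conjTranspose,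
        star_smul, hX, star_trivial, smul_neg]
    have h1 : NormedSpace.exp (-(t • X)) * NormedSpace.exp (t • X) = 1 := by
      rw [← Matrix.exp_add_of_commute _ _ (Commute.neg_left (Commute.refl (t • X))), neg_add_cancel,
        NormedSpace.exp_zero]
    rw [Matrix.mem_unitaryGroup_iff', h, h1]⟩

lemma expUnitary_coe (X : V n) (hX : star X = -X) (t : ℝ) :
    (expUnitary X hX t : V n) = NormedSpace.exp (t • X) := rfl

/-- The vector field `ξ ↦ X ξ - ξ Y` on `ℂ^(n × n)`. -/
def infAct (X Y : V n) : (Fin n × Fin n → ℂ) →ₗ[ℂ] (Fin n × Fin n → ℂ) where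
  toFun y := (toMat n).symm (X * toMat n y - toMat n y * Y)
  map_add' y z := by
    rw [← map_add, map_add (toMat n), mul_add, add_mul]
    congr 1
    abel
  map_smul' c y := by
    rw [map_smul, RingHom.id_apply, ← map_smul]
    simp [smul_sub]

lemma infAct_apply (X Y : V n) (y : Fin n × Fin n → ℂ) (p : Fin n × Fin n) :
    infAct X Y y p = (∑ a, X p.1 a * y (a, p.2)) - ∑ b, y (p.1, b) * Y b p.2 := by
  change (X * toMat n y - toMat n y * Y) p.1 p.2 = _
  rw [Matrix.sub_apply, Matrix.mul_apply, Matrix.mul_apply]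
  rfl

lemma hasDerivAt_actMap_exp (X Y : V n) (hX : star X = -X) (hY : star Y = -Y)
    (y : Fin n × Fin n → ℂ) :
    HasDerivAt (fun t : ℝ => actMap (expUnitary X hX t, expUnitary Y hY t) y) (infAct X Y y) 0 := by
  rw [hasDerivAt_pi]
  intro p
  have h0 : ∀ t : ℝ, actMap (expUnitary X hX t, expUnitary Y hY t) y p =
      ∑ b, (∑ a, NormedSpace.exp (t • X) p.1 a * y (a, b)) *
        star (NormedSpace.exp (t • Y) p.2 b) := by
    intro t
    rw [actMap_apply, toMat_symm_apply, act, Matrix.mul_apply]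
    simp only [Matrix.mul_apply, Matrix.star_apply]
    rfl
  simp only [h0]
  have hstar : ∀ b, HasDerivAt (fun t : ℝ => star (NormedSpace.exp (t • Y) p.2 b))
      (star (Y p.2 b)) 0 := fun b => (hasDerivAt_exp_smul_apply Y p.2 b).star
  have h1 := HasDerivAt.fun_sum (u := Finset.univ) fun b (_ : b ∈ Finset.univ) =>
    (HasDerivAt.fun_sum (u := Finset.univ) fun a (_ : a ∈ Finset.univ) =>
      (hasDerivAt_exp_smul_apply X p.1 a).mul_const (y (a, b))).mul (hstar b)
  refine h1.congr_deriv ?_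
  rw [infAct_apply]
  simp only [zero_smul, NormedSpace.exp_zero, Matrix.one_apply, Finset.sum_add_distrib, ite_mul,
    one_mul, zero_mul, Finset.sum_ite_eq, Finset.mem_univ, if_true, apply_ite star, star_one,
    star_zero, mul_ite, mul_one, mul_zero, sub_eq_add_neg, ← Finset.sum_neg_distrib]
  congr 1
  refine Finset.sum_congr rfl fun b _ => ?_
  have : star (Y p.2 b) = - Y b p.2 := by
    have := congrFun (congrFun hY b) p.2
    simpa [Matrix.star_apply] using this
  rw [this, mul_neg]

/-- An invariant f is constant along the curve exp(tX) y exp(tY)*, whose velocity at t = 0 is the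
vector field. -/
lemma fderiv_infAct {f : Smooth (Fin n × Fin n)} (hf : f ∈ invariants n) (X Y : V n)
    (hX : star X = -X) (hY : star Y = -Y) (y : Fin n × Fin n → ℂ) :
    fderiv ℝ f y (infAct X Y y) = 0 := by
  have h1 := hasDerivAt_actMap_exp X Y hX hY y
  have h0 : actMap (expUnitary X hX 0, expUnitary Y hY 0) y = y := by
    have : (expUnitary X hX 0, expUnitary Y hY 0) = (1 : K n) := by
      refine Prod.ext (Subtype.ext ?_) (Subtype.ext ?_) <;> simp [expUnitary_coe]
    rw [this, actMap_apply, act_one, LinearEquiv.symm_apply_apply]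
  have h2 : HasFDerivAt f (fderiv ℝ f y) (actMap (expUnitary X hX 0, expUnitary Y hY 0) y) := by
    rw [h0]
    exact f.differentiable.differentiableAt.hasFDerivAt
  have h3 := h2.comp_hasDerivAt (0 : ℝ) h1
  have h4 : (f ∘ fun t : ℝ => actMap (expUnitary X hX t, expUnitary Y hY t) y) =
      fun _ => f y := by
    funext t
    exact DFunLike.congr_fun (hf (expUnitary X hX t, expUnitary Y hY t)) y
  rw [h4] at h3
  exact h3.unique (hasDerivAt_const _ _)

/-- The second order consequence of infinitesimal invariance. -/
lemma fderiv_fderiv_infAct {f : Smooth (Fin n × Fin n)} (hf : f ∈ invariants n) (X Y : V n)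
    (hX : star X = -X) (hY : star Y = -Y) (y : Fin n × Fin n → ℂ) :
    fderiv ℝ (fderiv ℝ f) y (infAct X Y y) (infAct X Y y) =
      - fderiv ℝ f y (infAct X Y (infAct X Y y)) := by
  have hd : DifferentiableAt ℝ (fderiv ℝ f) y :=
    ((f.contDiff.fderiv_right (m := ∞) (by simp)).differentiable (by simp)).differentiableAt
  have hA : HasFDerivAt (fun y => infAct X Y y)
      ((infAct X Y).toContinuousLinearMap.restrictScalars ℝ) y :=
    ((infAct X Y).toContinuousLinearMap.restrictScalars ℝ).hasFDerivAt
  have h1 := hd.hasFDerivAt.clm_apply hA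
  -- The first-order identity holds at every point, so it can be differentiated once more along the
  -- field itself.
  have h2 : (fun y => fderiv ℝ f y (infAct X Y y)) = fun _ => 0 :=
    funext fun y => fderiv_infAct hf X Y hX hY y
  rw [h2] at h1
  have h3 := congrArg (fun L => L (infAct X Y y)) (h1.unique (hasFDerivAt_const _ _))
  simp only [_root_.add_apply, ContinuousLinearMap.coe_comp, Function.comp,
    ContinuousLinearMap.flip_apply, _root_.zero_apply] at h3
  rw [eq_neg_iff_add_eq_zero, add_comm]
  exact h3

end Infinitesimal

/-! ### The discriminant -/

section Discriminant

variable {ι : Type*} [Fintype ι]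

lemma dirDeriv_one (v : ι → ℂ) : dirDeriv v 1 = 0 := by
  have := dirDeriv_mul_apply v (1 : Smooth ι) 1
  simpa using this

lemma dirDeriv_pow_succ (v : ι → ℂ) (g : Smooth ι) (k : ℕ) :
    dirDeriv v (g ^ (k + 1)) = (k + 1) * g ^ k * dirDeriv v g := by
  induction k with
  | zero => simp
  | succ k ih => rw [pow_succ, dirDeriv_mul_apply, ih, pow_succ]; push_cast; ring

lemma dirDeriv_pow_eq_zero {v : ι → ℂ} {g : Smooth ι} (h : dirDeriv v g = 0) (k : ℕ) :
    dirDeriv v (g ^ k) = 0 := by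
  cases k with
  | zero => rw [pow_zero, dirDeriv_one]
  | succ k => rw [dirDeriv_pow_succ, h, mul_zero]

lemma dirDeriv_prod_eq_zero {v : ι → ℂ} {κ : Type*} (s : Finset κ) (g : κ → Smooth ι)
    (h : ∀ i ∈ s, dirDeriv v (g i) = 0) : dirDeriv v (∏ i ∈ s, g i) = 0 :=
  Finset.prod_induction g (fun g => dirDeriv v g = 0)
    (fun a b ha hb => by rw [dirDeriv_mul_apply, ha, hb]; simp) (dirDeriv_one v) h

lemma dirDeriv_coordSq (v : ι → ℂ) (i : ι) :
    dirDeriv v (coordSq i) =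
      algebraMap ℂ (Smooth ι) (v i) * conjCoord i + coord i * algebraMap ℂ (Smooth ι) (star (v i)) := by
  rw [coordSq, dirDeriv_mul_apply, dirDeriv_coord, dirDeriv_conjCoord]

variable [DecidableEq ι]

lemma dirDeriv_single_coordSq_of_ne {i j : ι} (hij : i ≠ j) (c : ℂ) :
    dirDeriv (Pi.single j c) (coordSq i) = 0 := by
  rw [dirDeriv_coordSq, Pi.single_eq_of_ne hij]; simp

lemma dirDeriv_single_one_coordSq (i : ι) :
    dirDeriv (Pi.single i 1) (coordSq i) = conjCoord i + coord i := by
  rw [dirDeriv_coordSq, Pi.single_eq_same]; simp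

lemma dirDeriv_single_I_coordSq (i : ι) :
    dirDeriv (Pi.single i Complex.I) (coordSq i) =
      Complex.I • (conjCoord i - coord i) := by
  rw [dirDeriv_coordSq, Pi.single_eq_same]
  ext z
  simp
  ring

/-- The product of the gradients in the variable `z_i`. -/
def gradProd (i : ι) (g h : Smooth ι) : Smooth ι :=
  dirDeriv (Pi.single i 1) g * dirDeriv (Pi.single i 1) h +
    dirDeriv (Pi.single i Complex.I) g * dirDeriv (Pi.single i Complex.I) h

lemma gradProd_mul_left (i : ι) (f g h : Smooth ι) :
    gradProd i (f * g) h = f * gradProd i g h + g * gradProd i f h := by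
  simp only [gradProd, dirDeriv_mul_apply]
  ring

lemma gradProd_one_left (i : ι) (h : Smooth ι) : gradProd i 1 h = 0 := by
  simp [gradProd, dirDeriv_one]

lemma coordLaplacian_mul_apply (i : ι) (g h : Smooth ι) :
    coordLaplacian i (g * h) = g * coordLaplacian i h + h * coordLaplacian i g +
      2 * gradProd i g h := by
  simp only [coordLaplacian, gradProd, LinearMap.add_apply, Module.End.mul_apply,
    dirDeriv_mul_apply, map_add]
  ring

lemma gradProd_coordSq_self (i : ι) : gradProd i (coordSq i) (coordSq i) = 4 * coordSq i := by
  rw [gradProd, dirDeriv_single_one_coordSq, dirDeriv_single_I_coordSq]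
  ext z
  simp only [Smooth.add_apply, Smooth.mul_apply, Smooth.smul_apply, Smooth.sub_apply, coordSq]
  have : (4 : Smooth ι) z = 4 := rfl
  rw [this]
  linear_combination (conjCoord i z - coord i z) ^ 2 * Complex.I_mul_I

lemma coordLaplacian_coordSq (i : ι) : coordLaplacian i (coordSq i) = 4 := by
  have h : coordLaplacian i (coordSq i) = 2 * gradProd i (coord i) (conjCoord i) := by
    rw [coordSq, coordLaplacian_mul_apply]
    have h1 : coordLaplacian i (coord i) = 0 := by
      simp only [coordLaplacian, LinearMap.add_apply, Module.End.mul_apply, dirDeriv_coord]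
      simp [Algebra.algebraMap_eq_smul_one, dirDeriv_one]
    have h2 : coordLaplacian i (conjCoord i) = 0 := by
      simp only [coordLaplacian, LinearMap.add_apply, Module.End.mul_apply, dirDeriv_conjCoord]
      simp [Algebra.algebraMap_eq_smul_one, dirDeriv_one]
    rw [h1, h2]
    ring
  rw [h, gradProd]
  simp only [dirDeriv_coord, dirDeriv_conjCoord, Pi.single_eq_same]
  ext z
  have h2 : (2 : Smooth ι) z = 2 := rfl
  have h4 : (4 : Smooth ι) z = 4 := rfl
  simp [h2, h4]
  norm_num

lemma coordLaplacian_neg_coordSq_pow_succ (i : ι) (k : ℕ) :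
    coordLaplacian i ((-coordSq i) ^ (k + 1)) = -4 * (k + 1) ^ 2 * (-coordSq i) ^ k := by
  induction k with
  | zero => simp [coordLaplacian_coordSq]
  | succ k ih =>
    have h : gradProd i ((-coordSq i) ^ (k + 1)) (-coordSq i) =
        -4 * (k + 1) * (-coordSq i) ^ (k + 1) := by
      have h1 := gradProd_coordSq_self i
      rw [gradProd] at h1 ⊢
      rw [dirDeriv_pow_succ, dirDeriv_pow_succ, map_neg, map_neg]
      linear_combination (k + 1) * (-coordSq i) ^ k * h1
    rw [pow_succ, coordLaplacian_mul_apply, ih, h, map_neg, coordLaplacian_coordSq]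
    push_cast
    ring

lemma coordLaplacian_neg_coordSq_pow (i : ι) (k : ℕ) :
    coordLaplacian i ((-coordSq i) ^ k) = -4 * (k : Smooth ι) ^ 2 * (-coordSq i) ^ (k - 1) := by
  cases k with
  | zero =>
    simp [coordLaplacian, Module.End.mul_apply, dirDeriv_one]
  | succ k =>
    rw [coordLaplacian_neg_coordSq_pow_succ]
    push_cast
    rfl

lemma coordLaplacian_mul_of_dirDeriv_eq_zero {i : ι} {g : Smooth ι}
    (hg : ∀ c, dirDeriv (Pi.single i c) g = 0) (h : Smooth ι) :
    coordLaplacian i (g * h) = g * coordLaplacian i h := by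
  simp only [coordLaplacian, LinearMap.add_apply, Module.End.mul_apply, dirDeriv_mul_apply, hg]
  simp only [zero_mul, zero_add, dirDeriv_mul_apply, hg]
  ring

variable {n : ℕ}

/-- The function `∏_{i < j} (|z_i|² - |z_j|²)`. -/
def discr (n : ℕ) : Smooth (Fin n) := ∏ i, ∏ j ∈ Finset.Ioi i, (coordSq i - coordSq j)

lemma discr_eq_det : discr n = (Matrix.vandermonde fun i : Fin n => -coordSq i).det := by
  rw [Matrix.det_vandermonde]
  refine Finset.prod_congr rfl fun i _ => Finset.prod_congr rfl fun j _ => ?_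
  ring

/-- Only one factor involves the variable z_{σ i}, and its exponent drops from i to i - 1. The
result is a Leibniz term of the Vandermonde matrix with column i altered. -/
lemma coordLaplacian_prod (σ : Equiv.Perm (Fin n)) (i : Fin n) :
    coordLaplacian (σ i) (∏ l : Fin n, (-coordSq (σ l)) ^ (l : ℕ)) =
      -4 * ((i : ℕ) : Smooth (Fin n)) ^ 2 * ∏ l : Fin n,
        (Matrix.vandermonde fun i : Fin n => -coordSq i).updateCol i
          (fun j => (-coordSq j) ^ ((i : ℕ) - 1)) (σ l) l := by
  rw [← Finset.mul_prod_erase _ _ (Finset.mem_univ i), mul_comm,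
    coordLaplacian_mul_of_dirDeriv_eq_zero, coordLaplacian_neg_coordSq_pow,
    ← Finset.mul_prod_erase _ _ (Finset.mem_univ i), Matrix.updateCol_self]
  · have : ∏ l ∈ Finset.univ.erase i, (Matrix.vandermonde fun i : Fin n => -coordSq i).updateCol i
        (fun j => (-coordSq j) ^ ((i : ℕ) - 1)) (σ l) l =
        ∏ l ∈ Finset.univ.erase i, (-coordSq (σ l)) ^ (l : ℕ) := by
      refine Finset.prod_congr rfl fun l hl => ?_
      rw [Matrix.updateCol_ne (Finset.ne_of_mem_erase hl), Matrix.vandermonde_apply]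
    rw [this]
    ring
  · intro c
    refine dirDeriv_prod_eq_zero _ _ fun l hl => dirDeriv_pow_eq_zero ?_ _
    rw [map_neg, dirDeriv_single_coordSq_of_ne, neg_zero]
    exact fun h => Finset.ne_of_mem_erase hl (σ.injective h)

/-- The discriminant is harmonic. -/
lemma laplacian_discr : laplacian (Fin n) (discr n) = 0 := by
  have h1 : ∀ σ : Equiv.Perm (Fin n),
      laplacian (Fin n) (∏ l : Fin n, (-coordSq (σ l)) ^ (l : ℕ)) =
      ∑ i : Fin n, -4 * ((i : ℕ) : Smooth (Fin n)) ^ 2 * ∏ l : Fin n,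
        (Matrix.vandermonde fun i : Fin n => -coordSq i).updateCol i
          (fun j => (-coordSq j) ^ ((i : ℕ) - 1)) (σ l) l := by
    intro σ
    rw [laplacian, LinearMap.sum_apply, ← Equiv.sum_comp σ]
    exact Finset.sum_congr rfl fun i _ => coordLaplacian_prod σ i
  rw [discr_eq_det, Matrix.det_apply, map_sum]
  have h2 : ∀ σ : Equiv.Perm (Fin n), laplacian (Fin n) (Equiv.Perm.sign σ •
      ∏ i : Fin n, (Matrix.vandermonde fun i : Fin n => -coordSq i) (σ i) i) =
      ∑ i : Fin n, -4 * ((i : ℕ) : Smooth (Fin n)) ^ 2 * (Equiv.Perm.sign σ • ∏ l : Fin n,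
        (Matrix.vandermonde fun i : Fin n => -coordSq i).updateCol i
          (fun j => (-coordSq j) ^ ((i : ℕ) - 1)) (σ l) l) := by
    intro σ
    have : laplacian (Fin n) (Equiv.Perm.sign σ •
      ∏ i : Fin n, (Matrix.vandermonde fun i : Fin n => -coordSq i) (σ i) i) =
      Equiv.Perm.sign σ • laplacian (Fin n) (∏ i : Fin n, (-coordSq (σ i)) ^ (i : ℕ)) := by
      rw [Units.smul_def, map_zsmul, Units.smul_def]
      rfl
    rw [this, h1, Finset.smul_sum]
    exact Finset.sum_congr rfl fun i _ => by rw [mul_smul_comm]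
  rw [Finset.sum_congr rfl fun σ _ => h2 σ, Finset.sum_comm]
  -- For i > 0 the altered column i repeats column i - 1, so the determinant vanishes. For i = 0 the
  -- truncated exponent is harmless because the factor i² is zero.
  refine Finset.sum_eq_zero fun i _ => ?_
  rw [← Finset.mul_sum, ← Matrix.det_apply]
  rcases Nat.eq_zero_or_pos (i : ℕ) with h0 | h0
  · rw [h0]; simp
  · have hlt : (i : ℕ) - 1 < n := by omega
    have hne : i ≠ ⟨(i : ℕ) - 1, hlt⟩ := by
      intro h
      have := congrArg Fin.val h
      simp only [] at this
      omega
    rw [Matrix.det_zero_of_column_eq hne, mul_zero]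
    intro k
    rw [Matrix.updateCol_self, Matrix.updateCol_ne hne.symm, Matrix.vandermonde_apply]

end Discriminant

/-! ### The radial part of the Laplacian -/

section Radial

variable {n : ℕ}

/-- The embedding of the diagonal matrices. -/
def diagMap (n : ℕ) : (Fin n → ℂ) →ₗ[ℂ] (Fin n × Fin n → ℂ) where
  toFun z p := if p.1 = p.2 then z p.1 else 0
  map_add' y z := by
    ext p
    by_cases h : p.1 = p.2 <;> simp [h]
  map_smul' c y := by
    ext p
    by_cases h : p.1 = p.2 <;> simp [h]

lemma diagMap_apply (z : Fin n → ℂ) (p : Fin n × Fin n) :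
    diagMap n z p = if p.1 = p.2 then z p.1 else 0 := rfl

lemma toMat_diagMap (z : Fin n → ℂ) : toMat n (diagMap n z) = Matrix.diagonal z := by
  ext i j
  rw [toMat_apply, diagMap_apply, Matrix.diagonal_apply]

lemma diagMap_single (i : Fin n) (c : ℂ) :
    diagMap n (Pi.single i c) = Pi.single (i, i) c := by
  ext ⟨a, b⟩
  rw [diagMap_apply]
  by_cases h : a = b
  · subst h
    by_cases hi : a = i
    · subst hi; simp
    · rw [if_pos rfl, Pi.single_eq_of_ne hi, Pi.single_eq_of_ne]
      exact fun h => hi (congrArg Prod.fst h)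
  · rw [if_neg h, Pi.single_eq_of_ne]
    intro h'
    rw [Prod.mk.injEq] at h'
    exact h (h'.1.trans h'.2.symm)

/-- A skew-Hermitian matrix in the plane of two coordinates. -/
def skewMatrix (j k : Fin n) (x : ℂ) : V n :=
  Matrix.single j k x - Matrix.single k j (star x)

lemma star_skewMatrix (j k : Fin n) (x : ℂ) : star (skewMatrix j k x) = -skewMatrix j k x := by
  rw [skewMatrix, Matrix.star_eq_conjTranspose, Matrix.conjTranspose_sub,
    Matrix.conjTranspose_single, Matrix.conjTranspose_single, star_star, neg_sub]

lemma infAct_diagMap (X Y : V n) (z : Fin n → ℂ) (r s : Fin n) :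
    infAct X Y (diagMap n z) (r, s) = X r s * z s - z r * Y r s := by
  rw [infAct_apply]
  simp [diagMap_apply]

lemma infAct_single (X Y : V n) (j k : Fin n) (c : ℂ) (r s : Fin n) :
    infAct X Y (Pi.single (j, k) c) (r, s) =
      (if s = k then X r j * c else 0) - if r = j then c * Y k s else 0 := by
  rw [infAct_apply]
  congr 1
  · rw [Finset.sum_eq_single j]
    · by_cases h : s = k
      · subst h; simp
      · rw [if_neg h, Pi.single_eq_of_ne (fun h' => h (congrArg Prod.snd h')), mul_zero]
    · intro b _ hb
      rw [Pi.single_eq_of_ne (fun h' => hb (congrArg Prod.fst h')), mul_zero]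
    · simp
  · rw [Finset.sum_eq_single k]
    · by_cases h : r = j
      · subst h; simp
      · rw [if_neg h, Pi.single_eq_of_ne (fun h' => h (congrArg Prod.fst h')), zero_mul]
    · intro b _ hb
      rw [Pi.single_eq_of_ne (fun h' => hb (congrArg Prod.snd h')), zero_mul]
    · simp

/-- The second derivative of an invariant function transverse to the diagonal matrices. -/
lemma fderiv_fderiv_single {f : Smooth (Fin n × Fin n)} (hf : f ∈ invariants n)
    (z : Fin n → ℂ) {j k : Fin n} (hjk : j ≠ k)
    (hz : Complex.normSq (z j) ≠ Complex.normSq (z k)) (w : ℂ) (hw : w * star w = 1) :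
    fderiv ℝ (fderiv ℝ f) (diagMap n z) (Pi.single (j, k) w) (Pi.single (j, k) w) =
      ((Complex.normSq (z j) - Complex.normSq (z k))⁻¹ : ℝ) *
        fderiv ℝ f (diagMap n z) (diagMap n (Pi.single j (z j) - Pi.single k (z k))) := by
  set d : ℝ := Complex.normSq (z j) - Complex.normSq (z k) with hd
  have hd0 : (d : ℂ) ≠ 0 := by
    rw [Complex.ofReal_ne_zero]
    exact sub_ne_zero.mpr hz
  have hd' : (d : ℂ) = z j * star (z j) - z k * star (z k) := by
    rw [hd, Complex.ofReal_sub, ← Complex.mul_conj, ← Complex.mul_conj]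
    rfl
  set x : ℂ := -(w * star (z k) / d) with hx
  set y : ℂ := -(w * star (z j) / d) with hy
  have hsd : star (d : ℂ) = d := Complex.conj_ofReal d
  have hsx : star x = -(star w * z k / d) := by
    rw [hx, star_neg, star_div₀, star_mul, star_star, hsd, mul_comm (z k)]
  have hsy : star y = -(star w * z j / d) := by
    rw [hy, star_neg, star_div₀, star_mul, star_star, hsd, mul_comm (z j)]
  have h1 : infAct (skewMatrix j k x) (skewMatrix j k y) (diagMap n z) = Pi.single (j, k) w := by
    ext ⟨r, s⟩
    rw [infAct_diagMap, skewMatrix, skewMatrix]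
    simp only [Matrix.sub_apply, Matrix.single_apply, Pi.single_apply, Prod.mk.injEq, hsx, hsy]
    rcases eq_or_ne r j with rfl | hrj
    · rcases eq_or_ne s k with rfl | hsk
      · simp only [hjk.symm, false_and, and_self, if_true, if_false, sub_zero, hx, hy]
        field_simp
        rw [hd']
        ring
      · simp [hjk.symm, hsk, hsk.symm]
    · rcases eq_or_ne r k with rfl | hrk
      · rcases eq_or_ne s j with rfl | hsj
        · simp only [hjk, hjk.symm, and_self, if_true, if_false, zero_sub]
          ring
        · simp [hrj, hrj.symm, hsj.symm]
      · simp [hrj, hrj.symm, hrk.symm]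
  -- Applied twice, the field returns to the diagonal matrices; a transverse second derivative thus
  -- becomes a first derivative along the diagonal.
  have h2 : infAct (skewMatrix j k x) (skewMatrix j k y) (Pi.single (j, k) w) =
      (-d⁻¹ : ℝ) • diagMap n (Pi.single j (z j) - Pi.single k (z k)) := by
    ext ⟨r, s⟩
    rw [infAct_single, map_sub, diagMap_single, diagMap_single, skewMatrix, skewMatrix,
      Pi.smul_apply, Pi.sub_apply, Complex.real_smul]
    simp only [Matrix.sub_apply, Matrix.single_apply, Pi.single_apply, Prod.mk.injEq, hsx, hsy]
    push_cast
    rcases eq_or_ne r j with rfl | hrj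
    · rcases eq_or_ne s r with rfl | hsr
      · simp only [hjk, hjk.symm, false_and, and_self, if_true, if_false]
        field_simp
        linear_combination -(z s) * hw
      · simp [hjk, hjk.symm, hsr, hsr.symm]
    · rcases eq_or_ne r k with rfl | hrk
      · rcases eq_or_ne s r with rfl | hsr
        · simp only [hjk, hjk.symm, false_and, and_self, if_true, if_false]
          field_simp
          linear_combination (z s) * hw
        · simp [hjk.symm, hsr]
      · simp [hrj, hrj.symm, hrk, hrk.symm]
  have h3 := fderiv_fderiv_infAct hf _ _ (star_skewMatrix j k x) (star_skewMatrix j k y)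
    (diagMap n z)
  rw [h1, h2, map_smul] at h3
  rw [h3, Complex.real_smul]
  push_cast
  ring

/-- The radial part of a function: the restriction to the diagonal matrices, multiplied by the
discriminant. -/
def radial (n : ℕ) : Smooth (Fin n × Fin n) →ₗ[ℂ] Smooth (Fin n) :=
  (mulOp (discr n)).comp (comap (diagMap n)).toLinearMap

lemma radial_apply (f : Smooth (Fin n × Fin n)) :
    radial n f = discr n * comap (diagMap n) f := rfl

lemma coordSq_apply (i : Fin n) (z : Fin n → ℂ) :
    coordSq i z = (Complex.normSq (z i) : ℂ) := by
  rw [← Complex.mul_conj]; rfl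

lemma discr_apply (z : Fin n → ℂ) : discr n z =
    ∏ i, ∏ j ∈ Finset.Ioi i, ((Complex.normSq (z i) : ℂ) - (Complex.normSq (z j) : ℂ)) := by
  rw [← Smooth.eval_apply, discr]
  simp only [map_prod, map_sub, Smooth.eval_apply, coordSq_apply]

/-- The points where the discriminant does not vanish. -/
def regular (n : ℕ) : Set (Fin n → ℂ) :=
  {z | ∀ i j, i ≠ j → Complex.normSq (z i) ≠ Complex.normSq (z j)}

lemma dense_regular (n : ℕ) : Dense (regular n) := by
  intro z
  -- These are the differences of squared moduli along the line with coordinates z_i + t(i + 1). The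
  -- leading coefficient (i + 1)² - (j + 1)² is nonzero for i ≠ j, so only finitely many t are
  -- excluded.
  set p : Fin n → Fin n → Polynomial ℝ := fun i j =>
    Polynomial.C (Complex.normSq (z i) - Complex.normSq (z j)) +
    Polynomial.C (2 * ((z i).re * (i + 1) - (z j).re * (j + 1))) * Polynomial.X +
    Polynomial.C ((i + 1 : ℝ) ^ 2 - (j + 1 : ℝ) ^ 2) * Polynomial.X ^ 2 with hp
  have hp0 : ∀ i j, i ≠ j → p i j ≠ 0 := by
    intro i j hij h
    have h2 := congrArg (fun q => Polynomial.coeff q 2) h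
    simp only [hp, Polynomial.coeff_add, Polynomial.coeff_C_mul, Polynomial.coeff_X_pow,
      Polynomial.coeff_C, Polynomial.coeff_X, Polynomial.coeff_zero] at h2
    norm_num at h2
    have h3 : ((i : ℝ) + 1 - (j + 1)) * ((i : ℝ) + 1 + (j + 1)) = 0 := by linear_combination h2
    rcases mul_eq_zero.mp h3 with h4 | h4
    · exact hij (Fin.ext (by exact_mod_cast (by linarith : (i : ℝ) = j)))
    · have : (0 : ℝ) ≤ (i : ℝ) ∧ (0 : ℝ) ≤ (j : ℝ) := ⟨by positivity, by positivity⟩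
      linarith [this.1, this.2]
  set S : Set ℝ := ⋃ i : Fin n, ⋃ j : Fin n, ⋃ _ : i ≠ j, {t | (p i j).IsRoot t} with hS
  have hfin : S.Finite := Set.finite_iUnion fun i => Set.finite_iUnion fun j =>
    Set.finite_iUnion fun hij => Polynomial.finite_setOfPred_isRoot (hp0 i j hij)
  have hdense : Dense Sᶜ := hfin.countable.dense_compl ℝ
  set c : ℝ → Fin n → ℂ := fun t i => z i + (t * (i + 1) : ℝ) with hc
  have hcont : Continuous c := by
    refine continuous_pi fun i => ?_
    simp only [hc]
    fun_prop
  have hc0 : c 0 = z := by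
    funext i; simp [hc]
  rw [← hc0]
  refine closure_mono ?_ (image_closure_subset_closure_image hcont ⟨0, hdense 0, rfl⟩)
  rintro _ ⟨t, ht, rfl⟩ i j hij h
  refine ht (Set.mem_iUnion.mpr ⟨i, Set.mem_iUnion.mpr ⟨j, Set.mem_iUnion.mpr ⟨hij, ?_⟩⟩⟩)
  simp only [hc, Complex.normSq_apply] at h
  simp only [hp, Set.mem_ofPred_eq, Polynomial.IsRoot.def, Polynomial.eval_add,
    Polynomial.eval_mul, Polynomial.eval_C, Polynomial.eval_X, Polynomial.eval_pow,
    Complex.normSq_apply]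
  simp at h
  linear_combination h

lemma Smooth.ext_of_regular {f g : Smooth (Fin n)} (h : ∀ z ∈ regular n, f z = g z) : f = g :=
  DFunLike.coe_injective ((f.contDiff.continuous).ext_on (dense_regular n) g.contDiff.continuous h)

lemma gradProd_prod_apply {κ : Type*} [DecidableEq κ] (s : Finset κ) (g : κ → Smooth (Fin n))
    (h : Smooth (Fin n)) (i : Fin n) (z : Fin n → ℂ) (hz : ∀ a ∈ s, g a z ≠ 0) :
    gradProd i (∏ a ∈ s, g a) h z = (∏ a ∈ s, g a z) * ∑ a ∈ s, gradProd i (g a) h z / g a z := by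
  induction s using Finset.induction_on with
  | empty => simp [gradProd_one_left]
  | insert a s ha ih =>
    have h1 := ih fun b hb => hz b (Finset.mem_insert_of_mem hb)
    have h2 := hz a (Finset.mem_insert_self a s)
    rw [Finset.prod_insert ha, gradProd_mul_left, Finset.prod_insert ha, Finset.sum_insert ha,
      Smooth.add_apply, Smooth.mul_apply, Smooth.mul_apply, h1]
    have h3 : (∏ a ∈ s, g a) z = ∏ a ∈ s, g a z := by
      rw [← Smooth.eval_apply, map_prod]; rfl
    rw [h3]
    field_simp
    ring

lemma sum_gradProd_coordSq (i : Fin n) (h : Smooth (Fin n)) (z : Fin n → ℂ) :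
    ∑ l, gradProd l (coordSq i) h z = 2 * dirDeriv (Pi.single i (z i)) h z := by
  rw [Finset.sum_eq_single i]
  · have h1 : (Pi.single i (z i) : Fin n → ℂ) = (z i).re • (Pi.single i 1 : Fin n → ℂ) +
        (z i).im • (Pi.single i Complex.I : Fin n → ℂ) := by
      rw [← Pi.single_smul, ← Pi.single_smul, ← Pi.single_add]
      congr 1
      simp [Complex.re_add_im]
    rw [h1, dirDeriv_add, dirDeriv_smul, dirDeriv_smul, gradProd, dirDeriv_single_one_coordSq,
      dirDeriv_single_I_coordSq]
    simp only [Smooth.add_apply, Smooth.mul_apply, Smooth.smul_apply, Smooth.sub_apply,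
      LinearMap.add_apply, LinearMap.smul_apply, coord_apply, conjCoord_apply]
    have h2 : star (z i) + z i = 2 * ((z i).re : ℂ) := by
      apply Complex.ext
      · simp; ring
      · simp
    have h3 : Complex.I * (star (z i) - z i) = 2 * ((z i).im : ℂ) := by
      apply Complex.ext
      · simp; ring
      · simp
    rw [h2, h3]
    ring
  · intro l _ hl
    simp [gradProd, dirDeriv_single_coordSq_of_ne hl.symm]
  · simp

/-- Logarithmic differentiation of the product; the gradient of |z_i|² is twice the radial vector in
the variable z_i. -/
lemma sum_gradProd_discr (h : Smooth (Fin n)) {z : Fin n → ℂ} (hz : z ∈ regular n) :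
    ∑ l, gradProd l (discr n) h z = discr n z * ∑ i, ∑ j ∈ Finset.Ioi i,
      2 * (((Complex.normSq (z i) - Complex.normSq (z j))⁻¹ : ℝ) *
        dirDeriv (Pi.single i (z i) - Pi.single j (z j)) h z) := by
  have h0 : ∀ a ∈ Finset.univ.sigma fun i : Fin n => Finset.Ioi i,
      (coordSq a.1 - coordSq a.2 : Smooth (Fin n)) z ≠ 0 := by
    intro a ha
    rw [Finset.mem_sigma, Finset.mem_Ioi] at ha
    rw [Smooth.sub_apply, coordSq_apply, coordSq_apply, ← Complex.ofReal_sub,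
      Complex.ofReal_ne_zero, sub_ne_zero]
    exact hz _ _ ha.2.ne
  have h1 : discr n = ∏ a ∈ Finset.univ.sigma fun i : Fin n => Finset.Ioi i,
      (coordSq a.1 - coordSq a.2) := by rw [discr, Finset.prod_sigma]
  have h2 : discr n z = ∏ a ∈ Finset.univ.sigma fun i : Fin n => Finset.Ioi i,
      (coordSq a.1 - coordSq a.2 : Smooth (Fin n)) z := by
    rw [h1, ← Smooth.eval_apply, map_prod]; rfl
  rw [h2, h1]
  simp only [gradProd_prod_apply _ _ _ _ _ h0]
  rw [← Finset.mul_sum, Finset.sum_comm, Finset.sum_sigma]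
  congr 1
  refine Finset.sum_congr rfl fun i _ => Finset.sum_congr rfl fun j _ => ?_
  simp only []
  have h3 : ∀ l, gradProd l (coordSq i - coordSq j) h z =
      gradProd l (coordSq i) h z - gradProd l (coordSq j) h z := by
    intro l
    simp only [gradProd, map_sub, Smooth.add_apply, Smooth.mul_apply, Smooth.sub_apply]
    ring
  rw [← Finset.sum_div]
  simp only [h3, Finset.sum_sub_distrib, sum_gradProd_coordSq]
  rw [Smooth.sub_apply, coordSq_apply, coordSq_apply, dirDeriv_apply, dirDeriv_apply,
    dirDeriv_apply, map_sub]
  push_cast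
  ring

lemma laplacian_discr_mul (h : Smooth (Fin n)) :
    laplacian (Fin n) (discr n * h) =
      discr n * laplacian (Fin n) h + 2 * ∑ l, gradProd l (discr n) h := by
  have h1 := laplacian_discr (n := n)
  simp only [laplacian, LinearMap.sum_apply, coordLaplacian_mul_apply, Finset.sum_add_distrib,
    ← Finset.mul_sum] at h1 ⊢
  rw [h1]
  ring

/-- At a regular diagonal point, the four transverse second derivatives attached to i < j add up to
4 t i j, by `fderiv_fderiv_single`. Their sum, times the discriminant, is the cross term in the
Laplacian of the product, and the term with the Laplacian of the discriminant is zero. Density of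
the regular points covers the rest. -/
lemma radial_laplacian {f : Smooth (Fin n × Fin n)} (hf : f ∈ invariants n) :
    radial n (laplacian (Fin n × Fin n) f) = laplacian (Fin n) (radial n f) := by
  refine Smooth.ext_of_regular fun z hz => ?_
  rw [radial_apply, radial_apply, laplacian_discr_mul, Smooth.add_apply, Smooth.mul_apply,
    Smooth.mul_apply, Smooth.mul_apply]
  have hs : (∑ l, gradProd l (discr n) (comap (diagMap n) f)) z =
      ∑ l, gradProd l (discr n) (comap (diagMap n) f) z := by
    rw [← Smooth.eval_apply, map_sum]; rfl
  rw [hs, sum_gradProd_discr _ hz]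
  have h2 : (2 : Smooth (Fin n)) z = 2 := rfl
  set H : Fin n → Fin n → ℂ := fun i j => coordLaplacian (i, j) f (diagMap n z) with hH
  set t : Fin n → Fin n → ℂ := fun i j =>
    ((Complex.normSq (z i) - Complex.normSq (z j))⁻¹ : ℝ) *
      dirDeriv (Pi.single i (z i) - Pi.single j (z j)) (comap (diagMap n) f) z with ht
  have h3 : comap (diagMap n) (laplacian (Fin n × Fin n) f) z = ∑ i, ∑ j, H i j := by
    rw [comap_apply, ← Smooth.eval_apply, laplacian, LinearMap.sum_apply, map_sum,
      Fintype.sum_prod_type]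
    rfl
  have h4 : laplacian (Fin n) (comap (diagMap n) f) z = ∑ i, H i i := by
    rw [← Smooth.eval_apply, laplacian, LinearMap.sum_apply, map_sum]
    refine Finset.sum_congr rfl fun i _ => ?_
    simp only [hH, coordLaplacian, LinearMap.add_apply, Module.End.mul_apply, dirDeriv_comap,
      diagMap_single, ← map_add]
    rfl
  have h5 : ∀ i j, j ≠ i → H j i = 2 * t j i := by
    intro i j hij
    have e1 := fderiv_fderiv_single hf z hij (hz _ _ hij) 1 (by simp)
    have e2 := fderiv_fderiv_single hf z hij (hz _ _ hij) Complex.I (by simp)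
    simp only [hH, ht, coordLaplacian, LinearMap.add_apply, Module.End.mul_apply,
      Smooth.add_apply, fderiv_dirDeriv, e1, e2, dirDeriv_comap, comap_apply]
    simp only [dirDeriv_apply]
    ring
  have h6 : ∀ i j, t j i = t i j := by
    intro i j
    have e : (Pi.single j (z j) - Pi.single i (z i) : Fin n → ℂ) =
        -(Pi.single i (z i) - Pi.single j (z j)) := by abel
    have e' : (Complex.normSq (z j) - Complex.normSq (z i))⁻¹ =
        -(Complex.normSq (z i) - Complex.normSq (z j))⁻¹ := by rw [← inv_neg, neg_sub]
    simp only [ht, dirDeriv_apply]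
    rw [e, e', map_neg]
    push_cast
    ring
  have h7 : ∑ i, ∑ j, H i j = ∑ i, H i i + ∑ i, ∑ j ∈ Finset.Ioi i, 4 * t i j := by
    have e1 : ∑ i, ∑ j ∈ Finset.Ioi i, 4 * t i j = ∑ i, ∑ j ∈ {i}ᶜ, H j i := by
      rw [← Finset.sum_sum_Ioi_add_eq_sum_sum_off_diag]
      refine Finset.sum_congr rfl fun i _ => Finset.sum_congr rfl fun j hj => ?_
      have hij := (Finset.mem_Ioi.mp hj).ne
      rw [h5 i j hij.symm, h5 j i hij, h6 i j]
      ring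
    rw [e1, Finset.sum_comm, ← Finset.sum_add_distrib]
    refine Finset.sum_congr rfl fun i _ => ?_
    rw [← Finset.sum_add_sum_compl {i}, Finset.sum_singleton]
  rw [h3, h4, h7, h2, mul_add, add_right_inj]
  simp only [Finset.mul_sum]
  refine Finset.sum_congr rfl fun i _ => Finset.sum_congr rfl fun j _ => ?_
  simp only [ht]
  ring

lemma intertwines_laplacian :
    Intertwines (radial n) (invariants n) (laplacian (Fin n × Fin n)) (laplacian (Fin n)) :=
  ⟨fun _ hf => laplacian_mem_invariants hf, fun _ hf => radial_laplacian hf⟩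

lemma comap_diagMap_powerTrace (k : ℕ) : comap (diagMap n) (powerTrace n k) = powerSum n k := by
  ext z
  rw [comap_apply, powerTrace_apply, toMat_diagMap, Matrix.star_eq_conjTranspose,
    Matrix.diagonal_conjTranspose, Matrix.diagonal_mul_diagonal, Matrix.diagonal_pow,
    Matrix.trace_diagonal, ← Smooth.eval_apply, powerSum, map_sum]
  refine Finset.sum_congr rfl fun i _ => ?_
  rw [map_pow]
  rfl

lemma intertwines_powerTrace (k : ℕ) :
    Intertwines (radial n) (invariants n) (mulOp (powerTrace n k)) (mulOp (powerSum n k)) :=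
  ⟨fun _ hf => mul_mem_invariants (powerTrace_mem_invariants k) hf, fun f _ => by
    rw [mulOp_apply, mulOp_apply, radial_apply, radial_apply, map_mul, comap_diagMap_powerTrace]
    ring⟩

end Radial

/-! ### Joint eigenvector decompositions -/

section PowerSums

open Polynomial
open scoped IsMulCommutative

/-- Families with the same power sums have the same elementary symmetric functions. -/
lemma aeval_esymm_eq_of_sum_pow_eq {Q : Type*} [CommRing Q] [Algebra ℂ Q] {n : ℕ} {l m : Fin n → Q}
    (h : ∀ k, ∑ i, l i ^ k = ∑ i, m i ^ k) (k : ℕ) :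
    MvPolynomial.aeval l (MvPolynomial.esymm (Fin n) ℂ k) =
      MvPolynomial.aeval m (MvPolynomial.esymm (Fin n) ℂ k) := by
  induction k using Nat.strong_induction_on with
  | _ k ih =>
    rcases Nat.eq_zero_or_pos k with rfl | hk
    · simp
    have hN := MvPolynomial.mul_esymm_eq_sum (Fin n) ℂ k
    have h1 := congrArg (MvPolynomial.aeval l) hN
    have h2 := congrArg (MvPolynomial.aeval m) hN
    have hp : ∀ j, MvPolynomial.aeval l (MvPolynomial.psum (Fin n) ℂ j) =
        MvPolynomial.aeval m (MvPolynomial.psum (Fin n) ℂ j) := by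
      intro j
      simpa [MvPolynomial.psum] using h j
    simp only [map_mul, map_pow, map_neg, map_one, map_sum, map_natCast, hp] at h1 h2
    rw [Finset.sum_congr rfl fun a ha => by rw [ih a.1 (Finset.mem_filter.mp ha).2], ← h2] at h1
    -- Newton's identity determines only k times the elementary symmetric function; k is invertible
    -- because Q is a ℂ-algebra.
    have hu : IsUnit (k : Q) := by
      rw [← map_natCast (algebraMap ℂ Q)]
      exact (isUnit_iff_ne_zero.mpr (Nat.cast_ne_zero.mpr hk.ne')).map _
    exact hu.mul_left_cancel h1

/-- By Newton's identities the monic polynomials with roots l and with roots m coincide, and the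
first one vanishes at l i. -/
lemma prod_sub_eq_zero_of_sum_pow_eq {Q : Type*} [CommRing Q] [Algebra ℂ Q] {n : ℕ}
    {l m : Fin n → Q} (h : ∀ k, ∑ i, l i ^ k = ∑ i, m i ^ k) (i : Fin n) :
    ∏ j, (l i - m j) = 0 := by
  have key : ∏ j, (X - C (l j) : Q[X]) = ∏ j, (X - C (m j)) := by
    have e : ∀ f : Fin n → Q, ∏ j, (X - C (f j) : Q[X]) =
        ∑ j ∈ Finset.range (n + 1), (-1) ^ j *
          (C (MvPolynomial.aeval f (MvPolynomial.esymm (Fin n) ℂ j)) * X ^ (n - j)) := by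
      intro f
      have := Multiset.prod_X_sub_X_eq_sum_esymm (Finset.univ.val.map f)
      rw [Multiset.map_map, Multiset.card_map, Finset.card_val, Finset.card_univ,
        Fintype.card_fin] at this
      simp only [MvPolynomial.aeval_esymm_eq_multiset_esymm]
      exact this
    rw [e, e]
    exact Finset.sum_congr rfl fun j _ => by rw [aeval_esymm_eq_of_sum_pow_eq h]
  have := congrArg (Polynomial.eval (l i)) key
  rw [Polynomial.eval_prod, Polynomial.eval_prod] at this
  simp only [eval_sub, eval_X, eval_C] at this
  rw [← this]
  exact Finset.prod_eq_zero (Finset.mem_univ i) (sub_self _)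

/-- A vector on which the power sums of elements of a commutative algebra act by the power sums of
distinct scalars is a sum of joint eigenvectors. -/
lemma exists_sum_eq_one_of_sum_pow {S M : Type*} [CommRing S] [Algebra ℂ S] [AddCommGroup M]
    [Module ℂ M] (e : S →ₐ[ℂ] Module.End ℂ M) {n : ℕ} (l : Fin n → S) {m : Fin n → ℂ}
    (hm : Function.Injective m) {A : M}
    (hA : ∀ k, e (∑ i, l i ^ k) A = (∑ i, m i ^ k) • A) :
    ∃ s : (Fin n → Fin n) → S, ∑ P, s P = 1 ∧
      ∀ P i, e (l i) (e (s P) A) = m (P i) • e (s P) A := by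
  classical
  -- Modulo the annihilator of A the families l and m have equal power sums, so the previous lemma
  -- applies in the quotient ring.
  let I : Ideal S :=
    { carrier := {s | e s A = 0}
      add_mem' := fun {s t} hs ht => by
        have h1 : e s A = 0 := hs
        have h2 : e t A = 0 := ht
        change e (s + t) A = 0
        rw [map_add, LinearMap.add_apply, h1, h2, add_zero]
      zero_mem' := by
        change e 0 A = 0
        rw [map_zero, LinearMap.zero_apply]
      smul_mem' := fun c s hs => by
        have h1 : e s A = 0 := hs
        change e (c * s) A = 0
        rw [map_mul, Module.End.mul_apply, h1, map_zero] }
  have hI : ∀ s : S, s ∈ I ↔ e s A = 0 := fun s => Iff.rfl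
  have hprod : ∀ i, ∏ j, (l i - algebraMap ℂ S (m j)) ∈ I := by
    intro i
    have h1 : ∀ k, ∑ i, (Ideal.Quotient.mk I (l i)) ^ k =
        ∑ i, (Ideal.Quotient.mk I (algebraMap ℂ S (m i))) ^ k := by
      intro k
      simp only [← map_pow, ← map_sum]
      rw [Ideal.Quotient.eq, hI, map_sub, LinearMap.sub_apply, hA, AlgHom.commutes,
        Module.algebraMap_end_apply, sub_self]
    have h2 := prod_sub_eq_zero_of_sum_pow_eq h1 i
    simp only [← map_sub, ← map_prod] at h2
    exact Ideal.Quotient.eq_zero_iff_mem.mp h2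
  -- The Lagrange polynomials evaluated at l i act on A as spectral projections: they sum to 1, and
  -- l i acts on the j-th piece as the scalar m j.
  let b : Fin n → ℂ[X] := fun j => Lagrange.basis Finset.univ m j
  let π : Fin n → Fin n → S := fun i j => aeval (l i) (b j)
  have hsum : ∀ i, ∑ j, π i j = 1 := by
    intro i
    rw [← map_sum, Lagrange.sum_basis hm.injOn ⟨i, Finset.mem_univ i⟩, map_one]
  have hann : ∀ i j, (l i - algebraMap ℂ S (m j)) * π i j ∈ I := by
    intro i j
    have h1 : (X - C (m j)) * b j =
        C (Lagrange.nodalWeight Finset.univ m j) * ∏ k, (X - C (m k)) := by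
      change (X - C (m j)) * Lagrange.basis Finset.univ m j = _
      rw [Lagrange.basis_eq_prod_sub_inv_mul_nodal_div (Finset.mem_univ j),
        ← Lagrange.nodal_erase_eq_nodal_div (Finset.mem_univ j)]
      have := Lagrange.nodal_eq_mul_nodal_erase (s := Finset.univ) (v := m) (Finset.mem_univ j)
      rw [Lagrange.nodal] at this
      rw [this]
      ring
    have h2 := congrArg (aeval (l i)) h1
    simp only [map_mul, map_sub, map_prod, aeval_X, aeval_C] at h2
    change (l i - algebraMap ℂ S (m j)) * aeval (l i) (b j) ∈ I
    rw [h2]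
    exact I.mul_mem_left _ (hprod i)
  refine ⟨fun P => ∏ i, π i (P i), ?_, ?_⟩
  · rw [← Fintype.piFinset_univ, ← Finset.prod_univ_sum]
    exact Finset.prod_eq_one fun i _ => hsum i
  · intro P i
    have h1 : (l i - algebraMap ℂ S (m (P i))) * ∏ i, π i (P i) ∈ I := by
      rw [← Finset.mul_prod_erase _ _ (Finset.mem_univ i), ← mul_assoc]
      exact I.mul_mem_right _ (hann i (P i))
    rw [hI, map_mul, map_sub, AlgHom.commutes, Module.End.mul_apply, LinearMap.sub_apply,
      Module.algebraMap_end_apply, sub_eq_zero] at h1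
    exact h1

/-- A vector on which the power sums of commuting operators act by the power sums of distinct
scalars is a sum of joint eigenvectors. -/
lemma exists_sum_eigenvectors {M : Type*} [AddCommGroup M] [Module ℂ M] {n : ℕ}
    {L : Fin n → Module.End ℂ M} (hL : ∀ i j, Commute (L i) (L j)) {m : Fin n → ℂ}
    (hm : Function.Injective m) {A : M}
    (hA : ∀ k, (∑ i, L i ^ k) A = (∑ i, m i ^ k) • A) :
    ∃ B : (Fin n → Fin n) → M, A = ∑ P, B P ∧ (∀ P i, L i (B P) = m (P i) • B P) ∧
      ∀ T : Module.End ℂ M, (∀ i, Commute T (L i)) → T A = 0 → ∀ P, T (B P) = 0 := by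
  have hcomm : ∀ a ∈ Set.range L, ∀ b ∈ Set.range L, a * b = b * a := by
    rintro _ ⟨i, rfl⟩ _ ⟨j, rfl⟩
    exact hL i j
  have := Algebra.isMulCommutative_adjoin ℂ hcomm
  have hmem : ∀ i, L i ∈ Algebra.adjoin ℂ (Set.range L) := fun i => Algebra.subset_adjoin ⟨i, rfl⟩
  have hA' : ∀ k, (Algebra.adjoin ℂ (Set.range L)).val (∑ i, (⟨L i, hmem i⟩ :
      Algebra.adjoin ℂ (Set.range L)) ^ k) A = (∑ i, m i ^ k) • A := by
    intro k
    rw [← hA k, map_sum]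
    simp only [map_pow]
    rfl
  obtain ⟨s, hs, hs'⟩ := exists_sum_eq_one_of_sum_pow (Algebra.adjoin ℂ (Set.range L)).val
    (fun i => ⟨L i, hmem i⟩) hm hA'
  refine ⟨fun P => (s P).1 A, ?_, hs', ?_⟩
  · have h2 := congrArg (fun t => (Algebra.adjoin ℂ (Set.range L)).val t A) hs
    simp only [map_sum, map_one, LinearMap.sum_apply, Module.End.one_apply] at h2
    exact h2.symm
  -- Each piece is obtained from A by an element of the algebra generated by the L i, and T commutes
  -- with that whole algebra.
  · intro T hT hTA P
    have h1 : Algebra.adjoin ℂ (Set.range L) ≤ Subalgebra.centralizer ℂ {T} := by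
      refine Algebra.adjoin_le ?_
      rintro _ ⟨i, rfl⟩
      rw [SetLike.mem_coe, Subalgebra.mem_centralizer_iff]
      rintro _ rfl
      exact hT i
    have h2 := (Subalgebra.mem_centralizer_iff ℂ).mp (h1 (s P).2) T rfl
    have h3 := DFunLike.congr_fun h2 A
    rw [Module.End.mul_apply, Module.End.mul_apply, hTA, map_zero] at h3
    exact h3

end PowerSums

/-! ### Eigenvalue equations for the radial part of a spherical function -/

section RadialSpherical

variable {n : ℕ}

/-- The radial part of a spherical function. -/
def radialSpherical (x : Fin n → ℝ) : Smooth (Fin n) := radial n (smoothSpherical (diag x))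

/-- Taking 2k commutators of the two basic intertwining relations shows that the radial map carries
the trace of `derivMatrix n ^ k` to ∑(4Δ_i)^k, up to the common factor (2k)!. The former acts on the
spherical function by a known scalar. -/
lemma sum_coordLaplacian_pow_radialSpherical (x : Fin n → ℝ) (k : ℕ) :
    (∑ i, coordLaplacian i ^ k) (radialSpherical x) =
      (∑ i, (-(x i : ℂ) ^ 2) ^ k) • radialSpherical x := by
  have h := (Intertwines.iterate_commutator intertwines_laplacian (intertwines_powerTrace k)
    (2 * k)).map _ (smoothSpherical_mem_invariants (diag x))
  rw [iterate_commutator_powerTrace, iterate_commutator_powerSum, LinearMap.smul_apply,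
    LinearMap.smul_apply, map_nsmul, derivMatrix_pow_trace_smoothSpherical, map_smul] at h
  change (2 * k).factorial • (((-4) ^ k * ∑ i, (x i : ℂ) ^ (2 * k)) • radialSpherical x) =
    (2 * k).factorial • (∑ i, ((4 : ℂ) • coordLaplacian i) ^ k) (radialSpherical x) at h
  have hf : ((2 * k).factorial : ℂ) ≠ 0 := Nat.cast_ne_zero.mpr (Nat.factorial_ne_zero _)
  rw [← Nat.cast_smul_eq_nsmul ℂ, ← Nat.cast_smul_eq_nsmul ℂ] at h
  have h1 := smul_right_injective _ hf h
  simp only [smul_pow, ← Finset.smul_sum, LinearMap.smul_apply] at h1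
  have h4 : ((4 : ℂ) ^ k) ≠ 0 := pow_ne_zero _ (by norm_num)
  refine smul_right_injective _ h4 ?_
  simp only []
  rw [← h1, smul_smul]
  congr 1
  rw [Finset.mul_sum, Finset.mul_sum]
  refine Finset.sum_congr rfl fun i _ => ?_
  rw [pow_mul, ← mul_pow, ← mul_pow]
  ring

end RadialSpherical

/-! ### The Bessel equation -/

section Bessel

/-- The coefficients of the power series of `J_0(√s)`. -/
def besselCoeff (k : ℕ) : ℝ := (-1) ^ k / (4 ^ k * (k.factorial : ℝ) ^ 2)

/-- The sum of a power series. -/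
def powerSeriesSum (a : ℕ → ℝ) (s : ℝ) : ℝ := ∑' k, a k * s ^ k

lemma summable_mul_pow {a : ℕ → ℝ} (ha : ∀ k, |a k| ≤ 1 / k.factorial) (s : ℝ) :
    Summable fun k => a k * s ^ k := by
  refine Summable.of_norm_bounded (Real.summable_pow_div_factorial |s|) fun k => ?_
  rw [norm_mul, norm_pow, Real.norm_eq_abs, Real.norm_eq_abs, div_eq_mul_one_div, mul_comm]
  exact mul_le_mul_of_nonneg_left (ha k) (by positivity)

lemma abs_derivative_coeff_le {a : ℕ → ℝ} (ha : ∀ k, |a k| ≤ 1 / k.factorial) (k : ℕ) :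
    |(k + 1 : ℝ) * a (k + 1)| ≤ 1 / k.factorial := by
  have h : (0 : ℝ) < k + 1 := by positivity
  have hf : (0 : ℝ) < k.factorial := by positivity
  rw [abs_mul, abs_of_pos h]
  calc (k + 1 : ℝ) * |a (k + 1)| ≤ (k + 1) * (1 / (k + 1).factorial) :=
        mul_le_mul_of_nonneg_left (ha _) h.le
    _ = 1 / k.factorial := by
        rw [Nat.factorial_succ]; push_cast; field_simp

/-- The differentiated coefficients satisfy the same bound (`abs_derivative_coeff_le`), so this
applies again to the derivative. -/
lemma hasDerivAt_powerSeriesSum {a : ℕ → ℝ} (ha : ∀ k, |a k| ≤ 1 / k.factorial) (s : ℝ) :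
    HasDerivAt (powerSeriesSum a) (powerSeriesSum (fun k => (k + 1 : ℝ) * a (k + 1)) s) s := by
  set R : ℝ := |s| + 1 with hR
  have hs : s ∈ Metric.ball (0 : ℝ) R := by
    rw [mem_ball_zero_iff, Real.norm_eq_abs]; linarith
  have hu : Summable fun k : ℕ => R ^ (k - 1) / (k - 1).factorial := by
    rw [← summable_nat_add_iff 1]
    exact Real.summable_pow_div_factorial R
  have h := hasDerivAt_tsum_of_isPreconnected (g := fun k s => a k * s ^ k)
    (g' := fun k s => a k * (k * s ^ (k - 1))) hu Metric.isOpen_ball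
    (convex_ball (0 : ℝ) R).isPreconnected
    (fun k y _ => (hasDerivAt_pow k y).const_mul (a k)) (fun k y hy => by
      cases k with
      | zero => simp
      | succ k =>
        rw [Nat.add_sub_cancel, ← mul_assoc, norm_mul, norm_pow, Real.norm_eq_abs,
          Real.norm_eq_abs, div_eq_mul_one_div, mul_comm, mul_comm (a (k + 1))]
        rw [mem_ball_zero_iff, Real.norm_eq_abs] at hy
        have := abs_derivative_coeff_le ha k
        push_cast
        gcongr) hs
    (summable_mul_pow ha s) hs
  refine h.congr_deriv ?_
  have hsum : Summable fun k : ℕ => a k * (k * s ^ (k - 1)) := by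
    rw [← summable_nat_add_iff 1]
    refine (summable_mul_pow (abs_derivative_coeff_le ha) s).congr fun k => ?_
    rw [Nat.add_sub_cancel]; push_cast; ring
  rw [hsum.tsum_eq_zero_add, powerSeriesSum]
  simp only [Nat.cast_zero, zero_mul, mul_zero, zero_add, Nat.add_sub_cancel]
  refine tsum_congr fun k => ?_
  push_cast; ring

lemma abs_besselCoeff_le (k : ℕ) : |besselCoeff k| ≤ 1 / k.factorial := by
  have hf : (1 : ℝ) ≤ k.factorial := by exact_mod_cast k.factorial_pos
  have h4 : (1 : ℝ) ≤ 4 ^ k := one_le_pow₀ (by norm_num)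
  rw [besselCoeff, abs_div, abs_pow, abs_neg, abs_one, one_pow, abs_of_pos (by positivity)]
  refine one_div_le_one_div_of_le (by positivity) ?_
  nlinarith [mul_le_mul h4 hf (by norm_num) (by positivity)]

lemma besselCoeff_succ (k : ℕ) : 4 * (k + 1 : ℝ) ^ 2 * besselCoeff (k + 1) = -besselCoeff k := by
  have hf : (k.factorial : ℝ) ≠ 0 := by positivity
  rw [besselCoeff, besselCoeff, Nat.factorial_succ]
  push_cast
  field_simp
  ring

lemma besselJ0_eq (t : ℝ) : besselJ0 t = powerSeriesSum besselCoeff (t ^ 2) := by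
  refine tsum_congr fun k => ?_
  rw [besselCoeff, pow_mul, pow_mul]
  norm_num

lemma besselJ0_zero : besselJ0 0 = 1 := by
  rw [besselJ0, tsum_eq_single 0]
  · simp
  · intro k hk
    rw [zero_pow (by omega), mul_zero]

/-- The derivative of `J_0`. -/
def besselJ0' (t : ℝ) : ℝ := 2 * t * powerSeriesSum (fun k => (k + 1 : ℝ) * besselCoeff (k + 1)) (t ^ 2)

/-- The second derivative of `J_0`. -/
def besselJ0'' (t : ℝ) : ℝ :=
  2 * powerSeriesSum (fun k => (k + 1 : ℝ) * besselCoeff (k + 1)) (t ^ 2) + 4 * t ^ 2 *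
    powerSeriesSum (fun k => (k + 1 : ℝ) * ((k + 1 : ℕ) + 1 : ℝ) * besselCoeff (k + 2)) (t ^ 2)

lemma hasDerivAt_besselJ0 (t : ℝ) : HasDerivAt besselJ0 (besselJ0' t) t := by
  have h1 := (hasDerivAt_powerSeriesSum abs_besselCoeff_le (t ^ 2)).comp t (hasDerivAt_pow 2 t)
  have h2 : besselJ0 = powerSeriesSum besselCoeff ∘ fun t => t ^ 2 := funext besselJ0_eq
  rw [h2]
  refine h1.congr_deriv ?_
  rw [besselJ0']
  push_cast
  ring

lemma hasDerivAt_besselJ0' (t : ℝ) : HasDerivAt besselJ0' (besselJ0'' t) t := by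
  have h1 := (hasDerivAt_powerSeriesSum (abs_derivative_coeff_le abs_besselCoeff_le)
    (t ^ 2)).comp t (hasDerivAt_pow 2 t)
  have h2 := ((hasDerivAt_id t).const_mul 2).mul h1
  refine h2.congr_deriv ?_
  rw [besselJ0'']
  simp only [Function.comp, id, mul_one, ← mul_assoc]
  push_cast
  ring

/-- In the variable s = t², after a factor t is removed, comparing coefficients gives exactly the
recursion `besselCoeff_succ`. -/
lemma bessel_equation (t : ℝ) : t * besselJ0'' t + besselJ0' t + t * besselJ0 t = 0 := by
  rw [besselJ0'', besselJ0', besselJ0_eq]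
  set s := t ^ 2
  have h1 := abs_derivative_coeff_le abs_besselCoeff_le
  have h2 := abs_derivative_coeff_le h1
  have key : powerSeriesSum besselCoeff s +
      4 * powerSeriesSum (fun k => (k + 1 : ℝ) * besselCoeff (k + 1)) s +
      4 * s * powerSeriesSum
        (fun k => (k + 1 : ℝ) * ((k + 1 : ℕ) + 1 : ℝ) * besselCoeff (k + 2)) s = 0 := by
    have e0 := summable_mul_pow abs_besselCoeff_le s
    have e1 := summable_mul_pow h1 s
    have e2 := summable_mul_pow h2 s
    have e3 : s * powerSeriesSum
        (fun k => (k + 1 : ℝ) * ((k + 1 : ℕ) + 1 : ℝ) * besselCoeff (k + 2)) s =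
        ∑' k : ℕ, (k : ℝ) * (k + 1) * besselCoeff (k + 1) * s ^ k := by
      have hs : Summable fun k : ℕ => (k : ℝ) * (k + 1) * besselCoeff (k + 1) * s ^ k := by
        rw [← summable_nat_add_iff 1]
        refine (e2.mul_left s).congr fun k => ?_
        push_cast
        ring
      rw [hs.tsum_eq_zero_add, powerSeriesSum, ← tsum_mul_left]
      simp only [Nat.cast_zero, zero_mul, zero_add]
      refine tsum_congr fun k => ?_
      push_cast
      ring
    have hs : Summable fun k : ℕ => (k : ℝ) * (k + 1) * besselCoeff (k + 1) * s ^ k := by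
      rw [← summable_nat_add_iff 1]
      refine (e2.mul_left s).congr fun k => ?_
      push_cast
      ring
    rw [mul_assoc 4 s, e3, powerSeriesSum, powerSeriesSum, ← tsum_mul_left, ← tsum_mul_left,
      ← e0.tsum_add (e1.mul_left 4), ← (e0.add (e1.mul_left 4)).tsum_add (hs.mul_left 4)]
    rw [← tsum_zero (α := ℝ) (β := ℕ)]
    refine tsum_congr fun k => ?_
    linear_combination s ^ k * besselCoeff_succ k
  linear_combination t * key

/-- Uniqueness for the Bessel equation with regular initial condition, on the half-line. -/
lemma eq_zero_of_bessel_equation_of_nonneg {h h' h'' : ℝ → ℝ} {c : ℝ} (hc : 0 ≤ c)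
    (h1 : ∀ t, HasDerivAt h (h' t) t) (h2 : ∀ t, HasDerivAt h' (h'' t) t)
    (heq : ∀ t, t * h'' t + h' t + c * t * h t = 0) (h0 : h 0 = 0) {t : ℝ} (ht : 0 ≤ t) :
    h t = 0 := by
  have h0' : h' 0 = 0 := by simpa using heq 0
  have hE : ∀ t, HasDerivAt (fun t => h' t ^ 2 + c * h t ^ 2)
      (2 * h' t * h'' t + c * (2 * h t * h' t)) t := by
    intro t
    refine (((h2 t).pow 2).add (((h1 t).pow 2).const_mul c)).congr_deriv ?_
    push_cast
    ring
  -- By the equation, t times the derivative of this energy is -2h'², so the energy decreases on the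
  -- half-line.
  have hanti : AntitoneOn (fun t => h' t ^ 2 + c * h t ^ 2) (Set.Ici 0) := by
    refine antitoneOn_of_deriv_nonpos (convex_Ici 0)
      (fun t _ => (hE t).continuousAt.continuousWithinAt)
      (fun t _ => (hE t).differentiableAt.differentiableWithinAt) fun t ht => ?_
    rw [interior_Ici] at ht
    have ht' : 0 < t := ht
    rw [(hE t).deriv]
    have : t * (2 * h' t * h'' t + c * (2 * h t * h' t)) = -(2 * h' t ^ 2) := by
      linear_combination 2 * h' t * heq t
    by_contra hpos
    push Not at hpos
    nlinarith [mul_pos ht' hpos, sq_nonneg (h' t)]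
  -- The energy is 0 at the origin, because the equation there reads h'(0) = 0. The conclusion is
  -- drawn from h' and not from c h², as c may be 0.
  have hzero : ∀ t, 0 ≤ t → h' t = 0 := by
    intro t ht
    have := hanti (Set.mem_Ici.mpr le_rfl) (Set.mem_Ici.mpr ht) ht
    simp only [h0, h0'] at this
    have hh : h' t ^ 2 ≤ 0 := by nlinarith [mul_nonneg hc (sq_nonneg (h t))]
    exact pow_eq_zero_iff (two_ne_zero) |>.mp (le_antisymm hh (sq_nonneg _))
  rw [← h0]
  refine constant_of_derivWithin_zero (a := 0) (b := t)
    (fun s _ => (h1 s).differentiableAt.differentiableWithinAt) (fun s hs => ?_) t ⟨ht, le_rfl⟩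
  rw [((h1 s).hasDerivWithinAt.derivWithin
    ((uniqueDiffOn_Icc (lt_of_le_of_lt hs.1 hs.2)) s ⟨hs.1, hs.2.le⟩)), hzero s hs.1]

lemma eq_zero_of_bessel_equation {h h' h'' : ℝ → ℝ} {c : ℝ} (hc : 0 ≤ c)
    (h1 : ∀ t, HasDerivAt h (h' t) t) (h2 : ∀ t, HasDerivAt h' (h'' t) t)
    (heq : ∀ t, t * h'' t + h' t + c * t * h t = 0) (h0 : h 0 = 0) (t : ℝ) : h t = 0 := by
  rcases le_total 0 t with ht | ht
  · exact eq_zero_of_bessel_equation_of_nonneg hc h1 h2 heq h0 ht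
  · have := eq_zero_of_bessel_equation_of_nonneg (h := fun t => h (-t)) (h' := fun t => -h' (-t))
      (h'' := fun t => h'' (-t)) hc
      (fun t => ((h1 (-t)).comp t (hasDerivAt_neg t)).congr_deriv (by ring))
      (fun t => ((h2 (-t)).comp t (hasDerivAt_neg t)).neg.congr_deriv (by ring))
      (fun t => by linear_combination -heq (-t)) (by simpa using h0) (neg_nonneg.mpr ht)
    simpa using this

lemma eq_mul_besselJ0 {g g' g'' : ℝ → ℂ} (l : ℝ) (h1 : ∀ t, HasDerivAt g (g' t) t)
    (h2 : ∀ t, HasDerivAt g' (g'' t) t)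
    (heq : ∀ t : ℝ, (t : ℂ) * g'' t + g' t + (l : ℂ) ^ 2 * t * g t = 0) (t : ℝ) :
    g t = g 0 * (besselJ0 (l * t) : ℝ) := by
  have hl : ∀ t : ℝ, HasDerivAt (fun t => l * t) l t := fun t => by
    simpa using (hasDerivAt_id t).const_mul l
  have j1 : ∀ t, HasDerivAt (fun t => besselJ0 (l * t)) (l * besselJ0' (l * t)) t := fun t =>
    ((hasDerivAt_besselJ0 (l * t)).comp t (hl t)).congr_deriv (by ring)
  have j2 : ∀ t, HasDerivAt (fun t => l * besselJ0' (l * t)) (l * (l * besselJ0'' (l * t))) t :=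
    fun t => (((hasDerivAt_besselJ0' (l * t)).comp t (hl t)).const_mul l).congr_deriv (by ring)
  have key : ∀ T : ℂ →L[ℝ] ℝ, T (g t) = T (g 0) * besselJ0 (l * t) := by
    intro T
    have := eq_zero_of_bessel_equation (h := fun t => T (g t) - T (g 0) * besselJ0 (l * t))
      (h' := fun t => T (g' t) - T (g 0) * (l * besselJ0' (l * t)))
      (h'' := fun t => T (g'' t) - T (g 0) * (l * (l * besselJ0'' (l * t)))) (sq_nonneg l)
      (fun t => (T.hasFDerivAt.comp_hasDerivAt t (h1 t)).sub ((j1 t).const_mul _))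
      (fun t => (T.hasFDerivAt.comp_hasDerivAt t (h2 t)).sub ((j2 t).const_mul _))
      (fun t => by
        have e1 := congrArg T (heq t)
        have e2 : (t : ℂ) * g'' t + g' t + (l : ℂ) ^ 2 * t * g t =
            t • g'' t + g' t + (l ^ 2 * t) • g t := by
          simp only [Complex.real_smul]; push_cast; ring
        rw [e2, map_add, map_add, map_smul, map_smul, map_zero, smul_eq_mul, smul_eq_mul] at e1
        linear_combination e1 - T (g 0) * l * bessel_equation (l * t))
      (by simp [besselJ0_zero]) t
    linarith
  apply Complex.ext
  · simpa using key Complex.reCLM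
  · simpa using key Complex.imCLM

end Bessel

/-! ### Rotation invariance -/

section Rotation

variable {ι : Type*} [Fintype ι]

lemma hasDerivAt_add_smul (f : Smooth ι) (z v : ι → ℂ) (t : ℝ) :
    HasDerivAt (fun t : ℝ => f (z + t • v)) (dirDeriv v f (z + t • v)) t := by
  have h1 : HasDerivAt (fun t : ℝ => z + t • v) v t := by
    simpa using ((hasDerivAt_id t).smul_const v).const_add z
  exact f.differentiable.differentiableAt.hasFDerivAt.comp_hasDerivAt t h1

variable [DecidableEq ι]

lemma commutator_coordLaplacian_coord (i j : ι) :
    commutator (coordLaplacian i) (mulOp (coord j)) =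
      if i = j then (2 : ℂ) • conjWirtinger j else 0 := by
  unfold coordLaplacian
  simp only [commutator_add_left, commutator_dirDeriv_sq_coord]
  split_ifs with h
  · subst h
    simp only [Pi.single_eq_same, conjWirtinger, smul_add, smul_smul, mul_one]
  · simp [Pi.single_eq_of_ne (Ne.symm h)]

lemma commutator_coordLaplacian_conjCoord (i j : ι) :
    commutator (coordLaplacian i) (mulOp (conjCoord j)) =
      if i = j then (2 : ℂ) • wirtinger j else 0 := by
  unfold coordLaplacian
  simp only [commutator_add_left, commutator_dirDeriv_sq_conjCoord]
  split_ifs with h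
  · subst h
    simp only [Pi.single_eq_same, wirtinger, smul_sub, smul_smul, mul_one, star_one]
    simp [sub_eq_add_neg]
  · simp [Pi.single_eq_of_ne (Ne.symm h)]

/-- The infinitesimal rotation in the variable `z_i`, up to a factor. -/
def rotation (i : ι) : SmoothOp ι :=
  mulOp (coord i) * wirtinger i - mulOp (conjCoord i) * conjWirtinger i

lemma commute_rotation_coordLaplacian (i j : ι) : Commute (rotation i) (coordLaplacian j) := by
  have h1 : commutator (coordLaplacian j) (wirtinger i) = 0 :=
    sub_eq_zero.mpr (commute_wirtinger_coordLaplacian i j).symm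
  have h2 : commutator (coordLaplacian j) (conjWirtinger i) = 0 :=
    sub_eq_zero.mpr (commute_conjWirtinger_coordLaplacian i j).symm
  have h3 : Commute (wirtinger i) (conjWirtinger i) :=
    (commute_dirDeriv_conjWirtinger _ _).sub_left ((commute_dirDeriv_conjWirtinger _ _).smul_left _)
  have h4 : commutator (coordLaplacian j) (rotation i) = 0 := by
    rw [rotation, map_sub, commutator_mul, commutator_mul, h1, h2, mul_zero, mul_zero, add_zero,
      add_zero, commutator_coordLaplacian_coord, commutator_coordLaplacian_conjCoord]
    split_ifs with h
    · rw [smul_mul_assoc, smul_mul_assoc, h3.eq, sub_self]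
    · rw [zero_mul, zero_mul, sub_self]
  exact (sub_eq_zero.mp h4).symm

lemma rotation_apply (i : ι) (f : Smooth ι) (z : ι → ℂ) :
    rotation i f z = -2 * Complex.I * ((z i).re * dirDeriv (Pi.single i Complex.I) f z -
      (z i).im * dirDeriv (Pi.single i 1) f z) := by
  simp only [rotation, LinearMap.sub_apply, Module.End.mul_apply, mulOp_apply, wirtinger,
    conjWirtinger, LinearMap.add_apply, LinearMap.smul_apply, Smooth.sub_apply, Smooth.mul_apply,
    Smooth.add_apply, Smooth.smul_apply, coord_apply, conjCoord_apply]
  have h1 : star (z i) = (z i).re - (z i).im * Complex.I := by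
    apply Complex.ext <;> simp
  rw [h1]
  conv_lhs => rw [← Complex.re_add_im (z i)]
  simp only [Complex.add_re, Complex.add_im, Complex.mul_re, Complex.mul_im, Complex.ofReal_re,
    Complex.ofReal_im, Complex.I_re, Complex.I_im]
  push_cast
  ring

lemma rotation_apply' (i : ι) (f : Smooth ι) (z : ι → ℂ) :
    rotation i f z = -2 * Complex.I * dirDeriv (Pi.single i (Complex.I * z i)) f z := by
  have h1 : (Pi.single i (Complex.I * z i) : ι → ℂ) =
      (z i).re • (Pi.single i Complex.I : ι → ℂ) + (-(z i).im) • (Pi.single i 1 : ι → ℂ) := by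
    rw [← Pi.single_smul, ← Pi.single_smul, ← Pi.single_add]
    congr 1
    apply Complex.ext <;> simp
  rw [rotation_apply, h1, dirDeriv_add, dirDeriv_smul, dirDeriv_smul]
  simp only [LinearMap.add_apply, LinearMap.smul_apply, Smooth.add_apply, Smooth.smul_apply]
  push_cast
  ring

/-- Differentiate Re z_i ∂_I f = Im z_i ∂_1 f in the imaginary direction on the real axis. This
replaces polar coordinates and stays valid at the origin: Re z_i times the Laplacian becomes the
Bessel operator. -/
lemma re_mul_dirDeriv_dirDeriv_of_rotation {f : Smooth ι} {i : ι} (hf : rotation i f = 0)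
    (z : ι → ℂ) (hz : (z i).im = 0) :
    ((z i).re : ℂ) * dirDeriv (Pi.single i Complex.I) (dirDeriv (Pi.single i Complex.I) f) z =
      dirDeriv (Pi.single i 1) f z := by
  set v : ι → ℂ := Pi.single i Complex.I with hv
  have h0 : ∀ s : ℝ, ((z i).re : ℂ) * dirDeriv v f (z + s • v) -
      (s : ℂ) * dirDeriv (Pi.single i 1) f (z + s • v) = 0 := by
    intro s
    have h := DFunLike.congr_fun hf (z + s • v)
    rw [rotation_apply, Smooth.zero_apply] at h
    have e : (z + s • v) i = z i + s * Complex.I := by simp [hv]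
    have e1 : ((z + s • v) i).re = (z i).re := by rw [e]; simp
    have e2 : ((z + s • v) i).im = s := by rw [e]; simp [hz]
    rw [e1, e2] at h
    have hI : (-2 * Complex.I : ℂ) ≠ 0 := by simp
    exact (mul_eq_zero.mp h).resolve_left hI
  have h1 := ((hasDerivAt_add_smul (dirDeriv v f) z v 0).const_mul ((z i).re : ℂ)).sub
    ((Complex.ofRealCLM.hasDerivAt (x := (0 : ℝ))).mul
      (hasDerivAt_add_smul (dirDeriv (Pi.single i 1) f) z v 0))
  have h2 : HasDerivAt (fun _ : ℝ => (0 : ℂ)) _ 0 := h1.congr_of_eventuallyEq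
    (Eventually.of_forall fun s => (h0 s).symm)
  have h3 := h2.unique (hasDerivAt_const _ _)
  simp only [zero_smul, add_zero, Complex.ofRealCLM_apply, Complex.ofReal_one, one_mul,
    Complex.ofReal_zero, zero_mul] at h3
  exact sub_eq_zero.mp h3

/-- A rotation invariant eigenfunction of the Laplacian in the variable `z_i` is a Bessel function
of that variable. -/
lemma apply_add_smul_single {f : Smooth ι} {i : ι} (hf : rotation i f = 0) {l : ℝ}
    (hl : coordLaplacian i f = (-(l : ℂ) ^ 2) • f) (z : ι → ℂ) (hz : z i = 0) (t : ℝ) :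
    f (z + t • (Pi.single i 1 : ι → ℂ)) = f z * (besselJ0 (l * t) : ℝ) := by
  have h := eq_mul_besselJ0 (g := fun t : ℝ => f (z + t • (Pi.single i 1 : ι → ℂ))) l
    (fun t => hasDerivAt_add_smul f z _ t) (fun t => hasDerivAt_add_smul _ z _ t) (fun t => by
      have e : (z + t • (Pi.single i 1 : ι → ℂ)) i = t := by simp [hz]
      have h1 := re_mul_dirDeriv_dirDeriv_of_rotation hf (z + t • (Pi.single i 1 : ι → ℂ))
        (by rw [e, Complex.ofReal_im])
      have h2 := DFunLike.congr_fun hl (z + t • (Pi.single i 1 : ι → ℂ))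
      simp only [coordLaplacian, LinearMap.add_apply, Module.End.mul_apply, Smooth.add_apply,
        Smooth.smul_apply] at h2
      rw [e, Complex.ofReal_re] at h1
      linear_combination (t : ℂ) * h2 - h1) t
  simpa using h

lemma apply_ofReal_eq_prod {f : Smooth ι} (hf : ∀ i, rotation i f = 0) (l : ι → ℝ)
    (hl : ∀ i, coordLaplacian i f = (-(l i : ℂ) ^ 2) • f) (ξ : ι → ℝ) :
    f (fun i => ξ i) = f 0 * ∏ i, (besselJ0 (l i * ξ i) : ℂ) := by
  -- The variables are switched on one at a time starting from 0, each contributing one Bessel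
  -- factor.
  have key : ∀ s : Finset ι, f (fun i => if i ∈ s then (ξ i : ℂ) else 0) =
      f 0 * ∏ i ∈ s, (besselJ0 (l i * ξ i) : ℂ) := by
    intro s
    induction s using Finset.induction_on with
    | empty => simp; rfl
    | insert a s ha ih =>
      have h := apply_add_smul_single (hf a) (hl a) (fun i => if i ∈ s then (ξ i : ℂ) else 0)
        (if_neg ha) (ξ a)
      have e : ((fun i => if i ∈ s then (ξ i : ℂ) else 0) + ξ a • (Pi.single a 1 : ι → ℂ) : ι → ℂ) =
          fun i => if i ∈ insert a s then (ξ i : ℂ) else 0 := by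
        funext i
        by_cases hi : i = a
        · subst hi; simp [ha]
        · simp [hi]
      rw [e, ih] at h
      rw [h, Finset.prod_insert ha]
      ring
  simpa using key Finset.univ

end Rotation

/-! ### The determinant formula -/

section Formula

variable {n : ℕ}

/-- Changing the phase of z_i preserves all |z_j|², hence the discriminant, and on diagonal matrices
it is left multiplication by a unitary. -/
lemma rotation_radial {f : Smooth (Fin n × Fin n)} (hf : f ∈ invariants n) (i : Fin n) :
    rotation i (radial n f) = 0 := by
  ext z
  set v : Fin n → ℂ := Pi.single i (Complex.I * z i) with hv
  have h1 : dirDeriv v (discr n) z = 0 := by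
    have hmul : ∀ g h : Smooth (Fin n), dirDeriv v g z = 0 → dirDeriv v h z = 0 →
        dirDeriv v (g * h) z = 0 := by
      intro g h hg hh
      rw [dirDeriv_mul_apply, Smooth.add_apply, Smooth.mul_apply, Smooth.mul_apply, hg, hh]
      ring
    have hone : dirDeriv v 1 z = 0 := by rw [dirDeriv_one, Smooth.zero_apply]
    have hsq : ∀ j, dirDeriv v (coordSq j) z = 0 := by
      intro j
      rcases eq_or_ne j i with rfl | hj
      · rw [dirDeriv_coordSq]
        simp only [Smooth.add_apply, Smooth.mul_apply, Smooth.algebraMap_apply, coord_apply,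
          conjCoord_apply, hv, Pi.single_eq_same, star_mul']
        have : star Complex.I = -Complex.I := Complex.conj_I
        rw [this]
        ring
      · rw [hv, dirDeriv_single_coordSq_of_ne hj, Smooth.zero_apply]
    refine Finset.prod_induction _ (fun g => dirDeriv v g z = 0) hmul hone fun j _ =>
      Finset.prod_induction _ (fun g => dirDeriv v g z = 0) hmul hone fun k _ => ?_
    rw [map_sub, Smooth.sub_apply, hsq, hsq, sub_zero]
  have h2 : dirDeriv v (comap (diagMap n) f) z = 0 := by
    have hX : star (Matrix.single i i Complex.I : V n) = -Matrix.single i i Complex.I := by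
      rw [Matrix.star_eq_conjTranspose, Matrix.conjTranspose_single,
        show star Complex.I = -Complex.I from Complex.conj_I, Matrix.single_neg]
    have h3 : infAct (Matrix.single i i Complex.I) 0 (diagMap n z) = diagMap n v := by
      ext ⟨r, s⟩
      rw [infAct_diagMap, hv, diagMap_single, Matrix.single_apply, Pi.single_apply]
      simp only [Prod.mk.injEq, Matrix.zero_apply, mul_zero, sub_zero]
      by_cases h : r = i ∧ s = i
      · rw [if_pos h, if_pos ⟨h.1.symm, h.2.symm⟩, h.2]
      · rw [if_neg h, if_neg (fun h' => h ⟨h'.1.symm, h'.2.symm⟩), zero_mul]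
    rw [dirDeriv_comap, comap_apply, dirDeriv_apply, ← h3]
    exact fderiv_infAct hf _ _ hX (by simp) _
  rw [rotation_apply', radial_apply, dirDeriv_mul_apply, Smooth.add_apply, Smooth.mul_apply,
    Smooth.mul_apply, h1, h2, Smooth.zero_apply]
  ring

lemma D_eq_det (x : Fin n → ℝ) : D x = (Matrix.vandermonde fun i => -(x i ^ 2)).det := by
  rw [Matrix.det_vandermonde, D]
  refine Finset.prod_congr rfl fun i _ => Finset.prod_congr rfl fun j _ => ?_
  ring

lemma D_comp_perm (x : Fin n → ℝ) (σ : Equiv.Perm (Fin n)) :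
    D (x ∘ σ) = (Equiv.Perm.sign σ : ℤ) * D x := by
  rw [D_eq_det, D_eq_det, ← Matrix.det_permute]
  rfl

lemma sq_injective_of_D_ne_zero {x : Fin n → ℝ} (hx : D x ≠ 0) :
    Function.Injective fun i => x i ^ 2 := by
  rw [D_eq_det, Matrix.det_vandermonde_ne_zero_iff] at hx
  intro i j hij
  exact hx (by simpa using hij)

lemma discr_ofReal (ξ : Fin n → ℝ) : discr n (fun i => ξ i) = (D ξ : ℂ) := by
  rw [discr_apply, D]
  push_cast
  refine Finset.prod_congr rfl fun i _ => Finset.prod_congr rfl fun j _ => ?_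
  simp [Complex.normSq_ofReal, sq]

lemma radialSpherical_ofReal (x ξ : Fin n → ℝ) :
    radialSpherical x (fun i => ξ i) = D ξ * spherical (diag x) (diag ξ) := by
  rw [radialSpherical, radial_apply, Smooth.mul_apply, discr_ofReal, comap_apply,
    smoothSpherical_apply, toMat_diagMap]
  rfl

/-- The permutation matrices are unitary. -/
def permUnitary (σ : Equiv.Perm (Fin n)) : U n :=
  ⟨σ.permMatrix ℂ, by
    rw [Matrix.mem_unitaryGroup_iff, Matrix.star_eq_conjTranspose, Matrix.conjTranspose_permMatrix,
      ← Matrix.permMatrix_mul]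
    simp⟩

lemma spherical_diag_comp_perm (A : V n) (ξ : Fin n → ℝ) (σ : Equiv.Perm (Fin n)) :
    spherical A (diag (ξ ∘ σ)) = spherical A (diag ξ) := by
  have h : diag (ξ ∘ σ) = act (permUnitary σ, permUnitary σ) (diag ξ) := by
    have h1 : star (permUnitary σ : V n) = (σ⁻¹).permMatrix ℂ := by
      rw [Matrix.star_eq_conjTranspose]; exact Matrix.conjTranspose_permMatrix σ
    rw [act]
    simp only []
    rw [h1]
    ext i j
    change _ = (σ.permMatrix ℂ * diag ξ * (σ⁻¹).permMatrix ℂ) i j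
    rw [Matrix.mul_assoc]
    simp [Equiv.Perm.permMatrix, PEquiv.toMatrix_toPEquiv_mul, PEquiv.mul_toMatrix_toPEquiv, diag,
      Matrix.diagonal_apply, show ∀ j, Equiv.symm σ⁻¹ j = σ j from fun _ => rfl]
  rw [h, spherical_act_right]

/-- The spherical function is a multiple of the quotient of the Bessel determinant by the
discriminant. -/
lemma exists_D_mul_spherical_eq {x : Fin n → ℝ} (hx : D x ≠ 0) :
    ∃ c : ℂ, ∀ ξ : Fin n → ℝ, (D ξ : ℂ) * spherical (diag x) (diag ξ) =
      c * ((Matrix.of fun j k => besselJ0 (x j * ξ k)).det : ℝ) := by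
  have hm : Function.Injective fun i : Fin n => -(x i : ℂ) ^ 2 := by
    intro i j hij
    refine sq_injective_of_D_ne_zero hx ?_
    have : (x i : ℂ) ^ 2 = (x j : ℂ) ^ 2 := neg_injective hij
    exact_mod_cast this
  obtain ⟨B, hB, hL, hT⟩ := exists_sum_eigenvectors (L := fun i : Fin n => coordLaplacian i)
    commute_coordLaplacian hm (sum_coordLaplacian_pow_radialSpherical x)
  have hrot : ∀ P i, rotation i (B P) = 0 := fun P i =>
    hT _ (commute_rotation_coordLaplacian i)
      (rotation_radial (smoothSpherical_mem_invariants _) i) P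
  have h1 : ∀ ξ : Fin n → ℝ, (D ξ : ℂ) * spherical (diag x) (diag ξ) =
      ∑ P, B P 0 * ∏ i, (besselJ0 (x (P i) * ξ i) : ℂ) := by
    intro ξ
    rw [← radialSpherical_ofReal, hB, ← Smooth.eval_apply, map_sum]
    refine Finset.sum_congr rfl fun P _ => ?_
    exact apply_ofReal_eq_prod (hrot P) (fun i => x (P i)) (hL P) ξ
  -- D is alternating in ξ and the spherical function is symmetric, so signed averaging over
  -- permutations of ξ turns each product into a determinant.
  have h2 : ∀ ξ : Fin n → ℝ, (n.factorial : ℂ) * ((D ξ : ℂ) * spherical (diag x) (diag ξ)) =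
      ∑ P, B P 0 * ((Matrix.of fun j k => (besselJ0 (x j * ξ k) : ℂ)).submatrix P id).det := by
    intro ξ
    have e1 : ∀ σ : Equiv.Perm (Fin n), (D ξ : ℂ) * spherical (diag x) (diag ξ) =
        ∑ P, B P 0 * ((Equiv.Perm.sign σ : ℤ) * ∏ i, (besselJ0 (x (P i) * ξ (σ i)) : ℂ)) := by
      intro σ
      have e2 := h1 (ξ ∘ σ)
      rw [D_comp_perm, spherical_diag_comp_perm] at e2
      have e3 : (((Equiv.Perm.sign σ : ℤ) : ℂ)) * ((Equiv.Perm.sign σ : ℤ) : ℂ) = 1 := by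
        rw [← Int.cast_mul, ← Units.val_mul, Int.units_mul_self]; simp
      calc (D ξ : ℂ) * spherical (diag x) (diag ξ) =
          ((Equiv.Perm.sign σ : ℤ) : ℂ) * ((((Equiv.Perm.sign σ : ℤ) * D ξ : ℝ) : ℂ) *
            spherical (diag x) (diag ξ)) := by
              push_cast
              linear_combination (-(D ξ : ℂ) * spherical (diag x) (diag ξ)) * e3
        _ = _ := by
          rw [e2, Finset.mul_sum]
          refine Finset.sum_congr rfl fun P _ => ?_
          simp only [Function.comp]
          ring
    have e4 : (n.factorial : ℂ) * ((D ξ : ℂ) * spherical (diag x) (diag ξ)) =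
        ∑ σ : Equiv.Perm (Fin n), (D ξ : ℂ) * spherical (diag x) (diag ξ) := by
      rw [Finset.sum_const, Finset.card_univ, Fintype.card_perm, Fintype.card_fin, nsmul_eq_mul]
    rw [e4, Finset.sum_congr rfl fun σ _ => e1 σ, Finset.sum_comm]
    refine Finset.sum_congr rfl fun P _ => ?_
    rw [← Finset.mul_sum, ← Matrix.det_transpose, Matrix.det_apply']
    rfl
  refine ⟨(n.factorial : ℂ)⁻¹ * ∑ P, B P 0 *
    ((1 : Matrix (Fin n) (Fin n) ℂ).submatrix P id).det, fun ξ => ?_⟩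
  have hn : (n.factorial : ℂ) ≠ 0 := Nat.cast_ne_zero.mpr n.factorial_ne_zero
  set M : Matrix (Fin n) (Fin n) ℂ := Matrix.of fun j k => (besselJ0 (x j * ξ k) : ℂ) with hM
  have h3 : ((Matrix.of fun j k => besselJ0 (x j * ξ k)).det : ℂ) = M.det :=
    RingHom.map_det Complex.ofRealHom _
  -- Choosing rows by P is left multiplication by the same rows of the identity, so every
  -- determinant is a scalar multiple of det M, the scalar being independent of ξ.
  have h4 : ∀ P : Fin n → Fin n, (M.submatrix P id).det =
      ((1 : Matrix (Fin n) (Fin n) ℂ).submatrix P id).det * M.det := by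
    intro P
    rw [← Matrix.det_mul]
    congr 1
    ext i j
    simp [Matrix.mul_apply, Matrix.one_apply]
  have h5 : _ = ∑ P, B P 0 * (M.submatrix P id).det := h2 ξ
  simp only [h4] at h5
  rw [h3, mul_assoc, Finset.sum_mul, eq_inv_mul_iff_mul_eq₀ hn, h5]
  exact Finset.sum_congr rfl fun P _ => by ring

end Formula

/-! ### The constant of proportionality and the degenerate points -/

section Constant

variable {n : ℕ}

/-- The remainder of the power series of `J_0(√s)` after `n` terms. -/
def besselTail (n : ℕ) (s : ℝ) : ℝ := powerSeriesSum (fun k => besselCoeff (k + n)) s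

lemma abs_besselCoeff_add_le (n k : ℕ) : |besselCoeff (k + n)| ≤ 1 / k.factorial :=
  (abs_besselCoeff_le _).trans (one_div_le_one_div_of_le (by positivity)
    (by exact_mod_cast Nat.factorial_le (Nat.le_add_right k n)))

lemma continuous_besselTail (n : ℕ) : Continuous (besselTail n) :=
  continuous_iff_continuousAt.mpr fun s =>
    (hasDerivAt_powerSeriesSum (abs_besselCoeff_add_le n) s).continuousAt

lemma besselJ0_eq_sum_add (n : ℕ) (t : ℝ) :
    besselJ0 t = ∑ k : Fin n, besselCoeff k * (t ^ 2) ^ (k : ℕ) +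
      (t ^ 2) ^ n * besselTail n (t ^ 2) := by
  rw [besselJ0_eq, powerSeriesSum,
    ← (summable_mul_pow abs_besselCoeff_le (t ^ 2)).sum_add_tsum_nat_add n,
    Fin.sum_univ_eq_sum_range (fun k => besselCoeff k * (t ^ 2) ^ k), besselTail, powerSeriesSum,
    ← tsum_mul_left]
  congr 1
  refine tsum_congr fun k => ?_
  rw [pow_add]; ring

/-- The Bessel determinant near the origin. -/
lemma exists_det_besselJ0_eq {x ξ : Fin n → ℝ}
    (hx : (Matrix.vandermonde fun i => x i ^ 2).det ≠ 0)
    (hξ : (Matrix.vandermonde fun i => ξ i ^ 2).det ≠ 0) :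
    ∃ F : ℝ → Matrix (Fin n) (Fin n) ℝ, Continuous F ∧ (F 0).det = ∏ k : Fin n, besselCoeff k ∧
      ∀ t : ℝ, (Matrix.of fun j k => besselJ0 (x j * (t * ξ k))).det =
        (Matrix.vandermonde fun i => x i ^ 2).det * ((∏ k : Fin n, (t ^ 2) ^ (k : ℕ)) *
          (F t).det) * (Matrix.vandermonde fun i => ξ i ^ 2).det := by
  set A := Matrix.vandermonde fun i => x i ^ 2 with hA
  set B := Matrix.vandermonde fun i => ξ i ^ 2 with hB
  set R : ℝ → Matrix (Fin n) (Fin n) ℝ := fun t => Matrix.of fun j k =>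
    (x j ^ 2 * ξ k ^ 2) ^ n * besselTail n ((x j * (t * ξ k)) ^ 2) with hR
  -- The first n terms of the series give A diag((t²)^k a_k) Bᵀ. The remainder carries (t²)^n;
  -- pulling (t²)^k out of row k leaves the exponent n - k > 0, so this part vanishes at t = 0.
  set F : ℝ → Matrix (Fin n) (Fin n) ℝ := fun t =>
    Matrix.diagonal (fun k : Fin n => besselCoeff k) +
      Matrix.diagonal (fun k : Fin n => (t ^ 2) ^ (n - (k : ℕ))) * (A⁻¹ * R t * (Bᵀ)⁻¹) with hF
  have hA1 : A * A⁻¹ = 1 := Matrix.mul_nonsing_inv _ (isUnit_iff_ne_zero.mpr hx)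
  have hB1 : (Bᵀ)⁻¹ * Bᵀ = 1 := Matrix.nonsing_inv_mul _
    (isUnit_iff_ne_zero.mpr (by rwa [Matrix.det_transpose]))
  refine ⟨F, ?_, ?_, fun t => ?_⟩
  · have hRc : Continuous R := continuous_matrix fun j k => by
      simp only [hR, Matrix.of_apply]
      exact continuous_const.mul ((continuous_besselTail n).comp (by fun_prop))
    exact continuous_const.add (Continuous.matrix_mul
      (Continuous.matrix_diagonal (by fun_prop))
      ((continuous_const.matrix_mul hRc).matrix_mul continuous_const))
  · have h0 : (fun k : Fin n => ((0 : ℝ) ^ 2) ^ (n - (k : ℕ))) = fun _ => 0 := by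
      funext k
      have hk : n - (k : ℕ) ≠ 0 := by have := k.2; omega
      simp [hk]
    simp only [hF, h0]
    rw [Matrix.diagonal_zero, zero_mul, add_zero, Matrix.det_diagonal]
  · have hM : (Matrix.of fun j k => besselJ0 (x j * (t * ξ k))) =
        A * (Matrix.diagonal (fun k : Fin n => (t ^ 2) ^ (k : ℕ)) * F t) * Bᵀ := by
      have e1 : Matrix.diagonal (fun k : Fin n => (t ^ 2) ^ (k : ℕ)) * F t =
          Matrix.diagonal (fun k : Fin n => (t ^ 2) ^ (k : ℕ) * besselCoeff k) +
            (t ^ 2) ^ n • (A⁻¹ * R t * (Bᵀ)⁻¹) := by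
        simp only [hF, mul_add, ← mul_assoc, Matrix.diagonal_mul_diagonal]
        congr 1
        have : (fun k : Fin n => (t ^ 2) ^ (k : ℕ) * (t ^ 2) ^ (n - (k : ℕ))) =
            fun _ => (t ^ 2) ^ n := by
          funext k
          rw [← pow_add, Nat.add_sub_cancel' k.2.le]
        rw [this, mul_assoc, mul_assoc, ← Matrix.smul_one_eq_diagonal, Matrix.smul_mul,
          Matrix.one_mul, mul_assoc]
      have e2 : A * (A⁻¹ * R t * (Bᵀ)⁻¹) * Bᵀ = R t := by
        rw [← mul_assoc, ← mul_assoc, hA1, one_mul, mul_assoc, hB1, mul_one]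
      rw [e1, mul_add, add_mul, Matrix.mul_smul, Matrix.smul_mul, e2]
      ext i j
      rw [Matrix.add_apply, Matrix.smul_apply, Matrix.mul_apply, Matrix.of_apply,
        besselJ0_eq_sum_add n]
      congr 1
      · refine Finset.sum_congr rfl fun k _ => ?_
        rw [Matrix.mul_diagonal, Matrix.transpose_apply, hA, hB, Matrix.vandermonde_apply,
          Matrix.vandermonde_apply]
        ring
      · simp only [hR, Matrix.of_apply, smul_eq_mul]
        ring
    rw [hM, Matrix.det_mul, Matrix.det_mul, Matrix.det_mul, Matrix.det_diagonal,
      Matrix.det_transpose]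

lemma D_eq_mul_det (x : Fin n → ℝ) :
    D x = (Matrix.vandermonde fun i => x i ^ 2).det * ∏ k : Fin n, (-1 : ℝ) ^ (k : ℕ) := by
  rw [D_eq_det, ← Matrix.det_diagonal, ← Matrix.det_mul]
  congr 1
  ext i j
  rw [Matrix.mul_diagonal, Matrix.vandermonde_apply, Matrix.vandermonde_apply, ← mul_pow]
  ring

lemma D_smul (x : Fin n → ℝ) (t : ℝ) :
    D (fun i => t * x i) = D x * ∏ k : Fin n, (t ^ 2) ^ (k : ℕ) := by
  rw [D_eq_det, D_eq_det, ← Matrix.det_diagonal, ← Matrix.det_mul]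
  congr 1
  ext i j
  rw [Matrix.mul_diagonal, Matrix.vandermonde_apply, Matrix.vandermonde_apply, ← mul_pow]
  ring

/-- The prefactor of the determinant formula is the inverse of the leading coefficient of the Bessel
determinant at the origin. -/
lemma prod_besselCoeff_mul (n : ℕ) : (∏ k : Fin n, besselCoeff k) *
    ((deltaFactorial n : ℝ) ^ 2 * (-4) ^ (n * (n - 1) / 2)) = 1 := by
  have h1 : (-4 : ℝ) ^ (n * (n - 1) / 2) = ∏ k : Fin n, (-4 : ℝ) ^ (k : ℕ) := by
    rw [Finset.prod_pow_eq_pow_sum, Fin.sum_univ_eq_sum_range (fun k => k), Finset.sum_range_id]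
  have h2 : (deltaFactorial n : ℝ) = ∏ k : Fin n, ((k : ℕ).factorial : ℝ) := by
    rw [deltaFactorial, Fin.prod_univ_eq_prod_range (fun k => (n - 1 - k).factorial),
      Finset.prod_range_reflect (fun k => k.factorial),
      Fin.prod_univ_eq_prod_range (fun k => (k.factorial : ℝ))]
    push_cast
    rfl
  rw [h1, h2, ← Finset.prod_pow, ← Finset.prod_mul_distrib, ← Finset.prod_mul_distrib]
  refine Finset.prod_eq_one fun k _ => ?_
  have hf : ((k : ℕ).factorial : ℝ) ≠ 0 := by positivity
  rw [besselCoeff]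
  have h3 : ((-4 : ℝ)) ^ (k : ℕ) = (-1) ^ (k : ℕ) * 4 ^ (k : ℕ) := by rw [← mul_pow]; norm_num
  have h4 : ((-1 : ℝ)) ^ (k : ℕ) * (-1) ^ (k : ℕ) = 1 := by rw [← mul_pow]; norm_num
  rw [h3]
  field_simp
  rw [sq, h4]

lemma continuous_diag : Continuous (diag : (Fin n → ℝ) → V n) :=
  Continuous.matrix_diagonal (continuous_pi fun i =>
    Complex.continuous_ofReal.comp (continuous_apply i))

lemma spherical_diag_eq_besselQuotient {x ξ : Fin n → ℝ} (h : D x * D ξ ≠ 0) :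
    spherical (diag x) (diag ξ) = (besselQuotient x ξ : ℝ) := by
  have hx : D x ≠ 0 := left_ne_zero_of_mul h
  have hξ : D ξ ≠ 0 := right_ne_zero_of_mul h
  obtain ⟨c, hc⟩ := exists_D_mul_spherical_eq hx
  have hs : (∏ k : Fin n, (-1 : ℝ) ^ (k : ℕ)) * ∏ k : Fin n, (-1 : ℝ) ^ (k : ℕ) = 1 := by
    rw [← Finset.prod_mul_distrib]
    exact Finset.prod_eq_one fun k _ => by rw [← mul_pow]; norm_num
  have hxv := D_eq_mul_det x
  have hξv := D_eq_mul_det ξ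
  set a := (Matrix.vandermonde fun i => x i ^ 2).det with ha
  set b := (Matrix.vandermonde fun i => ξ i ^ 2).det with hb
  obtain ⟨F, hFc, hF0, hF⟩ := exists_det_besselJ0_eq (x := x) (ξ := ξ)
    (fun h0 => hx (by rw [hxv, ha, h0, zero_mul])) (fun h0 => hξ (by rw [hξv, hb, h0, zero_mul]))
  have h1 : ∀ t : ℝ, t ≠ 0 → (D ξ : ℂ) * spherical (diag x) (diag fun i => t * ξ i) =
      c * ((a * (F t).det * b : ℝ) : ℂ) := by
    intro t ht
    have h2 := hc fun i => t * ξ i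
    rw [hF t, D_smul] at h2
    have h3 : ((∏ k : Fin n, (t ^ 2) ^ (k : ℕ) : ℝ) : ℂ) ≠ 0 := by
      rw [Complex.ofReal_ne_zero]
      exact Finset.prod_ne_zero_iff.mpr fun k _ => pow_ne_zero _ (pow_ne_zero _ ht)
    refine mul_left_cancel₀ h3 ?_
    rw [Complex.ofReal_mul] at h2
    rw [Complex.ofReal_mul, Complex.ofReal_mul] at h2
    rw [Complex.ofReal_mul, Complex.ofReal_mul]
    rw [Complex.ofReal_mul] at h2
    linear_combination h2
  -- Both sides of the scaled identity are continuous in t and agree for t ≠ 0. At t = 0 the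
  -- spherical function is 1, which determines c.
  have h2 : (D ξ : ℂ) = c * ((a * (∏ k : Fin n, besselCoeff k) * b : ℝ) : ℂ) := by
    have hl : Continuous fun t : ℝ => (D ξ : ℂ) * spherical (diag x) (diag fun i => t * ξ i) :=
      continuous_const.mul (Continuous.spherical continuous_const
        (continuous_diag.comp (by fun_prop)))
    have hr : Continuous fun t : ℝ => c * ((a * (F t).det * b : ℝ) : ℂ) :=
      continuous_const.mul (Complex.continuous_ofReal.comp
        ((continuous_const.mul hFc.matrix_det).mul continuous_const))
    have h3 := congrFun (Continuous.ext_on (dense_compl_singleton (0 : ℝ)) hl hr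
      fun t ht => h1 t ht) 0
    beta_reduce at h3
    rw [hF0] at h3
    rw [← h3]
    have : (diag fun i => (0 : ℝ) * ξ i) = (0 : V n) := by
      ext i j
      simp [diag, Matrix.diagonal_apply]
    rw [this, spherical_zero_right, mul_one]
  have h3 := hc ξ
  have h4 : a * b = D x * D ξ := by rw [hxv, hξv]; linear_combination -a * b * hs
  have hp := prod_besselCoeff_mul n
  set p := ∏ k : Fin n, besselCoeff k
  set q := (deltaFactorial n : ℝ) ^ 2 * (-4) ^ (n * (n - 1) / 2) with hq
  set J := (Matrix.of fun j k => besselJ0 (x j * ξ k)).det with hJ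
  have h5 : besselQuotient x ξ = q / (D x * D ξ) * J := by
    rw [besselQuotient, hq]; ring
  have hxc : (D x : ℂ) ≠ 0 := Complex.ofReal_ne_zero.mpr hx
  have hξc : (D ξ : ℂ) ≠ 0 := Complex.ofReal_ne_zero.mpr hξ
  have h6 : c * (D x : ℂ) * p = 1 := by
    have e : a * p * b = D x * D ξ * p := by linear_combination p * h4
    rw [e] at h2
    push_cast at h2
    refine mul_left_cancel₀ hξc ?_
    linear_combination -h2
  have hpc : (p : ℂ) * q = 1 := by exact_mod_cast hp
  have h7 : c * D x = q := by linear_combination (-c * D x) * hpc + q * h6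
  rw [h5]
  push_cast
  rw [div_mul_eq_mul_div, eq_div_iff (mul_ne_zero hxc hξc)]
  linear_combination (D x : ℂ) * h3 + J * h7

/-- On the nondegenerate set the quotient is the spherical function, which is jointly continuous
everywhere. -/
lemma tendsto_besselQuotient (x ξ : Fin n → ℝ) :
    Tendsto (fun p : (Fin n → ℝ) × (Fin n → ℝ) => ((besselQuotient p.1 p.2 : ℝ) : ℂ))
      (𝓝[{p | D p.1 * D p.2 ≠ 0}] (x, ξ)) (𝓝 (spherical (diag x) (diag ξ))) := by
  have h1 : Continuous fun p : (Fin n → ℝ) × (Fin n → ℝ) => spherical (diag p.1) (diag p.2) :=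
    Continuous.spherical (continuous_diag.comp continuous_fst) (continuous_diag.comp continuous_snd)
  refine Tendsto.congr' ?_ (h1.continuousAt.continuousWithinAt (x := (x, ξ)))
  filter_upwards [self_mem_nhdsWithin] with p hp
  exact spherical_diag_eq_besselQuotient hp

end Constant

end

end SphericalMatrix

/-- The spherical functions of positive type of `(G_n, K_n)` are exactly the Fourier transforms of
the orbital measures `μ_x` of real diagonal matrices `x`, and on real diagonal matrices they are
given by the Bessel quotient, which is read by continuous extension where `D(x) D(ξ) = 0`. -/
theorem corollary2p4 (n : ℕ) :
    (∀ φ : SphericalMatrix.G n → ℂ,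
      SphericalMatrix.IsSphericalOfPositiveType φ ↔
        ∃ x : Fin n → ℝ, ∀ g : SphericalMatrix.G n,
          φ g = SphericalMatrix.fourier
            (SphericalMatrix.orbitalMeasure (SphericalMatrix.diag x))
            (Multiplicative.toAdd g.left)) ∧
    (∀ x ξ : Fin n → ℝ, SphericalMatrix.D x * SphericalMatrix.D ξ ≠ 0 →
      SphericalMatrix.fourier (SphericalMatrix.orbitalMeasure (SphericalMatrix.diag x))
          (SphericalMatrix.diag ξ) =
        ((SphericalMatrix.besselQuotient x ξ : ℝ) : ℂ)) ∧
    (∀ x ξ : Fin n → ℝ,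
      Tendsto
        (fun p : (Fin n → ℝ) × (Fin n → ℝ) =>
          ((SphericalMatrix.besselQuotient p.1 p.2 : ℝ) : ℂ))
        (𝓝[{p | SphericalMatrix.D p.1 * SphericalMatrix.D p.2 ≠ 0}] (x, ξ))
        (𝓝 (SphericalMatrix.fourier
          (SphericalMatrix.orbitalMeasure (SphericalMatrix.diag x))
          (SphericalMatrix.diag ξ)))) := by
  simp_rw [SphericalMatrix.fourier_orbitalMeasure]
  refine ⟨fun φ => ?_, fun x ξ h => SphericalMatrix.spherical_diag_eq_besselQuotient h,
    SphericalMatrix.tendsto_besselQuotient⟩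
  simpa only [SphericalMatrix.fourier_orbitalMeasure] using
    SphericalMatrix.isSphericalOfPositiveType_iff φ
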